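/- Let $m\ge 1$ and let $\pi=e^{-U}$ and $\mathfrak g=e^{-V}$ be everywhere positive, twice continuously differentiable probability densities on $\mathbb R^m$ (the target and the auxiliary density; no symmetry of $\mathfrak g$ is assumed). Let $R>0$, $B_R=\{x\in\mathbb R^m:|x|\le R\}$, and suppose that $\pi$ and $\mathfrak g$ are strictly log-concave outside $B_R$, that is, there are constants $0<c\le C<\infty$ with $c\,|v|^2\le \langle U''(x)v,v\rangle\le C\,|v|^2$ and $c\,|v|^2\le\langle V''(x)v,v\rangle\le C\,|v|^2$ for all $x\notin B_R$ and all $v\in\mathbb R^m$. Let $t\mapsto (Q(t),P(t))$, $t\in\mathbb R$, denote the exact solution of Hamilton's equations $\dot Q=\nabla V(P)$, $\dot P=-\nabla U(Q)$ with $(Q(0),P(0))=(q,p)$, and put $\bar U(t)=\frac1t\int_0^t U''(Q(s))\,ds$, $\bar V(t)=\frac1t\int_0^t V''(P(s))\,ds$ and $A(t)=\sqrt{\bar V(t)\bar U(t)}:=\bar U(t)^{-1/2}\big(\bar U(t)^{1/2}\,\bar V(t)\,\bar U(t)^{1/2}\big)^{1/2}\bar U(t)^{1/2}$ wherever $\bar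 U(t)$ and $\bar V(t)$ are positive definite. For $T>0$ let $|A|_{B_R^c}$ be the supremum of the operator norms $|A(t)|$ over all $0<t\le T$ and all initial points $(q,p)$ for which $Q(s)\notin B_R$ and $P(s)\notin B_R$ for every $s\in[0,t]$. One iteration of Alternating Direction Hamiltonian Monte Carlo (AD-HMC) with exact dynamics sends a position $q$ to $q_1$ as follows: draw $p$ from $\mathfrak g$ independently and let $q'=Q(T)$ for the motion started at $(q,p)$; then draw a fresh $p'$ from $\mathfrak g$ independently and let $q_1=Q(-T)$ for the motion started at $(q',p')$. For an initial law $\mu_0$ on $\mathbb R^m$ let $\mu_n$ be the law of the position after $n$ iterations. If $0<T<\pi/|A|_{B_R^c}$ (here $\pi$ is the number $3.14\ldots$), then AD-HMC converges geometrically to the target in the Wasserstein distance $W_1$ (with the Euclidean metric): there are constants $K>0$ and $\rho\in(0,1)$ such that, for every probability measure $\mu_0$ on $\mathbb R^m$ with $\int|q|\,d\mu_0<\infty$ and every $n\ge 0$, $$W_1\big(\mu_n,\ \pi(q)\,dq\big)\ \le\ K\,\rho^{\,n}\Big(1+\int|q|\,d\mu_0(q)\Big).$$ -/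

import Mathlib

open MeasureTheory Set
open scoped ENNReal

noncomputable section

namespace ADHMC

/-- The position space and the momentum space: `ℝ^m` with the Euclidean metric. -/
abbrev E (m : ℕ) : Type := EuclideanSpace ℝ (Fin m)

variable {m : ℕ}

/-- The energy `-log f` of a density `f`: it is `U` for the target and `V` for the auxiliary. -/
def energy (f : E m → ℝ) : E m → ℝ := fun x => -Real.log (f x)

/-- The measure with density `f` with respect to Lebesgue measure. -/
def densityMeasure (f : E m → ℝ) : Measure (E m) :=
  volume.withDensity fun x => ENNReal.ofReal (f x)

/-- A twice continuously differentiable, everywhere positive probability density on `ℝ^m`. -/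
structure IsRegularDensity (f : E m → ℝ) : Prop where
  contDiff : ContDiff ℝ 2 f
  pos : ∀ x, 0 < f x
  lintegral_eq_one : ∫⁻ x, ENNReal.ofReal (f x) = 1

/-- The Hessian of `F` at `x`, as an operator. -/
def hess (F : E m → ℝ) (x : E m) : E m →L[ℝ] E m := fderiv ℝ (gradient F) x

/-- Strict log-concavity outside the closed ball `B_R` about the origin: there the spectrum of the
Hessian of `-log f` is bounded away from `0` and from `∞`, uniformly. -/
def StrictlyLogConcaveOutside (f : E m → ℝ) (R : ℝ) : Prop :=
  ∃ c C : ℝ, 0 < c ∧ ∀ x : E m, R < ‖x‖ → ∀ v : E m,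
    c * ‖v‖ ^ 2 ≤ inner ℝ (hess (energy f) x v) v ∧
      inner ℝ (hess (energy f) x v) v ≤ C * ‖v‖ ^ 2

/-- `γ = (Q, P)` solves Hamilton's equations for `H(q, p) = U q + V p` on the whole time axis. -/
def IsHamiltonianMotion (U V : E m → ℝ) (γ : ℝ → E m × E m) : Prop :=
  ∀ t : ℝ, HasDerivAt γ (gradient V (γ t).2, -gradient U (γ t).1) t

open Classical in
/-- The exact Hamiltonian motion for time `t` (of either sign) started at `z = (q, p)`. The second
branch is never used when the gradients of `U` and `V` are globally Lipschitz. -/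
def motion (U V : E m → ℝ) (t : ℝ) (z : E m × E m) : E m × E m :=
  if h : ∃ γ : ℝ → E m × E m, IsHamiltonianMotion U V γ ∧ γ 0 = z then h.choose t else z

/-- The time average over `[0, t]` of the Hessian of `V` along the momentum. -/
def avgHessV (U V : E m → ℝ) (z : E m × E m) (t : ℝ) : E m →L[ℝ] E m :=
  t⁻¹ • ∫ s in (0 : ℝ)..t, hess V (motion U V s z).2

/-- The time average over `[0, t]` of the Hessian of `U` along the position. -/
def avgHessU (U V : E m → ℝ) (z : E m × E m) (t : ℝ) : E m →L[ℝ] E m :=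
  t⁻¹ • ∫ s in (0 : ℝ)..t, hess U (motion U V s z).1

/-- The positive semidefinite square root of a positive semidefinite matrix. -/
def rootMatrix (S : Matrix (Fin m) (Fin m) ℝ) : Matrix (Fin m) (Fin m) ℝ := cfc Real.sqrt S

/-- The square root of the product `V U` of two symmetric positive definite matrices, which is
`√U⁻¹ √(√U V √U) √U`. -/
def rootProdMatrix (V U : Matrix (Fin m) (Fin m) ℝ) : Matrix (Fin m) (Fin m) ℝ :=
  (rootMatrix U)⁻¹ * rootMatrix (rootMatrix U * V * rootMatrix U) * rootMatrix U

theorem rootMatrix_isHermitian (S : Matrix (Fin m) (Fin m) ℝ) : (rootMatrix S).IsHermitian :=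
  cfc_predicate (R := ℝ) (A := Matrix (Fin m) (Fin m) ℝ) Real.sqrt S

theorem rootMatrix_mul_self {S : Matrix (Fin m) (Fin m) ℝ} (hS : S.PosSemidef) :
    rootMatrix S * rootMatrix S = S := by
  have hsa : IsSelfAdjoint S := hS.1
  unfold rootMatrix
  rw [← cfc_mul Real.sqrt Real.sqrt S]
  conv_rhs => rw [← cfc_id ℝ S hsa]
  refine cfc_congr fun x hx => ?_
  rw [hS.1.spectrum_real_eq_range_eigenvalues] at hx
  obtain ⟨i, rfl⟩ := hx
  exact Real.mul_self_sqrt (hS.eigenvalues_nonneg i)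

/-- `rootProdMatrix V U` is indeed a square root of `V U`. -/
theorem rootProdMatrix_mul_self {V U : Matrix (Fin m) (Fin m) ℝ} (hV : V.PosDef) (hU : U.PosDef) :
    rootProdMatrix V U * rootProdMatrix V U = V * U := by
  have hr : rootMatrix U * rootMatrix U = U := rootMatrix_mul_self hU.posSemidef
  have hdet : IsUnit (rootMatrix U).det := by
    have h : IsUnit (rootMatrix U * rootMatrix U).det := by
      rw [hr]; exact hU.det_pos.ne'.isUnit
    rw [Matrix.det_mul] at h
    exact isUnit_of_mul_isUnit_left h
  have hs : rootMatrix (rootMatrix U * V * rootMatrix U) *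
      rootMatrix (rootMatrix U * V * rootMatrix U) = rootMatrix U * V * rootMatrix U := by
    refine rootMatrix_mul_self ?_
    have h := hV.posSemidef.mul_mul_conjTranspose_same (rootMatrix U)
    rwa [(rootMatrix_isHermitian U).eq] at h
  unfold rootProdMatrix
  generalize rootMatrix (rootMatrix U * V * rootMatrix U) = s at hs ⊢
  generalize rootMatrix U = r at *
  calc r⁻¹ * s * r * (r⁻¹ * s * r) = r⁻¹ * s * (r * r⁻¹) * s * r := by noncomm_ring
    _ = r⁻¹ * (s * s) * r := by rw [Matrix.mul_nonsing_inv _ hdet]; noncomm_ring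
    _ = (r⁻¹ * r) * V * (r * r) := by rw [hs]; noncomm_ring
    _ = V * U := by rw [Matrix.nonsing_inv_mul _ hdet, hr, one_mul]

/-- The operator `A = √(V̄ Ū)` at time `t` for the motion started at `z`. -/
def opA (U V : E m → ℝ) (z : E m × E m) (t : ℝ) : E m →L[ℝ] E m :=
  Matrix.toEuclideanCLM (𝕜 := ℝ) (n := Fin m) (rootProdMatrix
    ((Matrix.toEuclideanCLM (𝕜 := ℝ) (n := Fin m)).symm (avgHessV U V z t))
    ((Matrix.toEuclideanCLM (𝕜 := ℝ) (n := Fin m)).symm (avgHessU U V z t)))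

/-- The supremum `|A|` over the complement of `B_R`: the largest operator norm of `A = √(V̄ Ū)`
over all times `0 < t ≤ T` and all motions whose position and momentum stay outside `B_R`
during `[0, t]`, so that the averages `V̄` and `Ū` involve only Hessians outside `B_R`. -/
def normAOutside (U V : E m → ℝ) (R T : ℝ) : ℝ≥0∞ :=
  ⨆ (z : E m × E m) (t : ℝ) (_ : 0 < t ∧ t ≤ T)
    (_ : ∀ s ∈ Icc 0 t, R < ‖(motion U V s z).1‖ ∧ R < ‖(motion U V s z).2‖), ‖opA U V z t‖ₑ

/-- One Hamiltonian move of duration `t` on laws of positions: draw a fresh momentum from the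
auxiliary distribution, move, and keep the position. -/
def hmcMove (target aux : E m → ℝ) (t : ℝ) (μ : Measure (E m)) : Measure (E m) :=
  (μ.prod (densityMeasure aux)).map fun z => (motion (energy target) (energy aux) t z).1

/-- One iteration of the alternating direction algorithm on laws of positions: a forward move of
duration `T` followed by a backward move of duration `-T` with a fresh momentum. -/
def adhmcStep (target aux : E m → ℝ) (T : ℝ) (μ : Measure (E m)) : Measure (E m) :=
  hmcMove target aux (-T) (hmcMove target aux T μ)

/-- The Wasserstein distance `W₁`, as an infimum over all couplings. -/
def W1 (μ ν : Measure (E m)) : ℝ≥0∞ :=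
  ⨅ (γ : Measure (E m × E m)) (_ : γ.map Prod.fst = μ ∧ γ.map Prod.snd = ν),
    ∫⁻ z, edist z.1 z.2 ∂γ

/-- Geometric convergence in `W₁` of the recursion `μ ↦ step μ` to `ν`. The constants `C` and `ρ` do
not depend on the initial law `μ`. -/
def ConvergesGeometrically (step : Measure (E m) → Measure (E m)) (ν : Measure (E m)) : Prop :=
  ∃ C ρ : ℝ, 0 < C ∧ 0 < ρ ∧ ρ < 1 ∧
    ∀ μ : Measure (E m), IsProbabilityMeasure μ → ∫⁻ q, ‖q‖ₑ ∂μ < ∞ → ∀ n : ℕ,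
      W1 (step^[n] μ) ν ≤ ENNReal.ofReal (C * ρ ^ n) * (1 + ∫⁻ q, ‖q‖ₑ ∂μ)

end ADHMC

end

/-! Fix `a` above the norm of `A` with `a * T < π`. Letting the averaging time tend to `0` turns the
bound on `A` into a pointwise comparison of Hessians, `⟨U''(q) V''(p) v, V''(p) v⟩ ≤ a² ⟨V''(p) v,
v⟩`, for all `q` and `p` outside the ball, chosen independently of each other
(`form_le_of_normAOutside_le`). By this independence a supremum over `q` or over `p` may be taken.
The supremum of the forms is the square of a fixed seminorm, in which the dynamics is compared with
an oscillator of frequency `a`, whose conjugate points are `π / a` apart. The comparison is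
`sturm_estimate`, a Wirtinger inequality combined with the derivative of `⟨x, y⟩`. It is used twice.

Applied to a motion, it bounds the initial point by the momenta at the two ends
(`boundary_control`). If the position is far out and the fresh momentum is moderate, the final
momentum must be large; by conservation of energy its share is taken from `U`. Hence `√(U + const)`
satisfies a geometric drift condition for each move, forward or backward (`sqrt_energy_drift`).

Applied to the linearized motion, it excludes nonzero variations that fix both end positions,
provided that the motion spends little time in the ball (`variation_eq_zero`). A large initial
momentum guarantees this (`exists_badTimes_small`). Then the final position is a local
diffeomorphism of the initial momentum, so its law dominates a multiple of Lebesgue measure near a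
point. As `V` need not be even, reversing the momentum is not available; the backward move retraces
the same orbit instead and brings the minorization back to the starting point
(`exists_minorization_forward_backward`). A chain of small balls makes it uniform on large balls.

Drift and minorization give a contracting coupling (Harris' theorem, `exists_contracting_coupling`)
for a cost that dominates the Euclidean distance. Liouville's theorem and conservation of energy
show that the target is invariant. -/

/-! ### Global solutions of Lipschitz equations and Grönwall bounds. -/

section ODE

open scoped NNReal Topology BoundedContinuousFunction

variable {F : Type*} [NormedAddCommGroup F] [NormedSpace ℝ F]

/-- Integration gains a factor `1 / l` in the norm weighted by `exp (l |t|)`, which makes the Picard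
map a contraction on the whole line. -/
theorem norm_integral_le_exp_weight {g : ℝ → F} {D l : ℝ} (hD : 0 ≤ D) (hl : 0 < l)
    (hg : ∀ s, ‖g s‖ ≤ D * Real.exp (l * |s|)) (t : ℝ) :
    ‖∫ s in (0 : ℝ)..t, g s‖ ≤ D / l * Real.exp (l * |t|) := by
  have key : ∀ f : ℝ → F, (∀ s, ‖f s‖ ≤ D * Real.exp (l * |s|)) → ∀ t, 0 ≤ t →
      ‖∫ s in (0 : ℝ)..t, f s‖ ≤ D / l * Real.exp (l * |t|) := by
    intro f hf t ht
    have h1 : ‖∫ s in (0 : ℝ)..t, f s‖ ≤ ∫ s in (0 : ℝ)..t, D * Real.exp (l * s) := by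
      refine intervalIntegral.norm_integral_le_of_norm_le ht ?_ ?_
      · refine Filter.Eventually.of_forall fun s hs => ?_
        simpa [abs_of_pos hs.1] using hf s
      · exact (Continuous.intervalIntegrable (by fun_prop) _ _)
    have h2 : ∫ s in (0 : ℝ)..t, D * Real.exp (l * s) = D / l * (Real.exp (l * t) - 1) := by
      rw [intervalIntegral.integral_eq_sub_of_hasDerivAt
        (f := fun s => D / l * Real.exp (l * s)) (fun s _ => ?_)
        (Continuous.intervalIntegrable (by fun_prop) _ _)]
      · simp; ring
      · have := ((hasDerivAt_id s).const_mul l).exp.const_mul (D / l)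
        refine this.congr_deriv ?_
        simp only [id]
        field_simp
    rw [abs_of_nonneg ht]
    rw [h2] at h1
    refine h1.trans ?_
    have : 0 ≤ D / l := by positivity
    nlinarith
  rcases le_total 0 t with ht | ht
  · exact key g hg t ht
  · have h := key (fun s => g (-s)) (fun s => by simpa using hg (-s)) (-t) (by linarith)
    rw [intervalIntegral.integral_comp_neg] at h
    rw [intervalIntegral.integral_symm] at h
    simpa using h

/-- A continuous time-dependent vector field, uniformly Lipschitz in space and bounded at the
origin, has an integral curve on the whole time axis through every point. -/
theorem exists_global_integralCurve [CompleteSpace F] {v : ℝ → F → F} {K : ℝ≥0} {B : ℝ}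
    (hv : Continuous (Function.uncurry v)) (hK : ∀ t, LipschitzWith K (v t))
    (hB : ∀ t, ‖v t 0‖ ≤ B) (z : F) :
    ∃ γ : ℝ → F, γ 0 = z ∧ ∀ t, HasDerivAt γ (v t (γ t)) t := by
  have hB0 : 0 ≤ B := (norm_nonneg _).trans (hB 0)
  -- The Picard map has Lipschitz constant `K / l` in the weighted norm, and this `l` makes it at
  -- most `1 / 2`. The unknown `η` below is the curve divided by the weight `w`, so that it is
  -- bounded.
  set l : ℝ := 2 * K + 1 with hl
  have hl0 : 0 < l := by positivity
  set w : ℝ → ℝ := fun t => Real.exp (l * |t|) with hw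
  have hwc : Continuous w := by fun_prop
  have hw1 : ∀ t, 1 ≤ w t := fun t => Real.one_le_exp (by positivity)
  have hwpos : ∀ t, 0 < w t := fun t => Real.exp_pos _
  have hcont : ∀ η : ℝ →ᵇ F, Continuous fun s => v s (w s • η s) := fun η =>
    hv.comp (continuous_id.prodMk (hwc.smul η.continuous))
  have hint : ∀ (η : ℝ →ᵇ F) t, IntervalIntegrable (fun s => v s (w s • η s)) volume 0 t :=
    fun η t => (hcont η).intervalIntegrable _ _
  have hbd : ∀ (η : ℝ →ᵇ F) s, ‖v s (w s • η s)‖ ≤ (B + K * ‖η‖) * w s := by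
    intro η s
    have h1 : ‖v s (w s • η s) - v s 0‖ ≤ K * ‖w s • η s‖ := by
      simpa [dist_eq_norm] using (hK s).dist_le_mul (w s • η s) 0
    have h2 : ‖w s • η s‖ ≤ w s * ‖η‖ := by
      rw [norm_smul, Real.norm_of_nonneg (hwpos s).le]
      exact mul_le_mul_of_nonneg_left (η.norm_coe_le_norm s) (hwpos s).le
    have h3 : ‖v s (w s • η s)‖ ≤ ‖v s (w s • η s) - v s 0‖ + ‖v s 0‖ := by
      simpa using norm_add_le (v s (w s • η s) - v s 0) (v s 0)
    have h4 : (K : ℝ) * ‖w s • η s‖ ≤ K * (w s * ‖η‖) := by gcongr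
    nlinarith [hB s, hw1 s]
  let Φ : (ℝ →ᵇ F) → (ℝ →ᵇ F) := fun η => BoundedContinuousFunction.ofNormedAddCommGroup
    (fun t => (w t)⁻¹ • (z + ∫ s in (0 : ℝ)..t, v s (w s • η s)))
    (by
      refine (hwc.inv₀ fun t => (hwpos t).ne').smul (continuous_const.add ?_)
      exact intervalIntegral.continuous_primitive (fun a b => (hcont η).intervalIntegrable _ _) 0)
    (‖z‖ + (B + K * ‖η‖) / l)
    (by
      intro t
      rw [norm_smul, norm_inv, Real.norm_of_nonneg (hwpos t).le, inv_mul_le_iff₀ (hwpos t)]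
      refine (norm_add_le _ _).trans ?_
      have h1 := norm_integral_le_exp_weight (by positivity) hl0 (hbd η) t
      have : ‖z‖ ≤ w t * ‖z‖ := le_mul_of_one_le_left (norm_nonneg _) (hw1 t)
      change _ ≤ _ * w t at h1
      linarith)
  have hΦ : ∀ η t, Φ η t = (w t)⁻¹ • (z + ∫ s in (0 : ℝ)..t, v s (w s • η s)) := fun η t => rfl
  have hcontr : ContractingWith (1 / 2) Φ := by
    refine ⟨by rw [← NNReal.coe_lt_coe]; norm_num, LipschitzWith.of_dist_le_mul fun η ξ => ?_⟩
    refine (BoundedContinuousFunction.dist_le (by positivity)).2 fun t => ?_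
    rw [hΦ, hΦ, dist_eq_norm, ← smul_sub, add_sub_add_left_eq_sub,
      ← intervalIntegral.integral_sub (hint η t) (hint ξ t), norm_smul, norm_inv,
      Real.norm_of_nonneg (hwpos t).le, inv_mul_le_iff₀ (hwpos t)]
    have h1 : ∀ s, ‖v s (w s • η s) - v s (w s • ξ s)‖ ≤ (K * dist η ξ) * Real.exp (l * |s|) := by
      intro s
      rw [← dist_eq_norm]
      refine ((hK s).dist_le_mul _ _).trans ?_
      rw [dist_smul₀, Real.norm_of_nonneg (hwpos s).le]
      have := η.dist_coe_le_dist (g := ξ) s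
      calc (K : ℝ) * (w s * dist (η s) (ξ s)) ≤ K * (w s * dist η ξ) := by
            have := (hwpos s).le
            gcongr
        _ = _ := by ring
    refine (norm_integral_le_exp_weight (by positivity) hl0 h1 t).trans ?_
    have : (K : ℝ) * dist η ξ / l ≤ 1 / 2 * dist η ξ := by
      rw [div_le_iff₀ hl0, hl]
      nlinarith [dist_nonneg (x := η) (y := ξ)]
    calc _ ≤ (1 / 2 * dist η ξ) * Real.exp (l * |t|) := by gcongr
      _ = _ := by simp [hw]; ring
  obtain ⟨η, hη⟩ : ∃ η, Φ η = η := ⟨_, hcontr.fixedPoint_isFixedPt⟩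
  have hγ : ∀ t, w t • η t = z + ∫ s in (0 : ℝ)..t, v s (w s • η s) := by
    intro t
    have := hΦ η t
    rw [hη] at this
    rw [this, smul_smul, mul_inv_cancel₀ (hwpos t).ne', one_smul]
  refine ⟨fun t => w t • η t, by simpa using hγ 0, fun t => ?_⟩
  have h := ((hcont η).integral_hasStrictDerivAt 0 t).hasDerivAt.const_add z
  convert h using 1
  exact funext hγ

theorem dist_integralCurve_le {v : ℝ → F → F} {K : ℝ≥0} (hK : ∀ t, LipschitzWith K (v t))
    {γ δ : ℝ → F} (hγ : ∀ t, HasDerivAt γ (v t (γ t)) t) (hδ : ∀ t, HasDerivAt δ (v t (δ t)) t)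
    (s t : ℝ) : dist (γ t) (δ t) ≤ dist (γ s) (δ s) * Real.exp (K * |t - s|) := by
  have fwd : ∀ {v : ℝ → F → F} (_ : ∀ t, LipschitzWith K (v t)) {γ δ : ℝ → F}
      (_ : ∀ t, HasDerivAt γ (v t (γ t)) t) (_ : ∀ t, HasDerivAt δ (v t (δ t)) t) (s t : ℝ),
      s ≤ t → dist (γ t) (δ t) ≤ dist (γ s) (δ s) * Real.exp (K * |t - s|) := by
    intro v hK γ δ hγ hδ s t hst
    rw [abs_of_nonneg (by linarith)]
    exact dist_le_of_trajectories_ODE hK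
      (fun u _ => (hγ u).continuousAt.continuousWithinAt) (fun u _ => (hγ u).hasDerivWithinAt)
      (fun u _ => (hδ u).continuousAt.continuousWithinAt) (fun u _ => (hδ u).hasDerivWithinAt)
      le_rfl t ⟨hst, le_rfl⟩
  rcases le_total s t with h | h
  · exact fwd hK hγ hδ s t h
  · have := fwd (v := fun t x => -v (-t) x) (fun t => (hK (-t)).neg)
      (γ := fun t => γ (-t)) (δ := fun t => δ (-t))
      (fun u => by simpa [Function.comp_def] using (hγ (-u)).scomp u (hasDerivAt_neg u))
      (fun u => by simpa [Function.comp_def] using (hδ (-u)).scomp u (hasDerivAt_neg u)) (-s) (-t) (by linarith)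
    simpa [abs_sub_comm, neg_add_eq_sub] using this

theorem integralCurve_eq {v : ℝ → F → F} {K : ℝ≥0} (hK : ∀ t, LipschitzWith K (v t))
    {γ δ : ℝ → F} (hγ : ∀ t, HasDerivAt γ (v t (γ t)) t) (hδ : ∀ t, HasDerivAt δ (v t (δ t)) t)
    {s : ℝ} (h : γ s = δ s) : γ = δ := by
  ext t
  have := dist_integralCurve_le hK hγ hδ s t
  rw [h, dist_self, zero_mul] at this
  exact dist_le_zero.1 this

/-- Along a curve whose speed is at most `K (1 + ‖γ‖)`, the quantity `1 + ‖γ‖` grows at most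
exponentially. -/
theorem one_add_norm_le_exp {γ γ' : ℝ → F} {K : ℝ} (hK : 0 < K)
    (hγ : ∀ t, HasDerivAt γ (γ' t) t) (hb : ∀ t, ‖γ' t‖ ≤ K * (1 + ‖γ t‖)) (s t : ℝ) :
    1 + ‖γ t‖ ≤ (1 + ‖γ s‖) * Real.exp (K * |t - s|) := by
  have fwd : ∀ {γ γ' : ℝ → F} (_ : ∀ t, HasDerivAt γ (γ' t) t)
      (_ : ∀ t, ‖γ' t‖ ≤ K * (1 + ‖γ t‖)) (s t : ℝ), s ≤ t →
      1 + ‖γ t‖ ≤ (1 + ‖γ s‖) * Real.exp (K * |t - s|) := by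
    intro γ γ' hγ hb s t hst
    have := norm_le_gronwallBound_of_norm_deriv_right_le (f := γ) (f' := γ') (δ := ‖γ s‖)
      (K := K) (ε := K) (a := s) (b := t)
      (fun u _ => (hγ u).continuousAt.continuousWithinAt) (fun u _ => (hγ u).hasDerivWithinAt)
      le_rfl (fun u _ => by linarith [hb u]) t ⟨hst, le_rfl⟩
    rw [gronwallBound_of_K_ne_0 hK.ne', div_self hK.ne'] at this
    rw [abs_of_nonneg (by linarith)]
    linarith
  rcases le_total s t with h | h
  · exact fwd hγ hb s t h
  · have := fwd (γ := fun t => γ (-t)) (γ' := fun t => -γ' (-t))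
      (fun u => by simpa [Function.comp_def] using (hγ (-u)).scomp u (hasDerivAt_neg u))
      (fun u => by simpa using hb (-u)) (-s) (-t) (by linarith)
    simpa [abs_sub_comm, neg_add_eq_sub] using this

end ODE

/-! ### Gradient fields that are uniformly convex outside a ball. -/

section Force

variable {X : Type*} [NormedAddCommGroup X] [InnerProductSpace ℝ X]

/-- A gradient field `g` with derivative `H`, which is symmetric, bounded by `K`, and at least `c`
outside the ball of radius `R`. -/
structure IsForce (g : X → X) (H : X → X →L[ℝ] X) (R c K : ℝ) : Prop where
  hasFDerivAt : ∀ x, HasFDerivAt g (H x) x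
  continuous_deriv : Continuous H
  symm : ∀ x u v, inner ℝ (H x u) v = inner ℝ u (H x v)
  norm_le : ∀ x, ‖H x‖ ≤ K
  lower : ∀ x, R < ‖x‖ → ∀ v, c * ‖v‖ ^ 2 ≤ inner ℝ (H x v) v
  c_pos : 0 < c
  K_pos : 0 < K
  R_pos : 0 < R

namespace IsForce

variable {g : X → X} {H : X → X →L[ℝ] X} {R c K : ℝ}

theorem mono (h : IsForce g H R c K) {c' K' : ℝ} (hc' : 0 < c') (hc : c' ≤ c) (hK : K ≤ K') :
    IsForce g H R c' K' :=
  ⟨h.hasFDerivAt, h.continuous_deriv, h.symm, fun x => (h.norm_le x).trans hK,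
    fun x hx v => (mul_le_mul_of_nonneg_right hc (sq_nonneg _)).trans (h.lower x hx v), hc',
    h.K_pos.trans_le hK, h.R_pos⟩

theorem continuous (h : IsForce g H R c K) : Continuous g :=
  continuous_iff_continuousAt.2 fun x => (h.hasFDerivAt x).continuousAt

theorem lipschitz (h : IsForce g H R c K) : LipschitzWith K.toNNReal g := by
  refine lipschitzWith_of_nnnorm_fderiv_le (𝕜 := ℝ)
    (fun x => (h.hasFDerivAt x).differentiableAt) fun x => ?_
  rw [(h.hasFDerivAt x).fderiv, ← NNReal.coe_le_coe, coe_nnnorm, Real.coe_toNNReal _ h.K_pos.le]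
  exact h.norm_le x

theorem norm_sub_le (h : IsForce g H R c K) (x y : X) : ‖g x - g y‖ ≤ K * ‖x - y‖ := by
  simpa [dist_eq_norm, Real.coe_toNNReal _ h.K_pos.le] using h.lipschitz.dist_le_mul x y

theorem inner_le (h : IsForce g H R c K) (x v : X) : inner ℝ (H x v) v ≤ K * ‖v‖ ^ 2 := by
  calc inner ℝ (H x v) v ≤ ‖H x v‖ * ‖v‖ := real_inner_le_norm _ _
    _ ≤ (K * ‖v‖) * ‖v‖ := by
      gcongr; exact (H x).le_of_opNorm_le (h.norm_le x) v
    _ = _ := by ring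

theorem inner_nonneg (h : IsForce g H R c K) {x : X} (hx : R < ‖x‖) (v : X) :
    0 ≤ inner ℝ (H x v) v :=
  (mul_nonneg h.c_pos.le (sq_nonneg _)).trans (h.lower x hx v)

theorem norm_apply_ge (h : IsForce g H R c K) {x : X} (hx : R < ‖x‖) (v : X) :
    c * ‖v‖ ≤ ‖H x v‖ := by
  rcases eq_or_ne v 0 with rfl | hv
  · simp
  have h1 := (h.lower x hx v).trans (real_inner_le_norm _ _)
  have h2 : 0 < ‖v‖ := norm_pos_iff.2 hv
  nlinarith

/-- Young's inequality for the form given by `H x`. -/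
theorem two_inner_le (h : IsForce g H R c K) {x : X} (hx : R < ‖x‖) {a : ℝ} (ha : 0 < a)
    (u w : X) :
    2 * inner ℝ (H x u) w ≤ a ^ 2 * inner ℝ (H x u) u + (a ^ 2)⁻¹ * inner ℝ (H x w) w := by
  have h1 := h.inner_nonneg hx (a • u - a⁻¹ • w)
  have h2 : inner ℝ (H x w) u = inner ℝ (H x u) w := by
    rw [h.symm, real_inner_comm]
  have ha' : a * a⁻¹ = 1 := mul_inv_cancel₀ ha.ne'
  simp only [map_sub, map_smul, inner_sub_left, inner_sub_right, inner_smul_left,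
    inner_smul_right, h2, conj_trivial] at h1
  rw [← inv_pow]
  have : inner ℝ (H x u) w = (a * a⁻¹) * inner ℝ (H x u) w := by rw [ha', one_mul]
  rw [this]
  nlinarith

/-- The mean value theorem for a scalar function of `r`. Since `w` is arbitrary, it may depend on
the increment `g (x + d) - g x` itself, as it does in `form_force_le`. -/
theorem inner_sub_le_of_segment (h : IsForce g H R c K) {x d w : X} {B : ℝ}
    (hB : ∀ r ∈ Ioo (0 : ℝ) 1, inner ℝ (H (x + r • d) d) w ≤ B) :
    inner ℝ (g (x + d) - g x) w ≤ B := by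
  have hd : ∀ r : ℝ, HasDerivAt (fun r : ℝ => inner ℝ (g (x + r • d)) w)
      (inner ℝ (H (x + r • d) d) w) r := by
    intro r
    have h1 : HasDerivAt (fun r : ℝ => x + r • d) d r := by
      simpa using ((hasDerivAt_id r).smul_const d).const_add x
    have h2 := (h.hasFDerivAt (x + r • d)).comp_hasDerivAt r h1
    simpa using h2.inner ℝ (hasDerivAt_const r w)
  obtain ⟨r, hr, hr'⟩ := exists_hasDerivAt_eq_slope _ _ zero_lt_one
    (fun r _ => (hd r).continuousAt.continuousWithinAt) (fun r _ => hd r)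
  have := hB r hr
  rw [hr'] at this
  simpa [inner_sub_left] using this

/-- The radial segment that is used to leave the ball. -/
theorem radial_segment (h : IsForce g H R c K) {x : X} (hx : R + 1 ≤ ‖x‖) :
    ∃ x₀ d : X, x₀ + d = x ∧ ‖x₀‖ = R + 1 ∧ (∀ r ∈ Icc (0 : ℝ) 1, R < ‖x₀ + r • d‖) ∧
      ∃ l ∈ Icc (0 : ℝ) 1, d = l • x := by
  have hR := h.R_pos
  have hx0 : 0 < ‖x‖ := by linarith
  set l := (R + 1) / ‖x‖ with hl
  have hl0 : 0 < l := by positivity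
  have hl1 : l ≤ 1 := (div_le_one hx0).2 hx
  have hlx : l * ‖x‖ = R + 1 := div_mul_cancel₀ _ hx0.ne'
  refine ⟨l • x, (1 - l) • x, by rw [← add_smul]; simp, ?_, ?_, 1 - l, ⟨by linarith, by linarith⟩,
    rfl⟩
  · rw [norm_smul, Real.norm_of_nonneg hl0.le, hlx]
  · intro r hr
    rw [smul_smul, ← add_smul, norm_smul, Real.norm_of_nonneg (by nlinarith [hr.1])]
    nlinarith [hr.1, mul_nonneg (mul_nonneg hr.1 (sub_nonneg.2 hl1)) hx0.le]

theorem norm_le_linear (h : IsForce g H R c K) : ∀ x, ‖g x‖ ≤ (K + ‖g 0‖) * (1 + ‖x‖) := by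
  intro x
  have h1 := h.norm_sub_le x 0
  have h2 : ‖g x‖ ≤ ‖g x - g 0‖ + ‖g 0‖ := by simpa using norm_add_le (g x - g 0) (g 0)
  rw [sub_zero] at h1
  nlinarith [norm_nonneg (g 0), norm_nonneg x, h.K_pos,
    mul_nonneg (norm_nonneg (g 0)) (norm_nonneg x)]

theorem norm_le_of_norm_eq (h : IsForce g H R c K) {x₀ : X} (hx : ‖x₀‖ = R + 1) :
    ‖g x₀‖ ≤ (K + ‖g 0‖) * (R + 2) := by
  have := h.norm_le_linear x₀
  rw [hx] at this
  linarith

/-- The lower bound on the Hessian is used along the part of the ray outside the ball; the part up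
to radius `R + 1` costs only a term of linear growth. -/
theorem inner_ge (h : IsForce g H R c K) :
    ∃ D, 0 ≤ D ∧ ∀ x, c * ‖x‖ ^ 2 ≤ inner ℝ (g x) x + D * (1 + ‖x‖) := by
  have hR := h.R_pos
  have hK := h.K_pos
  have hc := h.c_pos
  set G := (K + ‖g 0‖) * (R + 2) with hG
  have hG0 : 0 ≤ G := by positivity
  set D := 2 * c * (R + 1) + G + c * (R + 1) ^ 2 + (K + ‖g 0‖) * (R + 2) with hD
  refine ⟨D, by positivity, fun x => ?_⟩
  rcases lt_or_ge ‖x‖ (R + 1) with hx | hx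
  · have h1 := h.norm_le_linear x
    have h2 := abs_le.1 (abs_real_inner_le_norm (g x) x)
    have h3 : ‖g x‖ * ‖x‖ ≤ G * ‖x‖ := by
      refine mul_le_mul_of_nonneg_right (h1.trans ?_) (norm_nonneg _)
      exact mul_le_mul_of_nonneg_left (by linarith) (by positivity)
    have h4 : ‖x‖ ^ 2 ≤ (R + 1) ^ 2 := by gcongr
    nlinarith [norm_nonneg x, mul_nonneg hG0 (norm_nonneg x),
      mul_nonneg (mul_nonneg hc.le hR.le) (norm_nonneg x), mul_nonneg hc.le (norm_nonneg x),
      mul_nonneg (mul_nonneg hc.le (sq_nonneg (R + 1))) (norm_nonneg x)]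
  · obtain ⟨x₀, d, hxd, hx₀, hseg, l, hl, hdl⟩ := h.radial_segment hx
    have h1 : inner ℝ (g (x₀ + d) - g x₀) (-d) ≤ -(c * ‖d‖ ^ 2) := by
      refine h.inner_sub_le_of_segment fun r hr => ?_
      rw [inner_neg_right]
      exact neg_le_neg (h.lower _ (hseg r ⟨hr.1.le, hr.2.le⟩) d)
    rw [hxd, inner_neg_right, neg_le_neg_iff, inner_sub_left] at h1
    have h2 : ‖g x₀‖ ≤ G := h.norm_le_of_norm_eq hx₀
    have hd : x - x₀ = d := by rw [← hxd]; abel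
    have h3 : inner ℝ (g x) d = l * inner ℝ (g x) x := by rw [hdl, inner_smul_right]
    have h4 : ‖d‖ = l * ‖x‖ := by rw [hdl, norm_smul, Real.norm_of_nonneg hl.1]
    have h5 : ‖x‖ ≤ ‖d‖ + (R + 1) := by
      rw [← hx₀, ← hxd, add_comm]; exact norm_add_le _ _
    have h6 := abs_le.1 (abs_real_inner_le_norm (g x₀) d)
    have h7 : ‖g x₀‖ * ‖d‖ ≤ G * ‖d‖ := by gcongr
    -- As `d = l • x`, the estimate along `d` can be divided by `l`. If `l = 0` then `‖x‖ = R + 1`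
    -- and the constants suffice.
    rcases hl.1.eq_or_lt with hl0 | hl0
    · rw [← hl0, zero_mul] at h4
      have h8 := h.norm_le_linear x
      have h9 := abs_le.1 (abs_real_inner_le_norm (g x) x)
      have h10 : ‖x‖ = R + 1 := by linarith
      rw [h10] at h8 h9 ⊢
      have : ‖g x‖ * (R + 1) ≤ G * (R + 1) := by
        gcongr; rw [hG]; linarith
      nlinarith [mul_nonneg hc.le hR.le, mul_nonneg hG0 hR.le,
        mul_nonneg (mul_nonneg hc.le (sq_nonneg (R + 1))) hR.le]
    · have h8 : c * l * ‖x‖ ^ 2 ≤ inner ℝ (g x) x + G * ‖x‖ := by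
        have : l * (c * l * ‖x‖ ^ 2) ≤ l * (inner ℝ (g x) x + G * ‖x‖) := by
          rw [h4] at h1 h6 h7
          nlinarith
        exact le_of_mul_le_mul_left this hl0
      have h9 : ‖x‖ ≤ l * ‖x‖ + (R + 1) := by linarith
      have h10 : c * ‖x‖ * ‖x‖ ≤ c * ‖x‖ * (l * ‖x‖ + (R + 1)) := by gcongr
      nlinarith [mul_nonneg (mul_nonneg hc.le hR.le) (norm_nonneg x),
        mul_nonneg hc.le (norm_nonneg x), mul_nonneg hG0 (norm_nonneg x),
        mul_nonneg (mul_nonneg hc.le (sq_nonneg (R + 1))) (norm_nonneg x),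
        mul_nonneg hc.le (sq_nonneg (R + 1)), mul_nonneg hc.le hR.le]

theorem norm_ge (h : IsForce g H R c K) : ∃ D, 0 ≤ D ∧ ∀ x, c * ‖x‖ ≤ ‖g x‖ + D := by
  obtain ⟨D, hD, hx⟩ := h.inner_ge
  refine ⟨2 * D + c, by linarith [h.c_pos], fun x => ?_⟩
  rcases le_total ‖x‖ 1 with h1 | h1
  · nlinarith [norm_nonneg (g x), h.c_pos]
  · have h2 := (hx x).trans (add_le_add_left (real_inner_le_norm _ _) _)
    have h3 : 0 < ‖x‖ := by linarith
    have : c * ‖x‖ * ‖x‖ ≤ (‖g x‖ + 2 * D) * ‖x‖ := by nlinarith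
    have := le_of_mul_le_mul_right this h3
    linarith [h.c_pos]

/-- An upper bound on the force from a bound on the forms `H x` outside of the ball. -/
theorem inner_le_of_form (h : IsForce g H R c K) (N : Seminorm ℝ X)
    (hN : ∀ x, R < ‖x‖ → ∀ v, inner ℝ (H x v) v ≤ N v ^ 2) :
    ∃ D, 0 ≤ D ∧ ∀ x, inner ℝ (g x) x ≤ N x ^ 2 + D * (1 + ‖x‖) := by
  have hR := h.R_pos
  have hK := h.K_pos
  set G := (K + ‖g 0‖) * (R + 2) with hG
  have hG0 : 0 ≤ G := by positivity
  refine ⟨G + (K + ‖g 0‖) * 2 * (R + 1), by positivity, fun x => ?_⟩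
  have hlin := h.norm_le_linear x
  have hgx : 0 ≤ ‖g 0‖ := norm_nonneg _
  have hxx := norm_nonneg x
  rcases lt_or_ge ‖x‖ (R + 1) with hx | hx
  · have h2 := real_inner_le_norm (g x) x
    have h3 : ‖g x‖ * ‖x‖ ≤ G * ‖x‖ := by
      refine mul_le_mul_of_nonneg_right (hlin.trans ?_) (norm_nonneg _)
      exact mul_le_mul_of_nonneg_left (by linarith) (by positivity)
    have h4 : 0 ≤ (K + ‖g 0‖) * 2 * (R + 1) * (1 + ‖x‖) := by positivity
    nlinarith [sq_nonneg (N x)]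
  · obtain ⟨x₀, d, hxd, hx₀, hseg, l, hl, hdl⟩ := h.radial_segment hx
    have h1 : inner ℝ (g (x₀ + d) - g x₀) d ≤ N d ^ 2 :=
      h.inner_sub_le_of_segment fun r hr => hN _ (hseg r ⟨hr.1.le, hr.2.le⟩) d
    rw [hxd, inner_sub_left] at h1
    have h2 : ‖g x₀‖ ≤ G := h.norm_le_of_norm_eq hx₀
    have h4 : ‖d‖ ≤ ‖x‖ := by
      rw [hdl, norm_smul, Real.norm_of_nonneg hl.1]
      exact mul_le_of_le_one_left (norm_nonneg _) hl.2
    have h5 : N d ≤ N x := by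
      rw [hdl, map_smul_eq_mul, Real.norm_of_nonneg hl.1]
      exact mul_le_of_le_one_left (apply_nonneg _ _) hl.2
    have h6 := real_inner_le_norm (g x₀) d
    have h7 : ‖g x₀‖ * ‖d‖ ≤ G * ‖x‖ := by gcongr
    have h8 := real_inner_le_norm (g x) x₀
    have h9 : inner ℝ (g x) x = inner ℝ (g x) x₀ + inner ℝ (g x) d := by
      rw [← inner_add_right, hxd]
    have h10 : N d ^ 2 ≤ N x ^ 2 := by gcongr
    rw [hx₀] at h8
    have h11 : ‖g x‖ * (R + 1) ≤ (K + ‖g 0‖) * (1 + ‖x‖) * (R + 1) := by gcongr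
    have h12 : 0 ≤ (K + ‖g 0‖) * (1 + ‖x‖) * (R + 1) := by positivity
    nlinarith

/-- If `V U V ≤ a² V` for all Hessians `U` outside the ball, then the same holds, up to lower order
terms, for the force itself. -/
theorem form_force_le (h : IsForce g H R c K) {V : X →L[ℝ] X} {a k : ℝ} (ha : 0 < a)
    (hVs : ∀ u v, inner ℝ (V u) v = inner ℝ u (V v)) (hVk : ‖V‖ ≤ k)
    (hUV : ∀ x, R < ‖x‖ → ∀ v, inner ℝ (H x (V v)) (V v) ≤ a ^ 2 * inner ℝ (V v) v) :
    ∀ x, inner ℝ (V (g x)) (g x) ≤ a ^ 2 * inner ℝ (g x) x +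
      ((K + ‖g 0‖) ^ 2 * (R + 2) ^ 2 * (3 * k) + a ^ 2 * ((K + ‖g 0‖) * (R + 2) * 2)) *
        (1 + ‖x‖) := by
  intro x
  have hR := h.R_pos
  have hK := h.K_pos
  set L := K + ‖g 0‖ with hL
  have hL0 : 0 ≤ L := by positivity
  have hk0 : 0 ≤ k := (norm_nonneg _).trans hVk
  have hlin := h.norm_le_linear x
  have hxx := norm_nonneg x
  have hVb : ∀ u v, |inner ℝ (V u) v| ≤ k * ‖u‖ * ‖v‖ := fun u v =>
    (abs_real_inner_le_norm _ _).trans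
      (mul_le_mul_of_nonneg_right (V.le_of_opNorm_le hVk u) (norm_nonneg v))
  rcases lt_or_ge ‖x‖ (R + 1) with hx | hx
  · have h1 : ‖g x‖ ≤ L * (R + 2) := hlin.trans (mul_le_mul_of_nonneg_left (by linarith) hL0)
    have h2 := (abs_le.1 (hVb (g x) (g x))).2
    have h3 := (abs_le.1 (abs_real_inner_le_norm (g x) x)).1
    have h4 : k * ‖g x‖ * ‖g x‖ ≤ k * (L * (R + 2)) * (L * (R + 2)) := by gcongr
    have h5 : ‖g x‖ * ‖x‖ ≤ L * (R + 2) * ‖x‖ := by gcongr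
    have h6 : a ^ 2 * (-(L * (R + 2) * ‖x‖)) ≤ a ^ 2 * inner ℝ (g x) x := by gcongr; linarith
    have h7 : 0 ≤ k * (L * (R + 2)) * (L * (R + 2)) := by positivity
    have h8 : 0 ≤ k * (L * (R + 2)) * (L * (R + 2)) * ‖x‖ := by positivity
    have h9 : 0 ≤ a ^ 2 * (L * (R + 2)) := by positivity
    have h10 : 0 ≤ a ^ 2 * (L * (R + 2)) * ‖x‖ := by positivity
    nlinarith
  · obtain ⟨x₀, d, hxd, hx₀, hseg, l, hl, hdl⟩ := h.radial_segment hx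
    set G := g x - g x₀ with hG
    -- With this test vector, Young's inequality leaves `a⁻² ⟨H (V G), V G⟩` at each point of the
    -- segment, which is at most `⟨V G, G⟩` by `hUV`. The left side is `2 ⟨V G, G⟩ - a² ⟨G, d⟩`, so
    -- `⟨V G, G⟩ ≤ a² ⟨G, d⟩` for the whole increment.
    have h1 : inner ℝ (g (x₀ + d) - g x₀) (2 • V G - a ^ 2 • d) ≤ inner ℝ (V G) G := by
      refine h.inner_sub_le_of_segment fun r hr => ?_
      have hs := hseg r ⟨hr.1.le, hr.2.le⟩
      have h2 := h.two_inner_le hs ha d (V G)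
      have h3 := mul_le_mul_of_nonneg_left (hUV _ hs G) (inv_nonneg.2 (sq_nonneg a))
      rw [← mul_assoc, inv_mul_cancel₀ (by positivity), one_mul] at h3
      rw [inner_sub_right, inner_smul_right, two_smul, inner_add_right]
      linarith
    rw [hxd, ← hG, inner_sub_right, inner_smul_right, two_smul, inner_add_right,
      ← hVs] at h1
    have h2 : ‖g x₀‖ ≤ L * (R + 2) := h.norm_le_of_norm_eq hx₀
    have h4 : ‖d‖ ≤ ‖x‖ := by
      rw [hdl, norm_smul, Real.norm_of_nonneg hl.1]
      exact mul_le_of_le_one_left (norm_nonneg _) hl.2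
    have hgx : g x = G + g x₀ := by rw [hG]; abel
    have h5 : inner ℝ (V (g x)) (g x) = inner ℝ (V G) G + 2 * inner ℝ (V (g x₀)) (g x)
        - inner ℝ (V (g x₀)) (g x₀) := by
      have : inner ℝ (V G) (g x₀) = inner ℝ (V (g x₀)) G := by rw [hVs, real_inner_comm]
      rw [hgx, map_add]
      simp only [inner_add_left, inner_add_right, this]
      ring
    have h6 := abs_le.1 (hVb (g x₀) (g x))
    have h7 := abs_le.1 (hVb (g x₀) (g x₀))
    have h8 : k * ‖g x₀‖ * ‖g x‖ ≤ k * (L * (R + 2)) * (L * (1 + ‖x‖)) := by gcongr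
    have h9 : k * ‖g x₀‖ * ‖g x₀‖ ≤ k * (L * (R + 2)) * (L * (R + 2)) := by gcongr
    have h10 : inner ℝ G d = inner ℝ (g x) x - inner ℝ (g x) x₀ - inner ℝ (g x₀) d := by
      have : inner ℝ (g x) x = inner ℝ (g x) x₀ + inner ℝ (g x) d := by
        rw [← inner_add_right, hxd]
      rw [this, hG, inner_sub_left]; ring
    have h11 := abs_le.1 (abs_real_inner_le_norm (g x) x₀)
    have h12 := abs_le.1 (abs_real_inner_le_norm (g x₀) d)
    have h13 : ‖g x‖ * ‖x₀‖ ≤ L * (1 + ‖x‖) * (R + 2) := by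
      rw [hx₀]; gcongr; linarith
    have h14 : ‖g x₀‖ * ‖d‖ ≤ L * (R + 2) * (1 + ‖x‖) := by
      gcongr; linarith
    have h15 : a ^ 2 * inner ℝ G d ≤ a ^ 2 * (inner ℝ (g x) x + L * (R + 2) * 2 * (1 + ‖x‖)) := by
      gcongr; linarith
    have h16 : 0 ≤ k * L * L * (R + 2) := by positivity
    have h17 : k * (L * (R + 2)) * (L * (R + 2)) ≤
        k * (L * (R + 2)) * (L * (R + 2)) * (1 + ‖x‖) :=
      le_mul_of_one_le_right (by positivity) (by linarith)
    have h18 : k * (L * (R + 2)) * (L * (1 + ‖x‖)) ≤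
        k * (L * (R + 2)) * (L * (R + 2)) * (1 + ‖x‖) := by
      have : k * (L * (R + 2)) * (L * (1 + ‖x‖)) * 1 ≤
        k * (L * (R + 2)) * (L * (1 + ‖x‖)) * (R + 2) := by gcongr; linarith
      linarith
    nlinarith

end IsForce

/-- The supremum over `x` outside the ball of radius `R` of the seminorms `v ↦ √⟨H x v, v⟩`. -/
noncomputable def IsForce.outerSeminorm {g : X → X} {H : X → X →L[ℝ] X} {R c K : ℝ}
    (h : IsForce g H R c K) : Seminorm ℝ X :=
  have hbdd : ∀ v, BddAbove (range fun x : {x : X // R < ‖x‖} => √(inner ℝ (H x v) v)) :=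
    fun v => ⟨√(K * ‖v‖ ^ 2), by
      rintro _ ⟨x, rfl⟩
      exact Real.sqrt_le_sqrt (h.inner_le x v)⟩
  Seminorm.of (fun v => ⨆ x : {x : X // R < ‖x‖}, √(inner ℝ (H x v) v))
    (fun u v => by
      refine Real.iSup_le (fun x => ?_) (add_nonneg (Real.iSup_nonneg fun _ => Real.sqrt_nonneg _)
        (Real.iSup_nonneg fun _ => Real.sqrt_nonneg _))
      refine le_trans ?_ (add_le_add (le_ciSup (hbdd u) x) (le_ciSup (hbdd v) x))
      have hu := h.inner_nonneg x.2 u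
      have hv := h.inner_nonneg x.2 v
      set su := √(inner ℝ (H x u) u) with hsu
      set sv := √(inner ℝ (H x v) v) with hsv
      have hu2 : su ^ 2 = inner ℝ (H x u) u := Real.sq_sqrt hu
      have hv2 : sv ^ 2 = inner ℝ (H x v) v := Real.sq_sqrt hv
      have hsu0 : 0 ≤ su := Real.sqrt_nonneg _
      have hsv0 : 0 ≤ sv := Real.sqrt_nonneg _
      have hsym : inner ℝ (H x v) u = inner ℝ (H x u) v := by rw [h.symm, real_inner_comm]
      refine Real.sqrt_le_iff.2 ⟨by positivity, ?_⟩
      -- Cauchy–Schwarz for the form of `H x`, from positivity at a combination of `u` and `v`. The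
      -- shift by `δ` avoids a division by zero.
      have hcs : inner ℝ (H x u) v ≤ su * sv := by
        refine le_of_forall_pos_le_add fun ε hε => ?_
        obtain ⟨δ, hδ, hδ'⟩ : ∃ δ > 0, δ * (su + sv) + δ ^ 2 ≤ ε := by
          refine ⟨min 1 (ε / (su + sv + 1)), by positivity, ?_⟩
          have h1 := min_le_left 1 (ε / (su + sv + 1))
          have h2 := min_le_right 1 (ε / (su + sv + 1))
          have h3 : 0 < min 1 (ε / (su + sv + 1)) := by positivity
          rw [le_div_iff₀ (by positivity)] at h2
          nlinarith
        have hu1 : 0 < su + δ := by positivity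
        have hv1 : 0 < sv + δ := by positivity
        have hp := h.inner_nonneg x.2 ((sv + δ) • u - (su + δ) • v)
        simp only [map_sub, map_smul, inner_sub_left, inner_sub_right, inner_smul_left,
          inner_smul_right, hsym, conj_trivial, ← hu2, ← hv2] at hp
        have hq : inner ℝ (H x u) v ≤ (su + δ) * (sv + δ) := by
          have : (2 * (su + δ) * (sv + δ)) * inner ℝ (H x u) v ≤
              (2 * (su + δ) * (sv + δ)) * ((su + δ) * (sv + δ)) := by
            have e1 : (sv + δ) ^ 2 * su ^ 2 ≤ (sv + δ) ^ 2 * (su + δ) ^ 2 := by gcongr; linarith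
            have e2 : (su + δ) ^ 2 * sv ^ 2 ≤ (su + δ) ^ 2 * (sv + δ) ^ 2 := by gcongr; linarith
            nlinarith
          exact le_of_mul_le_mul_left this (by positivity)
        nlinarith
      simp only [map_add, inner_add_left, inner_add_right, hsym, ← hu2, ← hv2]
      nlinarith)
    (fun a v => by
      rw [Real.mul_iSup_of_nonneg (norm_nonneg a)]
      congr 1
      ext x
      rw [map_smul, inner_smul_left, inner_smul_right, conj_trivial, ← mul_assoc,
        Real.sqrt_mul (mul_self_nonneg a), Real.sqrt_mul_self_eq_abs, Real.norm_eq_abs])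

namespace IsForce

variable {g : X → X} {H : X → X →L[ℝ] X} {R c K : ℝ}

theorem outerSeminorm_apply (h : IsForce g H R c K) (v : X) :
    h.outerSeminorm v = ⨆ x : {x : X // R < ‖x‖}, √(inner ℝ (H x v) v) := rfl

theorem inner_le_outerSeminorm (h : IsForce g H R c K) {x : X} (hx : R < ‖x‖) (v : X) :
    inner ℝ (H x v) v ≤ h.outerSeminorm v ^ 2 := by
  have h1 : √(inner ℝ (H x v) v) ≤ h.outerSeminorm v := by
    rw [outerSeminorm_apply]
    refine le_ciSup (f := fun x : {x : X // R < ‖x‖} => √(inner ℝ (H x v) v))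
      ⟨√(K * ‖v‖ ^ 2), ?_⟩ ⟨x, hx⟩
    rintro _ ⟨x, rfl⟩
    exact Real.sqrt_le_sqrt (h.inner_le x v)
  rw [← Real.sq_sqrt (h.inner_nonneg hx v)]
  gcongr

theorem outerSeminorm_sq_le (h : IsForce g H R c K) {v : X} {B : ℝ} (hB : 0 ≤ B)
    (hv : ∀ x, R < ‖x‖ → inner ℝ (H x v) v ≤ B) : h.outerSeminorm v ^ 2 ≤ B := by
  have h1 : h.outerSeminorm v ≤ √B := by
    rw [outerSeminorm_apply]
    exact Real.iSup_le (fun x => Real.sqrt_le_sqrt (hv x x.2)) (Real.sqrt_nonneg _)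
  calc h.outerSeminorm v ^ 2 ≤ √B ^ 2 := by gcongr
    _ = B := Real.sq_sqrt hB

theorem outerSeminorm_le (h : IsForce g H R c K) (v : X) : h.outerSeminorm v ≤ √K * ‖v‖ := by
  have h1 := h.outerSeminorm_sq_le (v := v) (mul_nonneg h.K_pos.le (sq_nonneg _))
    fun x _ => h.inner_le x v
  have h2 : K * ‖v‖ ^ 2 = (√K * ‖v‖) ^ 2 := by rw [mul_pow, Real.sq_sqrt h.K_pos.le]
  rw [h2] at h1
  exact le_of_sq_le_sq h1 (by positivity)

theorem le_outerSeminorm_sq [Nontrivial X] (h : IsForce g H R c K) (v : X) :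
    c * ‖v‖ ^ 2 ≤ h.outerSeminorm v ^ 2 := by
  obtain ⟨x, hx⟩ := NormedSpace.exists_lt_norm ℝ X R
  exact (h.lower x hx v).trans (h.inner_le_outerSeminorm hx v)

end IsForce

end Force

/-! ### Wirtinger's inequality and Sturm comparison for seminorms. -/

section Sturm

open scoped Topology

variable {X : Type*} [NormedAddCommGroup X] [InnerProductSpace ℝ X]

theorem Seminorm.lipschitzWith_of_le_norm {N : Seminorm ℝ X} {k : ℝ} (hk : 0 ≤ k)
    (hN : ∀ v, N v ≤ k * ‖v‖) : LipschitzWith k.toNNReal N := by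
  refine LipschitzWith.of_dist_le_mul fun u v => ?_
  rw [Real.dist_eq, Real.coe_toNNReal _ hk, dist_eq_norm]
  exact (abs_sub_map_le_sub N u v).trans (hN _)

/-- A seminorm along a smooth curve is only Lipschitz, so it is differentiable almost everywhere;
this bounds its derivative where it exists. -/
theorem abs_deriv_seminorm_le {N : Seminorm ℝ X} (hNc : Continuous N) {x : ℝ → X} {v : X} {t d : ℝ}
    (hx : HasDerivAt x v t) (hf : HasDerivAt (fun s => N (x s)) d t) : |d| ≤ N v := by
  have h1 := (hasDerivAt_iff_tendsto_slope.1 hf).abs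
  have h2 := (hNc.tendsto v).comp (hasDerivAt_iff_tendsto_slope.1 hx)
  refine le_of_tendsto_of_tendsto h1 h2 (Filter.Eventually.of_forall fun s => ?_)
  simp only [slope_def_field, Function.comp_apply, slope_def_module, map_smul_eq_mul, norm_inv,
    abs_div, Real.norm_eq_abs]
  rw [div_eq_inv_mul]
  exact mul_le_mul_of_nonneg_left (abs_sub_map_le_sub N _ _) (by positivity)

/-- **Wirtinger's inequality** for a seminorm along a curve, with boundary terms: the constant
is any `b` with `b T < π`. -/
theorem wirtinger_seminorm {N : Seminorm ℝ X} {k : ℝ} (hk : 0 ≤ k) (hN : ∀ v, N v ≤ k * ‖v‖)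
    {b T : ℝ} (hb : 0 < b) (hT : 0 < T) (hbT : b * T < Real.pi) :
    ∃ D, 0 ≤ D ∧ ∀ x g : ℝ → X, (∀ t, HasDerivAt x (g t) t) → Continuous g →
      b ^ 2 * ∫ t in (0 : ℝ)..T, N (x t) ^ 2 ≤
        (∫ t in (0 : ℝ)..T, N (g t) ^ 2) + D * (‖x 0‖ ^ 2 + ‖x T‖ ^ 2) := by
  set ε := (Real.pi - b * T) / 2 with hε
  have hε0 : 0 < ε := by rw [hε]; linarith
  -- `θ = b cot (b t + ε)` solves the Riccati equation `θ' = -b² - θ²`, and the phase `ε` keeps `b t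
  -- + ε` in `[ε, π - ε]`. Completing the square gives `(θ f²)' ≤ f'² - b² f²`, whose integral is
  -- the claim; the boundary values of `θ` give the constant.
  set θ : ℝ → ℝ := fun t => b * (Real.cos (b * t + ε) / Real.sin (b * t + ε)) with hθ
  have hsin : ∀ t ∈ uIcc 0 T, 0 < Real.sin (b * t + ε) := by
    intro t ht
    rw [uIcc_of_le hT.le] at ht
    refine Real.sin_pos_of_pos_of_lt_pi (by nlinarith [ht.1]) ?_
    have : b * t ≤ b * T := by gcongr; exact ht.2
    rw [hε] at hε0 ⊢; linarith
  have hθd : ∀ t ∈ uIcc 0 T, HasDerivAt θ (-b ^ 2 - θ t ^ 2) t := by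
    intro t ht
    have h0 := (hsin t ht).ne'
    have h1 : HasDerivAt (fun t => b * t + ε) b t := by
      simpa using ((hasDerivAt_id t).const_mul b).add_const ε
    have := ((h1.cos.div h1.sin h0).const_mul b)
    refine this.congr_deriv ?_
    rw [hθ]
    field_simp
  have hθac : AbsolutelyContinuousOnInterval θ 0 T := by
    refine ContDiffOn.absolutelyContinuousOnInterval ?_
    refine contDiffOn_const.mul (ContDiffOn.div ?_ ?_ fun t ht => (hsin t ht).ne')
    · exact (Real.contDiff_cos.comp ((contDiff_const.mul contDiff_id).add contDiff_const)).contDiffOn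
    · exact (Real.contDiff_sin.comp ((contDiff_const.mul contDiff_id).add contDiff_const)).contDiffOn
  refine ⟨k ^ 2 * (|θ 0| + |θ T|), by positivity, fun x g hx hg => ?_⟩
  have hNl := Seminorm.lipschitzWith_of_le_norm hk hN
  have hxc : Continuous x := continuous_iff_continuousAt.2 fun t => (hx t).continuousAt
  set f : ℝ → ℝ := fun t => N (x t) with hf
  have hfc : Continuous f := hNl.continuous.comp hxc
  have hfac : AbsolutelyContinuousOnInterval f 0 T := by
    have h1 : ContDiff ℝ 1 x := by
      rw [contDiff_one_iff_deriv]
      refine ⟨fun t => (hx t).differentiableAt, ?_⟩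
      rwa [show deriv x = g from funext fun t => (hx t).deriv]
    obtain ⟨L, hL⟩ := h1.contDiffOn.exists_lipschitzOnWith (s := uIcc 0 T) (by simp)
      (convex_uIcc _ _) isCompact_uIcc
    exact (hNl.comp_lipschitzOnWith hL).absolutelyContinuousOnInterval
  -- `f` is not differentiable everywhere, so the fundamental theorem of calculus is used in its
  -- absolutely continuous form.
  have hu : AbsolutelyContinuousOnInterval (θ * (f * f)) 0 T := hθac.mul (hfac.mul hfac)
  have hFTC := hu.integral_deriv_eq_sub
  have hle : ∫ t in (0 : ℝ)..T, deriv (θ * (f * f)) t ≤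
      ∫ t in (0 : ℝ)..T, (N (g t) ^ 2 - b ^ 2 * f t ^ 2) := by
    refine intervalIntegral.integral_mono_ae_restrict hT.le hu.intervalIntegrable_deriv
      (Continuous.intervalIntegrable ?_ _ _) ?_
    · exact ((hNl.continuous.comp hg).pow 2).sub (continuous_const.mul (hfc.pow 2))
    · refine (ae_restrict_iff' measurableSet_Icc).2 ?_
      filter_upwards [hfac.ae_differentiableAt] with t ht htI
      rw [uIcc_of_le hT.le] at ht
      have hd := (ht htI).hasDerivAt
      have h1 := hθd t (by rwa [uIcc_of_le hT.le])
      have h2 := (h1.mul (hd.mul hd)).deriv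
      rw [h2]
      have h3 : |deriv f t| ≤ N (g t) := abs_deriv_seminorm_le hNl.continuous (hx t) hd
      have h4 : deriv f t ^ 2 ≤ N (g t) ^ 2 := by
        rw [← sq_abs]; gcongr
      simp only [Pi.mul_apply]
      nlinarith [sq_nonneg (deriv f t - θ t * f t)]
  have hi1 : IntervalIntegrable (fun t => N (g t) ^ 2) volume 0 T :=
    ((hNl.continuous.comp hg).pow 2).intervalIntegrable _ _
  have hi2 : IntervalIntegrable (fun t => b ^ 2 * f t ^ 2) volume 0 T :=
    (continuous_const.mul (hfc.pow 2)).intervalIntegrable _ _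
  rw [hFTC, intervalIntegral.integral_sub hi1 hi2, intervalIntegral.integral_const_mul] at hle
  simp only [Pi.mul_apply] at hle
  have hbd : ∀ t, f t * f t ≤ k ^ 2 * ‖x t‖ ^ 2 := by
    intro t
    have := hN (x t)
    calc f t * f t = N (x t) ^ 2 := by rw [hf]; ring
      _ ≤ (k * ‖x t‖) ^ 2 := by gcongr
      _ = _ := by ring
  have h0 : θ 0 * (f 0 * f 0) ≤ |θ 0| * (k ^ 2 * ‖x 0‖ ^ 2) :=
    mul_le_mul (le_abs_self _) (hbd 0) (mul_self_nonneg _) (abs_nonneg _)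
  have hT' : -(θ T * (f T * f T)) ≤ |θ T| * (k ^ 2 * ‖x T‖ ^ 2) := by
    rw [← neg_mul]
    exact mul_le_mul (neg_le_abs _) (hbd T) (mul_self_nonneg _) (abs_nonneg _)
  have e1 : 0 ≤ |θ 0| * (k ^ 2 * ‖x T‖ ^ 2) := by positivity
  have e2 : 0 ≤ |θ T| * (k ^ 2 * ‖x 0‖ ^ 2) := by positivity
  nlinarith

/-- A Sturm type estimate for `x' = g`, `y' = -h`: if `N(g)² ≤ a² ⟨g, y⟩` and `⟨h, x⟩ ≤ N(x)²` up to
an error `e`, then on an interval of length `T < π / a` the solution is controlled by its boundary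
values. -/
theorem sturm_estimate {N : Seminorm ℝ X} {k : ℝ} (hk : 0 ≤ k) (hN : ∀ v, N v ≤ k * ‖v‖)
    {a T : ℝ} (ha : 0 < a) (hT : 0 < T) (haT : a * T < Real.pi) :
    ∃ κ D, 0 < κ ∧ 0 ≤ D ∧ ∀ (x y g h : ℝ → X) (e : ℝ → ℝ), (∀ t, HasDerivAt x (g t) t) →
      (∀ t, HasDerivAt y (-h t) t) → Continuous g → Continuous h →
      IntervalIntegrable e volume 0 T →
      (∀ t ∈ Icc 0 T, N (g t) ^ 2 ≤ a ^ 2 * (inner ℝ (g t) (y t) + e t)) →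
      (∀ t ∈ Icc 0 T, inner ℝ (h t) (x t) ≤ N (x t) ^ 2 + e t) →
      κ * ∫ t in (0 : ℝ)..T, N (g t) ^ 2 ≤ ‖x 0‖ * ‖y 0‖ + ‖x T‖ * ‖y T‖ +
        D * (‖x 0‖ ^ 2 + ‖x T‖ ^ 2) + 2 * ∫ t in (0 : ℝ)..T, e t := by
  -- The derivative of `⟨x, y⟩` is at least `a⁻² N(g)² - N(x)² - 2e`, and Wirtinger bounds `∫ N(x)²`
  -- by `b⁻² ∫ N(g)²` plus boundary terms. A `b` strictly between `a` and `π / T` leaves the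
  -- positive coefficient `a⁻² - b⁻²`.
  obtain ⟨b, hab, hbT⟩ : ∃ b, a < b ∧ b * T < Real.pi := by
    have : a < Real.pi / T := by rwa [lt_div_iff₀ hT]
    obtain ⟨b, h1, h2⟩ := exists_between this
    exact ⟨b, h1, by rwa [lt_div_iff₀ hT] at h2⟩
  have hb : 0 < b := ha.trans hab
  obtain ⟨D, hD, hW⟩ := wirtinger_seminorm hk hN hb hT hbT
  have hab' : (b ^ 2)⁻¹ < (a ^ 2)⁻¹ := by
    apply inv_strictAnti₀ (by positivity); gcongr
  refine ⟨(a ^ 2)⁻¹ - (b ^ 2)⁻¹, (b ^ 2)⁻¹ * D, by linarith, by positivity,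
    fun x y g h e hx hy hg hh he h1 h2 => ?_⟩
  have hNc := (Seminorm.lipschitzWith_of_le_norm hk hN).continuous
  have hxc : Continuous x := continuous_iff_continuousAt.2 fun t => (hx t).continuousAt
  have hyc : Continuous y := continuous_iff_continuousAt.2 fun t => (hy t).continuousAt
  have hw := hW x g hx hg
  have hI : ∫ t in (0 : ℝ)..T, (inner ℝ (g t) (y t) - inner ℝ (h t) (x t)) =
      inner ℝ (x T) (y T) - inner ℝ (x 0) (y 0) := by
    refine intervalIntegral.integral_eq_sub_of_hasDerivAt (f := fun t => inner ℝ (x t) (y t))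
      (fun t _ => ?_) (Continuous.intervalIntegrable (by fun_prop) _ _)
    refine ((hx t).inner ℝ (hy t)).congr_deriv ?_
    rw [inner_neg_right, real_inner_comm (h t)]
    ring
  have hgi : IntervalIntegrable (fun t => N (g t) ^ 2) volume 0 T :=
    ((hNc.comp hg).pow 2).intervalIntegrable _ _
  have hxi : IntervalIntegrable (fun t => N (x t) ^ 2) volume 0 T :=
    ((hNc.comp hxc).pow 2).intervalIntegrable _ _
  have hJ : ∫ t in (0 : ℝ)..T, ((a ^ 2)⁻¹ * N (g t) ^ 2 - N (x t) ^ 2 - 2 * e t) ≤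
      ∫ t in (0 : ℝ)..T, (inner ℝ (g t) (y t) - inner ℝ (h t) (x t)) := by
    refine intervalIntegral.integral_mono_on hT.le
      (((hgi.const_mul _).sub hxi).sub (he.const_mul 2))
      (Continuous.intervalIntegrable (by fun_prop) _ _) fun t ht => ?_
    have h3 := mul_le_mul_of_nonneg_left (h1 t ht) (inv_nonneg.2 (sq_nonneg a))
    rw [← mul_assoc, inv_mul_cancel₀ (by positivity), one_mul] at h3
    linarith [h2 t ht]
  rw [hI, intervalIntegral.integral_sub ((hgi.const_mul _).sub hxi) (he.const_mul 2),
    intervalIntegral.integral_sub (hgi.const_mul _) hxi, intervalIntegral.integral_const_mul,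
    intervalIntegral.integral_const_mul] at hJ
  have h4 := mul_le_mul_of_nonneg_left hw (inv_nonneg.2 (sq_nonneg b))
  rw [← mul_assoc, inv_mul_cancel₀ (by positivity), one_mul] at h4
  have h5 := (abs_le.1 (abs_real_inner_le_norm (x 0) (y 0))).1
  have h6 := real_inner_le_norm (x T) (y T)
  nlinarith

end Sturm

/-! ### Control of a motion by the momenta at its two ends. -/

section Hamilton

open scoped Topology

variable {X : Type*} [NormedAddCommGroup X] [InnerProductSpace ℝ X]

/-- The curve `γ = (Q, P)` solves `Q' = gV P`, `P' = -gU Q`. -/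
def IsHamCurve (gU gV : X → X) (γ : ℝ → X × X) : Prop :=
  ∀ t, HasDerivAt γ (gV (γ t).2, -gU (γ t).1) t

/-- The curve `ξ` solves the equation of Hamilton linearized along `γ`. -/
def IsVariation (HU HV : X → X →L[ℝ] X) (γ ξ : ℝ → X × X) : Prop :=
  ∀ t, HasDerivAt ξ (HV (γ t).2 (ξ t).2, -HU (γ t).1 (ξ t).1) t

theorem sq_integral_le {f : ℝ → ℝ} (hf : Continuous f) {T : ℝ} (hT : 0 < T) :
    (∫ t in (0 : ℝ)..T, f t) ^ 2 ≤ T * ∫ t in (0 : ℝ)..T, f t ^ 2 := by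
  set I := ∫ t in (0 : ℝ)..T, f t with hI
  have h : 0 ≤ ∫ t in (0 : ℝ)..T, (f t - I / T) ^ 2 :=
    intervalIntegral.integral_nonneg hT.le fun t _ => sq_nonneg _
  have h1 : ∀ t, (f t - I / T) ^ 2 = f t ^ 2 - 2 * (I / T) * f t + (I / T) ^ 2 := fun t => by ring
  simp only [h1] at h
  rw [intervalIntegral.integral_add (Continuous.intervalIntegrable (by fun_prop) _ _)
    (Continuous.intervalIntegrable (by fun_prop) _ _),
    intervalIntegral.integral_sub (Continuous.intervalIntegrable (by fun_prop) _ _)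
    (Continuous.intervalIntegrable (by fun_prop) _ _), intervalIntegral.integral_const_mul,
    intervalIntegral.integral_const, ← hI, smul_eq_mul] at h
  have h2 : T * (∫ t in (0 : ℝ)..T, f t ^ 2) - I ^ 2 =
      T * ((∫ t in (0 : ℝ)..T, f t ^ 2) - 2 * (I / T) * I + (T - 0) * (I / T) ^ 2) := by
    field_simp; ring
  nlinarith [mul_nonneg hT.le h]

theorem norm_sq_le_of_hasDerivAt [CompleteSpace X] {x g : ℝ → X} (hx : ∀ t, HasDerivAt x (g t) t)
    (hg : Continuous g) {T : ℝ} (hT : 0 < T) {t : ℝ} (ht : t ∈ Icc 0 T) :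
    ‖x t‖ ^ 2 ≤ 2 * ‖x 0‖ ^ 2 + 2 * T * ∫ s in (0 : ℝ)..T, ‖g s‖ ^ 2 := by
  have h1 : ∫ s in (0 : ℝ)..t, g s = x t - x 0 :=
    intervalIntegral.integral_eq_sub_of_hasDerivAt (fun s _ => hx s) (hg.intervalIntegrable _ _)
  have h2 : ‖x t - x 0‖ ≤ ∫ s in (0 : ℝ)..T, ‖g s‖ := by
    rw [← h1]
    refine (intervalIntegral.norm_integral_le_integral_norm ht.1).trans ?_
    exact intervalIntegral.integral_mono_interval le_rfl ht.1 ht.2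
      (Filter.Eventually.of_forall fun s => norm_nonneg _) (hg.norm.intervalIntegrable _ _)
  have h3 := sq_integral_le hg.norm hT
  have h4 : ‖x t - x 0‖ ^ 2 ≤ (∫ s in (0 : ℝ)..T, ‖g s‖) ^ 2 := by gcongr
  have h5 : ‖x t‖ ≤ ‖x 0‖ + ‖x t - x 0‖ := by
    simpa using norm_add_le (x 0) (x t - x 0)
  nlinarith [sq_nonneg (‖x 0‖ - ‖x t - x 0‖), norm_nonneg (x t)]

section

variable {gU gV : X → X} {HU HV : X → X →L[ℝ] X} {R c K : ℝ} {γ ξ : ℝ → X × X}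

theorem IsHamCurve.continuous (hγ : IsHamCurve gU gV γ) : Continuous γ :=
  continuous_iff_continuousAt.2 fun t => (hγ t).continuousAt

theorem IsHamCurve.hasDerivAt_fst (hγ : IsHamCurve gU gV γ) (t : ℝ) :
    HasDerivAt (fun t => (γ t).1) (gV (γ t).2) t := by
  exact hasFDerivAt_fst.comp_hasDerivAt (f := γ) t (hγ t)

theorem IsHamCurve.hasDerivAt_snd (hγ : IsHamCurve gU gV γ) (t : ℝ) :
    HasDerivAt (fun t => (γ t).2) (-gU (γ t).1) t := by
  exact hasFDerivAt_snd.comp_hasDerivAt (f := γ) t (hγ t)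

theorem IsVariation.continuous (hξ : IsVariation HU HV γ ξ) : Continuous ξ :=
  continuous_iff_continuousAt.2 fun t => (hξ t).continuousAt

theorem IsVariation.hasDerivAt_fst (hξ : IsVariation HU HV γ ξ) (t : ℝ) :
    HasDerivAt (fun t => (ξ t).1) (HV (γ t).2 (ξ t).2) t := by
  exact hasFDerivAt_fst.comp_hasDerivAt (f := ξ) t (hξ t)

theorem IsVariation.hasDerivAt_snd (hξ : IsVariation HU HV γ ξ) (t : ℝ) :
    HasDerivAt (fun t => (ξ t).2) (-HU (γ t).1 (ξ t).1) t := by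
  exact hasFDerivAt_snd.comp_hasDerivAt (f := ξ) t (hξ t)

/-- A constant that bounds the linear growth of both forces. -/
theorem exists_linear_bound (hU : IsForce gU HU R c K) (hV : IsForce gV HV R c K) :
    ∃ L, 0 < L ∧ (∀ q, ‖gU q‖ ≤ L * (1 + ‖q‖)) ∧ (∀ p, ‖gV p‖ ≤ L * (1 + ‖p‖)) ∧
      ∀ z : X × X, ‖(gV z.2, -gU z.1)‖ ≤ L * (1 + ‖z‖) := by
  have hK := hU.K_pos
  set L := K + ‖gU 0‖ + ‖gV 0‖ with hL
  have h1 : ∀ q, ‖gU q‖ ≤ L * (1 + ‖q‖) := fun q => (hU.norm_le_linear q).trans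
    (mul_le_mul_of_nonneg_right (by linarith [norm_nonneg (gV 0)]) (by positivity))
  have h2 : ∀ q, ‖gV q‖ ≤ L * (1 + ‖q‖) := fun q => (hV.norm_le_linear q).trans
    (mul_le_mul_of_nonneg_right (by linarith [norm_nonneg (gU 0)]) (by positivity))
  have hL0 : 0 < L := by positivity
  refine ⟨L, hL0, h1, h2, fun z => ?_⟩
  rw [Prod.norm_def, norm_neg]
  refine max_le ((h2 _).trans ?_) ((h1 _).trans ?_)
  · exact mul_le_mul_of_nonneg_left (by linarith [norm_snd_le z]) hL0.le
  · exact mul_le_mul_of_nonneg_left (by linarith [norm_fst_le z]) hL0.le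

theorem IsHamCurve.one_add_norm_le (hγ : IsHamCurve gU gV γ) {L : ℝ} (hL : 0 < L)
    (hb : ∀ z : X × X, ‖(gV z.2, -gU z.1)‖ ≤ L * (1 + ‖z‖)) {T s t : ℝ} (h : |t - s| ≤ T) :
    1 + ‖γ t‖ ≤ (1 + ‖γ s‖) * Real.exp (L * T) := by
  refine (one_add_norm_le_exp hL hγ (fun t => hb (γ t)) s t).trans ?_
  gcongr

set_option maxHeartbeats 1000000 in
/-- The momenta at the two ends of a time interval of length `T < π / a` control the whole
motion. -/
theorem boundary_control [CompleteSpace X] [Nontrivial X] (hU : IsForce gU HU R c K)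
    (hV : IsForce gV HV R c K) {a T : ℝ} (ha : 0 < a) (hT : 0 < T) (haT : a * T < Real.pi)
    (hc : ∀ q p, R < ‖q‖ → R < ‖p‖ → ∀ v,
      inner ℝ (HU q (HV p v)) (HV p v) ≤ a ^ 2 * inner ℝ (HV p v) v) :
    ∃ D, 0 < D ∧ ∀ γ : ℝ → X × X, IsHamCurve gU gV γ →
      1 + ‖γ 0‖ ≤ D * (1 + ‖(γ 0).2‖ + ‖(γ T).2‖) := by
  have hc0 := hU.c_pos
  have hK := hU.K_pos
  have hR := hU.R_pos
  obtain ⟨L, hL, hLU, hLV, hLb⟩ := exists_linear_bound hU hV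
  set N := hV.outerSeminorm with hN
  obtain ⟨κ, D₀, hκ, hD₀, hS⟩ := sturm_estimate (Real.sqrt_nonneg K) hV.outerSeminorm_le ha hT haT
  obtain ⟨D₁, hD₁, h₁⟩ : ∃ D₁, 0 ≤ D₁ ∧ ∀ q,
      N (gU q) ^ 2 ≤ a ^ 2 * inner ℝ (gU q) q + D₁ * (1 + ‖q‖) := by
    refine ⟨(K + ‖gU 0‖) ^ 2 * (R + 2) ^ 2 * (3 * K) + a ^ 2 * ((K + ‖gU 0‖) * (R + 2) * 2),
      by positivity, fun q => ?_⟩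
    -- The constants of `form_force_le` do not depend on `p`, so the supremum over `p` can be taken,
    -- which replaces the form of `HV p` by `N²`.
    · have key := fun p hp => hU.form_force_le ha (hV.symm p) (hV.norm_le p)
        (fun x hx v => hc x p hx hp v) q
      obtain ⟨p, hp⟩ := NormedSpace.exists_lt_norm ℝ X R
      exact hV.outerSeminorm_sq_le ((hV.inner_nonneg hp _).trans (key p hp)) key
  obtain ⟨D₂, hD₂, h₂⟩ := hV.inner_le_of_form N fun p hp v => hV.inner_le_outerSeminorm hp v
  obtain ⟨D₃, hD₃, h₃⟩ := hU.norm_ge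
  set x := Real.exp (L * T) with hx
  have hx1 : 1 ≤ x := Real.one_le_exp (by positivity)
  set E := (D₁ / a ^ 2 + D₂) * x with hE
  have hE0 : 0 ≤ E := by positivity
  set A := (2 * x + D₀ * (2 * x + 2) + 2 * T * E) / (κ * c) with hA
  have hA0 : 0 ≤ A := by positivity
  set B := 3 * x ^ 2 * (T + T * (2 * (x + 1)) + 2 * T * T * A + (2 * A + 2 * T * D₃ ^ 2) / c ^ 2)
    with hB
  refine ⟨B / T + 1, by positivity, fun γ hγ => ?_⟩
  set M := 1 + ‖γ 0‖ with hM
  have hM1 : 1 ≤ M := by rw [hM]; linarith [norm_nonneg (γ 0)]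
  set S := 1 + ‖(γ 0).2‖ + ‖(γ T).2‖ with hSd
  have hP0 := norm_nonneg (γ 0).2
  have hPT := norm_nonneg (γ T).2
  have hS1 : 1 ≤ S := by rw [hSd]; linarith
  have hup : ∀ t ∈ Icc 0 T, 1 + ‖γ t‖ ≤ M * x := fun t ht =>
    hγ.one_add_norm_le hL hLb (by rw [sub_zero, abs_of_nonneg ht.1]; exact ht.2)
  have hdown : ∀ t ∈ Icc 0 T, M ≤ (1 + ‖γ t‖) * x := fun t ht =>
    hγ.one_add_norm_le hL hLb (by rw [zero_sub, abs_neg, abs_of_nonneg ht.1]; exact ht.2)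
  have hSM : S ≤ M * (x + 1) := by
    have := hup T ⟨hT.le, le_rfl⟩
    have h4 := norm_snd_le (γ 0)
    have h5 := norm_snd_le (γ T)
    rw [hSd]; linarith
  have hγc := hγ.continuous
  have hQc : Continuous fun t => (γ t).1 := continuous_fst.comp hγc
  have hgc : Continuous fun t => -gU (γ t).1 := (hU.continuous.comp hQc).neg
  -- The momentum plays the role of `x` and minus the position that of `y`. The errors grow linearly
  -- in the phase point, so by Grönwall they are at most the constant `E * M`, one order below the
  -- quadratic main terms.
  have hst := hS (fun t => (γ t).2) (fun t => -(γ t).1) (fun t => -gU (γ t).1)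
    (fun t => gV (γ t).2) (fun _ => E * M) hγ.hasDerivAt_snd (fun t => (hγ.hasDerivAt_fst t).neg)
    hgc (hV.continuous.comp (continuous_snd.comp hγc)) intervalIntegrable_const
    (fun t ht => by
      have h4 := h₁ (γ t).1
      have h5 : 1 + ‖(γ t).1‖ ≤ M * x := by linarith [hup t ht, norm_fst_le (γ t)]
      have h6 : D₁ * (1 + ‖(γ t).1‖) ≤ D₁ * (M * x) := by gcongr
      have h7 : a ^ 2 * (D₁ / a ^ 2) = D₁ := by field_simp
      have h8 : 0 ≤ a ^ 2 * D₂ * x * M := by positivity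
      rw [map_neg_eq_map, inner_neg_neg]
      calc _ ≤ _ := h4
        _ ≤ a ^ 2 * inner ℝ (gU (γ t).1) (γ t).1 + (a ^ 2 * (D₁ / a ^ 2)) * (M * x) := by
          rw [h7]; linarith
        _ ≤ _ := by rw [hE]; nlinarith)
    (fun t ht => by
      have h4 := h₂ (γ t).2
      have h5 : 1 + ‖(γ t).2‖ ≤ M * x := by linarith [hup t ht, norm_snd_le (γ t)]
      have h6 : D₂ * (1 + ‖(γ t).2‖) ≤ D₂ * (M * x) := by gcongr
      have h8 : 0 ≤ D₁ / a ^ 2 * x * M := by positivity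
      rw [hE]; nlinarith)
  rw [intervalIntegral.integral_const, smul_eq_mul, sub_zero] at hst
  set J := ∫ t in (0 : ℝ)..T, ‖-gU (γ t).1‖ ^ 2 with hJ
  have hJ0 : 0 ≤ J := intervalIntegral.integral_nonneg hT.le fun t _ => sq_nonneg _
  have hNc := (Seminorm.lipschitzWith_of_le_norm (Real.sqrt_nonneg K) hV.outerSeminorm_le).continuous
  have hJN : c * J ≤ ∫ t in (0 : ℝ)..T, N (-gU (γ t).1) ^ 2 := by
    rw [hJ, ← intervalIntegral.integral_const_mul]
    exact intervalIntegral.integral_mono_on hT.le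
      ((continuous_const.mul (hgc.norm.pow 2)).intervalIntegrable _ _)
      (((hNc.comp hgc).pow 2).intervalIntegrable _ _) fun t _ => hV.le_outerSeminorm_sq _
  -- Each boundary term has a factor that is an end momentum, hence at most `S`, and another of
  -- order `M`; the error is of order `M ≤ S * M`.
  have hJA : J ≤ A * (S * M) := by
    rw [hA, div_mul_eq_mul_div, le_div_iff₀ (by positivity)]
    have e1 : ‖(γ 0).2‖ * ‖-(γ 0).1‖ ≤ S * (M * x) := by
      have := norm_fst_le (γ 0)
      rw [norm_neg]
      gcongr
      · rw [hSd]; linarith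
      · nlinarith
    have e2 : ‖(γ T).2‖ * ‖-(γ T).1‖ ≤ S * (M * x) := by
      have := norm_fst_le (γ T)
      have := hup T ⟨hT.le, le_rfl⟩
      rw [norm_neg]
      gcongr
      · rw [hSd]; linarith
      · linarith
    have e3 : ‖(γ 0).2‖ ^ 2 + ‖(γ T).2‖ ^ 2 ≤ S * (M * (x + 1)) := by
      have : S * S ≤ S * (M * (x + 1)) := by gcongr
      rw [hSd] at this ⊢
      nlinarith
    have e4 : D₀ * (‖(γ 0).2‖ ^ 2 + ‖(γ T).2‖ ^ 2) ≤ D₀ * (S * (M * (x + 1))) := by gcongr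
    have e5 : T * (E * M) ≤ T * (E * M) * S := le_mul_of_one_le_right (by positivity) hS1
    have e6 : κ * (c * J) ≤ κ * ∫ t in (0 : ℝ)..T, N (-gU (γ t).1) ^ 2 := by gcongr
    have e7 : 0 ≤ D₀ * (S * (M * (x + 1))) := by positivity
    have e8 : (2 * x + D₀ * (2 * x + 2) + 2 * T * E) * (S * M) = 2 * (S * (M * x)) +
        2 * (D₀ * (S * (M * (x + 1)))) + 2 * (T * (E * M) * S) := by ring
    have e9 : J * (κ * c) = κ * (c * J) := by ring
    rw [e8, e9]
    linarith
  -- By Grönwall the point at any time `t` controls `M`; the momentum there is controlled by `J`,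
  -- the position by the force. Integration over `t` gives `M² ≲ S * M`, and one factor `M` cancels.
  have hpt : ∀ t ∈ Icc 0 T, M ^ 2 ≤ 3 * x ^ 2 * (1 + 2 * (M * (x + 1)) * S + 2 * T * J +
      (2 * ‖-gU (γ t).1‖ ^ 2 + 2 * D₃ ^ 2) / c ^ 2) := by
    intro t ht
    have e1 := norm_sq_le_of_hasDerivAt hγ.hasDerivAt_snd hgc hT ht
    rw [← hJ] at e1
    have e2 : ‖(γ 0).2‖ ^ 2 ≤ M * (x + 1) * S := by
      have : ‖(γ 0).2‖ ≤ S := by rw [hSd]; linarith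
      calc ‖(γ 0).2‖ ^ 2 ≤ S ^ 2 := by gcongr
        _ = S * S := sq S
        _ ≤ _ := by gcongr
    have e3 : ‖(γ t).1‖ ^ 2 ≤ (2 * ‖-gU (γ t).1‖ ^ 2 + 2 * D₃ ^ 2) / c ^ 2 := by
      rw [le_div_iff₀ (by positivity), norm_neg]
      have h4 := h₃ (γ t).1
      have h5 : (c * ‖(γ t).1‖) ^ 2 ≤ (‖gU (γ t).1‖ + D₃) ^ 2 := by gcongr
      nlinarith [sq_nonneg (‖gU (γ t).1‖ - D₃)]
    have e4 : 1 + ‖γ t‖ ≤ 1 + ‖(γ t).1‖ + ‖(γ t).2‖ := by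
      rw [Prod.norm_def, add_assoc]
      exact add_le_add_right (max_le_add_of_nonneg (norm_nonneg _) (norm_nonneg _)) _
    have e5 : M ^ 2 ≤ ((1 + ‖(γ t).1‖ + ‖(γ t).2‖) * x) ^ 2 := by
      have := hdown t ht
      gcongr
      exact this.trans (by gcongr)
    have e6 : (1 + ‖(γ t).1‖ + ‖(γ t).2‖) ^ 2 ≤ 3 * (1 + ‖(γ t).1‖ ^ 2 + ‖(γ t).2‖ ^ 2) := by
      nlinarith [sq_nonneg (1 - ‖(γ t).1‖), sq_nonneg (1 - ‖(γ t).2‖),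
        sq_nonneg (‖(γ t).1‖ - ‖(γ t).2‖)]
    calc M ^ 2 ≤ _ := e5
      _ = (1 + ‖(γ t).1‖ + ‖(γ t).2‖) ^ 2 * x ^ 2 := by ring
      _ ≤ 3 * (1 + ‖(γ t).1‖ ^ 2 + ‖(γ t).2‖ ^ 2) * x ^ 2 := by gcongr
      _ = 3 * x ^ 2 * (1 + ‖(γ t).1‖ ^ 2 + ‖(γ t).2‖ ^ 2) := by ring
      _ ≤ _ := by gcongr ?_ * ?_; linarith
  have hint := intervalIntegral.integral_mono_on (μ := volume) hT.le (g := fun t => 3 * x ^ 2 *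
      (1 + 2 * (M * (x + 1)) * S + 2 * T * J + (2 * ‖-gU (γ t).1‖ ^ 2 + 2 * D₃ ^ 2) / c ^ 2))
      (intervalIntegrable_const (c := M ^ 2))
      (Continuous.intervalIntegrable (by
        have := hgc.norm
        fun_prop) _ _) hpt
  rw [intervalIntegral.integral_const_mul, intervalIntegral.integral_add intervalIntegrable_const
      (Continuous.intervalIntegrable (by have := hgc.norm; fun_prop) _ _),
    intervalIntegral.integral_const, intervalIntegral.integral_const,
    intervalIntegral.integral_div, intervalIntegral.integral_add
      (Continuous.intervalIntegrable (by have := hgc.norm; fun_prop) _ _) intervalIntegrable_const,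
    intervalIntegral.integral_const_mul, ← hJ, intervalIntegral.integral_const, sub_zero,
    smul_eq_mul, smul_eq_mul, smul_eq_mul] at hint
  have hSM1 : 1 ≤ S * M := by nlinarith
  have hfin : T * M ^ 2 ≤ B * (S * M) := by
    refine hint.trans ?_
    rw [hB]
    have e1 : T * 1 ≤ T * (S * M) := by gcongr
    have e2 : 2 * T * T * J ≤ 2 * T * T * (A * (S * M)) := by gcongr
    have e3 : (2 * J + T * (2 * D₃ ^ 2)) / c ^ 2 ≤
        (2 * A + 2 * T * D₃ ^ 2) / c ^ 2 * (S * M) := by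
      rw [div_mul_eq_mul_div]
      gcongr
      have e4 : 2 * T * D₃ ^ 2 * 1 ≤ 2 * T * D₃ ^ 2 * (S * M) := by gcongr
      calc 2 * J + T * (2 * D₃ ^ 2) ≤ 2 * (A * (S * M)) + 2 * T * D₃ ^ 2 * (S * M) := by linarith
        _ = _ := by ring
    rw [mul_assoc (3 * x ^ 2)]
    refine mul_le_mul_of_nonneg_left ?_ (by positivity)
    calc T * (1 + 2 * (M * (x + 1)) * S + 2 * T * J) + (2 * J + T * (2 * D₃ ^ 2)) / c ^ 2
        ≤ T * (S * M) + T * (2 * (x + 1)) * (S * M) + 2 * T * T * (A * (S * M)) +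
          (2 * A + 2 * T * D₃ ^ 2) / c ^ 2 * (S * M) := by linarith
      _ = _ := by ring
  have : T * M ≤ B * S := by
    have h0 : T * M * M ≤ B * S * M := by
      calc T * M * M = T * M ^ 2 := by ring
        _ ≤ B * (S * M) := hfin
        _ = B * S * M := by ring
    exact le_of_mul_le_mul_right h0 (by linarith)
  have : M ≤ B / T * S := by
    rw [div_mul_eq_mul_div, le_div_iff₀ hT]; linarith
  linarith

end

end Hamilton

/-! ### Absence of conjugate points along fast motions. -/

section Nondegenerate

open scoped Topology

variable {X : Type*} [NormedAddCommGroup X] [InnerProductSpace ℝ X]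
variable {gU gV : X → X} {HU HV : X → X →L[ℝ] X} {R c K : ℝ} {γ ξ : ℝ → X × X}

/-- The times in `[0, T]` at which the position or the momentum is inside the ball. -/
def badTimes (γ : ℝ → X × X) (R T : ℝ) : Set ℝ :=
  {t ∈ Icc 0 T | ‖(γ t).1‖ ≤ R ∨ ‖(γ t).2‖ ≤ R}

theorem measurableSet_badTimes {Y : Type*} [NormedAddCommGroup Y] {γ : ℝ → Y × Y}
    (hγ : Continuous γ) (R T : ℝ) : MeasurableSet (badTimes γ R T) := by
  refine measurableSet_Icc.inter (IsClosed.measurableSet ?_)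
  exact (isClosed_le (continuous_fst.comp hγ).norm continuous_const).union
    (isClosed_le (continuous_snd.comp hγ).norm continuous_const)

theorem variation_lipschitz (hU : IsForce gU HU R c K) (hV : IsForce gV HV R c K)
    (γ : ℝ → X × X) (t : ℝ) : LipschitzWith K.toNNReal
      (fun z : X × X => (HV (γ t).2 z.2, -HU (γ t).1 z.1)) := by
  refine LipschitzWith.of_dist_le_mul fun z w => ?_
  rw [Real.coe_toNNReal _ hU.K_pos.le, dist_eq_norm, dist_eq_norm, Prod.norm_def]
  have h1 : ∀ (A : X →L[ℝ] X) (u v : X), ‖A‖ ≤ K → ‖u - v‖ ≤ ‖z - w‖ →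
      ‖A u - A v‖ ≤ K * ‖z - w‖ := fun A u v hA huv => by
    rw [← map_sub]
    exact (A.le_of_opNorm_le hA _).trans (mul_le_mul_of_nonneg_left huv hU.K_pos.le)
  refine max_le (h1 _ _ _ (hV.norm_le _) (norm_snd_le (z - w))) ?_
  simp only [Prod.snd_sub, ← neg_sub', norm_neg]
  exact h1 _ _ _ (hU.norm_le _) (norm_fst_le (z - w))

theorem variation_norm_le (hU : IsForce gU HU R c K) (hV : IsForce gV HV R c K)
    (hξ : IsVariation HU HV γ ξ) (s t : ℝ) : ‖ξ t‖ ≤ ‖ξ s‖ * Real.exp (K * |t - s|) := by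
  have h0 : ∀ t, HasDerivAt (fun _ : ℝ => (0 : X × X))
      (HV (γ t).2 (0 : X × X).2, -HU (γ t).1 (0 : X × X).1) t := fun t =>
    (hasDerivAt_const t (0 : X × X)).congr_deriv (by simp; rfl)
  simpa [Real.coe_toNNReal _ hU.K_pos.le] using
    dist_integralCurve_le (variation_lipschitz hU hV γ) hξ h0 s t

set_option maxHeartbeats 1000000 in
/-- Along a motion that spends little time inside the ball there are no nontrivial variations which
fix the positions at both ends. -/
theorem variation_eq_zero [CompleteSpace X] [Nontrivial X] (hU : IsForce gU HU R c K)
    (hV : IsForce gV HV R c K) {a T : ℝ} (ha : 0 < a) (hT : 0 < T) (haT : a * T < Real.pi)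
    (hc : ∀ q p, R < ‖q‖ → R < ‖p‖ → ∀ v,
      inner ℝ (HU q (HV p v)) (HV p v) ≤ a ^ 2 * inner ℝ (HV p v) v) :
    ∃ τ, 0 < τ ∧ ∀ γ ξ : ℝ → X × X, Continuous γ → IsVariation HU HV γ ξ →
      volume (badTimes γ R T) ≤ ENNReal.ofReal τ → (ξ 0).1 = 0 → (ξ T).1 = 0 → ξ = 0 := by
  have hc0 := hU.c_pos
  have hK := hU.K_pos
  set N := hU.outerSeminorm with hN
  obtain ⟨κ, D₀, hκ, hD₀, hS⟩ := sturm_estimate (Real.sqrt_nonneg K) hU.outerSeminorm_le ha hT haT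
  set x := Real.exp (K * T) with hx
  have hx0 : 0 < x := Real.exp_pos _
  set E := K ^ 3 / a ^ 2 + K with hE
  have hE0 : 0 < E := by positivity
  set A := 2 * E * x ^ 2 / (κ * c) with hA
  have hA0 : 0 ≤ A := by positivity
  set B := x ^ 2 * (T * (2 * T * A) + (A / c ^ 2 + x ^ 2)) with hB
  have hB0 : 0 < B := by positivity
  -- The estimates below end in `T * M² ≤ B * M² * τ` with `τ` the time spent in the ball. For `τ ≤
  -- T / (2 * B)` this forces `M = 0`.
  refine ⟨T / (2 * B), by positivity, fun γ ξ hγ hξ hbad h0 hT0 => ?_⟩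
  set M := ‖ξ 0‖ with hM
  suffices hM0 : M = 0 by
    ext1 t
    have := variation_norm_le hU hV hξ 0 t
    rw [← hM, hM0, zero_mul] at this
    simpa using norm_le_zero_iff.1 this
  have hMn : 0 ≤ M := norm_nonneg _
  have hup : ∀ t ∈ Icc 0 T, ‖ξ t‖ ≤ M * x := fun t ht => by
    refine (variation_norm_le hU hV hξ 0 t).trans ?_
    rw [sub_zero, abs_of_nonneg ht.1]
    refine mul_le_mul_of_nonneg_left (Real.exp_le_exp.2 ?_) (norm_nonneg _)
    exact mul_le_mul_of_nonneg_left ht.2 hK.le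
  have hdown : ∀ t ∈ Icc 0 T, M ≤ ‖ξ t‖ * x := fun t ht => by
    refine (variation_norm_le hU hV hξ t 0).trans ?_
    rw [zero_sub, abs_neg, abs_of_nonneg ht.1]
    refine mul_le_mul_of_nonneg_left (Real.exp_le_exp.2 ?_) (norm_nonneg _)
    exact mul_le_mul_of_nonneg_left ht.2 hK.le
  have hξc := hξ.continuous
  set b := badTimes γ R T with hb
  have hbm : MeasurableSet b := measurableSet_badTimes hγ R T
  set χ : ℝ → ℝ := b.indicator (fun _ => 1) with hχ
  have hχi : ∀ r, IntervalIntegrable (fun t => r * χ t) volume 0 T := fun r => by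
    refine IntervalIntegrable.const_mul ?_ _
    rw [intervalIntegrable_iff, hχ]
    exact (integrableOn_const (by simp)).indicator hbm
  have hχint : ∫ t in (0 : ℝ)..T, χ t ≤ T / (2 * B) := by
    rw [intervalIntegral.integral_of_le hT.le, hχ, integral_indicator hbm]
    simp only [integral_const, smul_eq_mul, mul_one, measureReal_restrict_apply_univ]
    rw [Measure.real, Measure.restrict_apply hbm]
    refine ENNReal.toReal_le_of_le_ofReal (by positivity) ?_
    exact (measure_mono inter_subset_left).trans hbad
  have hgc : Continuous fun t => HV (γ t).2 (ξ t).2 :=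
    (hV.continuous_deriv.comp (continuous_snd.comp hγ)).clm_apply (continuous_snd.comp hξc)
  have hhc : Continuous fun t => HU (γ t).1 (ξ t).1 :=
    (hU.continuous_deriv.comp (continuous_fst.comp hγ)).clm_apply (continuous_fst.comp hξc)
  have hgood : ∀ t ∈ Icc 0 T, t ∉ b → R < ‖(γ t).1‖ ∧ R < ‖(γ t).2‖ := fun t ht htb => by
    by_contra h
    rw [not_and_or, not_lt, not_lt] at h
    exact htb ⟨ht, h⟩
  -- Here the position component of the variation plays the role of `x`, and the seminorm comes from
  -- `U`. At good times `hc` gives both hypotheses without error; at bad times crude norm bounds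
  -- cost at most `E * (M * x)²`.
  have hst := hS (fun t => (ξ t).1) (fun t => (ξ t).2) (fun t => HV (γ t).2 (ξ t).2)
    (fun t => HU (γ t).1 (ξ t).1) (fun t => E * (M * x) ^ 2 * χ t) hξ.hasDerivAt_fst
    hξ.hasDerivAt_snd hgc hhc (hχi _)
    (fun t ht => by
      by_cases htb : t ∈ b
      · simp only [hχ, indicator_of_mem htb, mul_one]
        have h1 : ‖(ξ t).2‖ ≤ M * x := (norm_snd_le _).trans (hup t ht)
        have h2 : ‖HV (γ t).2 (ξ t).2‖ ≤ K * ‖(ξ t).2‖ := (HV _).le_of_opNorm_le (hV.norm_le _) _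
        have h3 : N (HV (γ t).2 (ξ t).2) ^ 2 ≤ K * ‖HV (γ t).2 (ξ t).2‖ ^ 2 :=
          hU.outerSeminorm_sq_le (by positivity) fun q _ => hU.inner_le q _
        have h4 := (abs_le.1 (abs_real_inner_le_norm (HV (γ t).2 (ξ t).2) (ξ t).2)).1
        have h5 : ‖HV (γ t).2 (ξ t).2‖ * ‖(ξ t).2‖ ≤ K * (M * x) * (M * x) := by
          refine mul_le_mul (h2.trans (by gcongr)) h1 (norm_nonneg _) (by positivity)
        have h6 : K * ‖HV (γ t).2 (ξ t).2‖ ^ 2 ≤ K * (K * (M * x)) ^ 2 := by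
          gcongr; exact h2.trans (by gcongr)
        have h7 : a ^ 2 * (K ^ 3 / a ^ 2) = K ^ 3 := by field_simp
        calc _ ≤ K * (K * (M * x)) ^ 2 := h3.trans h6
          _ = a ^ 2 * (K ^ 3 / a ^ 2) * (M * x) ^ 2 := by rw [h7]; ring
          _ = a ^ 2 * (-(K * (M * x) * (M * x)) + E * (M * x) ^ 2) := by rw [hE]; ring
          _ ≤ _ := by gcongr; linarith
      · obtain ⟨h1, h2⟩ := hgood t ht htb
        simp only [hχ, indicator_of_notMem htb, mul_zero, add_zero]
        exact hU.outerSeminorm_sq_le (mul_nonneg (sq_nonneg a) (hV.inner_nonneg h2 _))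
          fun q hq => hc q _ hq h2 _)
    (fun t ht => by
      by_cases htb : t ∈ b
      · simp only [hχ, indicator_of_mem htb, mul_one]
        have h1 : ‖(ξ t).1‖ ≤ M * x := (norm_fst_le _).trans (hup t ht)
        have h2 := hU.inner_le (γ t).1 (ξ t).1
        have h3 : K * ‖(ξ t).1‖ ^ 2 ≤ K * (M * x) ^ 2 := by gcongr
        have h4 : 0 ≤ K ^ 3 / a ^ 2 * (M * x) ^ 2 := by positivity
        have h5 := sq_nonneg (hU.outerSeminorm (ξ t).1)
        rw [hE]; linarith
      · obtain ⟨h1, h2⟩ := hgood t ht htb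
        simp only [hχ, indicator_of_notMem htb, mul_zero, add_zero]
        exact hU.inner_le_outerSeminorm h1 _)
  simp only [h0, hT0, norm_zero, zero_mul, zero_add, ne_eq, OfNat.ofNat_ne_zero,
    not_false_eq_true, zero_pow, mul_zero, intervalIntegral.integral_const_mul] at hst
  set τ := ∫ t in (0 : ℝ)..T, χ t with hτ
  set J := ∫ t in (0 : ℝ)..T, ‖HV (γ t).2 (ξ t).2‖ ^ 2 with hJ
  have hJ0 : 0 ≤ J := intervalIntegral.integral_nonneg hT.le fun t _ => sq_nonneg _
  have hNc := (Seminorm.lipschitzWith_of_le_norm (Real.sqrt_nonneg K) hU.outerSeminorm_le).continuous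
  have hJN : c * J ≤ ∫ t in (0 : ℝ)..T, N (HV (γ t).2 (ξ t).2) ^ 2 := by
    rw [hJ, ← intervalIntegral.integral_const_mul]
    exact intervalIntegral.integral_mono_on hT.le
      ((continuous_const.mul (hgc.norm.pow 2)).intervalIntegrable _ _)
      (((hNc.comp hgc).pow 2).intervalIntegrable _ _) fun t _ => hU.le_outerSeminorm_sq _
  have hJA : J ≤ A * (M ^ 2 * τ) := by
    rw [hA, div_mul_eq_mul_div, le_div_iff₀ (by positivity)]
    have e1 : κ * (c * J) ≤ κ * ∫ t in (0 : ℝ)..T, N (HV (γ t).2 (ξ t).2) ^ 2 := by gcongr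
    calc J * (κ * c) = κ * (c * J) := by ring
      _ ≤ _ := e1.trans hst
      _ = _ := by ring
  have hpt : ∀ t ∈ Icc 0 T, M ^ 2 ≤ x ^ 2 * (2 * T * J + (‖HV (γ t).2 (ξ t).2‖ ^ 2 / c ^ 2 +
      (M * x) ^ 2 * χ t)) := by
    intro t ht
    have e1 := norm_sq_le_of_hasDerivAt hξ.hasDerivAt_fst hgc hT ht
    rw [← hJ, h0, norm_zero] at e1
    have e2 : ‖(ξ t).2‖ ^ 2 ≤ ‖HV (γ t).2 (ξ t).2‖ ^ 2 / c ^ 2 + (M * x) ^ 2 * χ t := by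
      by_cases htb : t ∈ b
      · have h1 : ‖(ξ t).2‖ ≤ M * x := (norm_snd_le _).trans (hup t ht)
        have h2 : ‖(ξ t).2‖ ^ 2 ≤ (M * x) ^ 2 := by gcongr
        simp only [hχ, indicator_of_mem htb, mul_one]
        have : 0 ≤ ‖HV (γ t).2 (ξ t).2‖ ^ 2 / c ^ 2 := by positivity
        linarith
      · obtain ⟨-, h2⟩ := hgood t ht htb
        simp only [hχ, indicator_of_notMem htb, mul_zero, add_zero]
        rw [le_div_iff₀ (by positivity), mul_comm, ← mul_pow]
        have := hV.norm_apply_ge h2 (ξ t).2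
        gcongr
    have e3 : ‖ξ t‖ ^ 2 ≤ ‖(ξ t).1‖ ^ 2 + ‖(ξ t).2‖ ^ 2 := by
      rw [Prod.norm_def]
      rcases max_choice ‖(ξ t).1‖ ‖(ξ t).2‖ with h | h <;> rw [h] <;> nlinarith [sq_nonneg ‖(ξ t).1‖,
        sq_nonneg ‖(ξ t).2‖]
    have e4 : M ^ 2 ≤ (‖ξ t‖ * x) ^ 2 := by
      have := hdown t ht
      gcongr
    calc M ^ 2 ≤ x ^ 2 * ‖ξ t‖ ^ 2 := e4.trans (by rw [mul_pow]; linarith)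
      _ ≤ _ := by gcongr ?_ * ?_; linarith
  have hi1 : IntervalIntegrable (fun t => ‖HV (γ t).2 (ξ t).2‖ ^ 2 / c ^ 2) volume 0 T :=
    Continuous.intervalIntegrable (by have := hgc.norm; fun_prop) _ _
  have hint := intervalIntegral.integral_mono_on (μ := volume) hT.le
      (intervalIntegrable_const (c := M ^ 2))
      ((intervalIntegrable_const.add (hi1.add (hχi ((M * x) ^ 2)))).const_mul (x ^ 2)) hpt
  rw [intervalIntegral.integral_const_mul, intervalIntegral.integral_add intervalIntegrable_const
      (hi1.add (hχi _)), intervalIntegral.integral_add hi1 (hχi _),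
    intervalIntegral.integral_const, intervalIntegral.integral_const,
    intervalIntegral.integral_div, ← hJ, intervalIntegral.integral_const_mul, ← hτ, sub_zero,
    smul_eq_mul, smul_eq_mul] at hint
  have hfin : T * M ^ 2 ≤ B * (M ^ 2 * τ) := by
    refine hint.trans ?_
    have e2 : T * (2 * T * J) ≤ T * (2 * T * (A * (M ^ 2 * τ))) := by gcongr
    have e3 : J / c ^ 2 ≤ A * (M ^ 2 * τ) / c ^ 2 := by gcongr
    calc _ ≤ x ^ 2 * (T * (2 * T * (A * (M ^ 2 * τ))) + (A * (M ^ 2 * τ) / c ^ 2 +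
          (M * x) ^ 2 * τ)) := by gcongr
      _ = _ := by rw [hB]; ring
  have h1 : B * (M ^ 2 * τ) ≤ B * (M ^ 2 * (T / (2 * B))) := by gcongr
  have h2 : B * (M ^ 2 * (T / (2 * B))) = T * M ^ 2 / 2 := by field_simp
  have h3 : T * M ^ 2 ≤ 0 := by linarith
  have h4 : M ^ 2 ≤ 0 := by
    by_contra h
    have := mul_pos hT (not_le.1 h)
    linarith
  nlinarith

/-- Cut `[0, T]` into windows of length `σ`; inside each one the set has diameter at most `r`. -/
theorem volume_le_of_separated {S : Set ℝ} {T σ r : ℝ} (hσ : 0 < σ)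
    (hS : S ⊆ Icc 0 T) (h : ∀ s ∈ S, ∀ t ∈ S, |s - t| ≤ σ → |s - t| ≤ r) :
    volume S ≤ (⌈T / σ⌉₊ + 1 : ℕ) * ENNReal.ofReal r := by
  have hcov : S ⊆ ⋃ k ∈ Finset.range (⌈T / σ⌉₊ + 1), S ∩ Icc (k * σ) ((k + 1) * σ) := by
    intro t ht
    have h0 := hS ht
    refine mem_iUnion₂.2 ⟨⌊t / σ⌋₊, ?_, ht, ?_, ?_⟩
    · rw [Finset.mem_range, Nat.lt_succ_iff]
      refine (Nat.floor_le_ceil _).trans (Nat.ceil_mono ?_)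
      gcongr; exact h0.2
    · rw [← le_div_iff₀ hσ]
      exact Nat.floor_le (div_nonneg h0.1 hσ.le)
    · rw [← div_le_iff₀ hσ]
      exact (Nat.lt_floor_add_one _).le
  refine (measure_mono hcov).trans ((measure_biUnion_finset_le _ _).trans ?_)
  refine (Finset.sum_le_card_nsmul _ _ (ENNReal.ofReal r) fun k _ => ?_).trans ?_
  · refine (Real.volume_le_diam _).trans (Metric.ediam_le fun s hs t ht => ?_)
    rw [edist_dist, Real.dist_eq]
    refine ENNReal.ofReal_le_ofReal (h s hs.1 t ht.1 ?_)
    rw [abs_le]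
    constructor <;> nlinarith [hs.2.1, hs.2.2, ht.2.1, ht.2.2]
  · simp

/-- A curve which moves fast and nearly straight whenever it is in a ball is in the ball only for a
short time. -/
theorem volume_time_in_ball_le {u w : ℝ → X} {T R A B : ℝ} (hA : 0 < A) (hB : 0 < B)
    (hu : ∀ t, HasDerivAt u (w t) t)
    (hw : ∀ s ∈ Icc 0 T, ∀ t ∈ Icc 0 T, ‖w s - w t‖ ≤ A * |s - t|)
    (hin : ∀ t ∈ Icc 0 T, ‖u t‖ ≤ R → B ≤ ‖w t‖) :
    volume {t ∈ Icc 0 T | ‖u t‖ ≤ R} ≤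
      (⌈T / (B / (2 * A))⌉₊ + 1 : ℕ) * ENNReal.ofReal (4 * R / B) := by
  -- In a window of length `B / (2 * A)` the velocity changes by at most `B / 2`. Two times in the
  -- ball then satisfy `|s - t| * B ≤ 2 * R + |s - t| * B / 2`, so `|s - t| ≤ 4 * R / B`.
  refine volume_le_of_separated (by positivity) (fun t ht => ht.1) fun s hs t ht hst => ?_
  have h1 : ‖(u s - s • w t) - (u t - t • w t)‖ ≤ A * |s - t| * ‖s - t‖ := by
    have hd : ∀ r, HasDerivAt (fun r => u r - r • w t) (w r - w t) r := fun r =>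
      ((hu r).sub ((hasDerivAt_id r).smul_const (w t))).congr_deriv (by simp)
    refine (convex_uIcc t s).norm_image_sub_le_of_norm_hasDerivWithin_le
      (fun r _ => (hd r).hasDerivWithinAt) (fun r hr => ?_) left_mem_uIcc right_mem_uIcc
    have hr' : r ∈ Icc 0 T := uIcc_subset_Icc ht.1 hs.1 hr
    refine (hw r hr' t ht.1).trans (mul_le_mul_of_nonneg_left ?_ hA.le)
    exact abs_sub_left_of_mem_uIcc hr
  have h2 : |s - t| * ‖w t‖ ≤ 2 * R + A * |s - t| * |s - t| := by
    have e1 : (s - t) • w t = u s - u t - ((u s - s • w t) - (u t - t • w t)) := by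
      rw [sub_smul]; abel
    have e2 : ‖(s - t) • w t‖ ≤ ‖u s‖ + ‖u t‖ + A * |s - t| * ‖s - t‖ := by
      rw [e1]
      exact (norm_sub_le _ _).trans (add_le_add (norm_sub_le _ _) h1)
    rw [norm_smul, Real.norm_eq_abs] at e2
    linarith [hs.2, ht.2]
  have h3 := hin t ht.1 ht.2
  rw [le_div_iff₀ (by positivity)] at hst
  rw [le_div_iff₀ hB]
  have h4 : |s - t| * B ≤ |s - t| * ‖w t‖ := by gcongr
  have h5 : |s - t| * (|s - t| * (2 * A)) ≤ |s - t| * B := by gcongr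
  linarith

/-- Motions with a large initial momentum spend little time inside the ball. -/
theorem exists_badTimes_small [Nontrivial X] (hU : IsForce gU HU R c K) (hV : IsForce gV HV R c K)
    {T : ℝ} (hT : 0 < T) {τ : ℝ} (hτ : 0 < τ) (q : X) :
    ∃ p : X, ∀ γ : ℝ → X × X, IsHamCurve gU gV γ → γ 0 = (q, p) →
      volume (badTimes γ R T) ≤ ENNReal.ofReal τ := by
  have hc0 := hU.c_pos
  have hK := hU.K_pos
  have hR := hU.R_pos
  obtain ⟨L, hL, hLU, hLV, hLb⟩ := exists_linear_bound hU hV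
  obtain ⟨D, hD, hDU⟩ := hU.norm_ge
  obtain ⟨D', hD', hDV⟩ := hV.norm_ge
  set x := Real.exp (L * T) with hx
  have hx0 : 0 < x := Real.exp_pos _
  set n : ℕ := ⌈T / (c / (2 * x) / (2 * (K * (L * x))))⌉₊ + 1 with hn
  set M₀ := 2 * x * ((c + D + D') / c) + x * (1 + R) + 1 + 8 * R * (n * 2) * x / (c * τ) with hM₀
  obtain ⟨p, hp⟩ := NormedSpace.exists_lt_norm ℝ X M₀
  refine ⟨p, fun γ hγ h0 => ?_⟩
  set M := 1 + ‖γ 0‖ with hM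
  have hMM : M₀ ≤ M := by
    have := norm_snd_le (γ 0)
    rw [h0] at this
    rw [hM, h0]; linarith
  have t1 : 0 ≤ 2 * x * ((c + D + D') / c) := by positivity
  have t2 : 0 ≤ x * (1 + R) := by positivity
  have t3 : 0 ≤ 8 * R * (n * 2) * x / (c * τ) := by positivity
  have hM1 : 0 < M := by linarith
  have hup : ∀ t ∈ Icc 0 T, 1 + ‖γ t‖ ≤ M * x := fun t ht =>
    hγ.one_add_norm_le hL hLb (by rw [sub_zero, abs_of_nonneg ht.1]; exact ht.2)
  have hdown : ∀ t ∈ Icc 0 T, M / x ≤ 1 + ‖γ t‖ := fun t ht => by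
    rw [div_le_iff₀ hx0]
    exact hγ.one_add_norm_le hL hLb (by rw [zero_sub, abs_neg, abs_of_nonneg ht.1]; exact ht.2)
  have hlip : ∀ s ∈ Icc 0 T, ∀ t ∈ Icc 0 T, ‖γ s - γ t‖ ≤ L * (M * x) * |s - t| := by
    intro s hs t ht
    refine (convex_Icc (0 : ℝ) T).norm_image_sub_le_of_norm_hasDerivWithin_le
      (fun r _ => (hγ r).hasDerivWithinAt) (fun r hr => (hLb (γ r)).trans ?_) ht hs
    exact mul_le_mul_of_nonneg_left (hup r hr) hL.le
  have hbig : ∀ t ∈ Icc 0 T, c * (M / (2 * x)) + (D + D') ≤ c * ‖γ t‖ ∧ R < ‖γ t‖ := by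
    intro t ht
    have h1 := hdown t ht
    have h2 : (c + D + D') / c ≤ M / (2 * x) := by
      rw [le_div_iff₀ (by positivity)]; linarith
    have h3 : 1 + R < M / x := by rw [lt_div_iff₀ hx0]; linarith
    have h4 : M / x = 2 * (M / (2 * x)) := by field_simp
    rw [div_le_iff₀ hc0] at h2
    constructor
    · nlinarith
    · linarith
  have hB : 0 < c * (M / (2 * x)) := by positivity
  have key : ∀ u w : ℝ → X, (∀ t, HasDerivAt u (w t) t) →
      (∀ s ∈ Icc 0 T, ∀ t ∈ Icc 0 T, ‖w s - w t‖ ≤ K * ‖γ s - γ t‖) →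
      (∀ t ∈ Icc 0 T, ‖u t‖ ≤ R → c * ‖γ t‖ ≤ ‖w t‖ + (D + D')) →
      volume {t ∈ Icc 0 T | ‖u t‖ ≤ R} ≤ ENNReal.ofReal (τ / 2) := by
    intro u w hu hw hin
    refine (volume_time_in_ball_le (A := K * (L * (M * x))) (by positivity) hB hu
      (fun s hs t ht => (hw s hs t ht).trans ?_) fun t ht htR => ?_).trans ?_
    · have := hlip s hs t ht
      calc K * ‖γ s - γ t‖ ≤ K * (L * (M * x) * |s - t|) := by gcongr
        _ = _ := by ring
    · have := hin t ht htR
      linarith [(hbig t ht).1]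
    · have e1 : T / (c * (M / (2 * x)) / (2 * (K * (L * (M * x))))) =
          T / (c / (2 * x) / (2 * (K * (L * x)))) := by field_simp
      rw [e1, ← hn, ← ENNReal.ofReal_natCast, ← ENNReal.ofReal_mul (by positivity)]
      refine ENNReal.ofReal_le_ofReal ?_
      have h5 : 8 * R * (n * 2) * x / (c * τ) ≤ M := by linarith
      rw [div_le_iff₀ (by positivity)] at h5
      rw [mul_div_assoc', div_le_iff₀ hB]
      have h6 : τ / 2 * (c * (M / (2 * x))) = M * (c * τ) / (4 * x) := by field_simp; ring
      rw [h6, le_div_iff₀ (by positivity)]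
      nlinarith
  have h1 := key (fun t => (γ t).1) (fun t => gV (γ t).2) hγ.hasDerivAt_fst
    (fun s _ t _ => (hV.norm_sub_le _ _).trans
      (mul_le_mul_of_nonneg_left (norm_snd_le (γ s - γ t)) hK.le))
    (fun t ht htR => by
      have h2 := (hbig t ht).2
      have h3 : ‖γ t‖ = ‖(γ t).2‖ := by
        rw [Prod.norm_def] at h2 ⊢
        exact max_eq_right_of_lt ((lt_max_iff.1 h2).resolve_left (not_lt.2 htR) |>.trans_le' htR)
      rw [h3]; linarith [hDV (γ t).2])
  have h2 := key (fun t => (γ t).2) (fun t => -gU (γ t).1) hγ.hasDerivAt_snd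
    (fun s _ t _ => by
      rw [neg_sub_neg, norm_sub_rev]
      exact (hU.norm_sub_le _ _).trans
        (mul_le_mul_of_nonneg_left (norm_fst_le (γ s - γ t)) hK.le))
    (fun t ht htR => by
      have h2 := (hbig t ht).2
      have h3 : ‖γ t‖ = ‖(γ t).1‖ := by
        rw [Prod.norm_def] at h2 ⊢
        exact max_eq_left_of_lt ((lt_max_iff.1 h2).resolve_right (not_lt.2 htR) |>.trans_le' htR)
      rw [h3, norm_neg]; linarith [hDU (γ t).1])
  have h3 : badTimes γ R T ⊆ {t ∈ Icc 0 T | ‖(γ t).1‖ ≤ R} ∪ {t ∈ Icc 0 T | ‖(γ t).2‖ ≤ R} := by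
    rintro t ⟨ht, h | h⟩
    · exact Or.inl ⟨ht, h⟩
    · exact Or.inr ⟨ht, h⟩
  refine (measure_mono h3).trans ((measure_union_le _ _).trans ((add_le_add h1 h2).trans ?_))
  rw [← ENNReal.ofReal_add (by positivity) (by positivity)]
  exact ENNReal.ofReal_le_ofReal (by linarith)

end Nondegenerate

/-! ### Differentiability of the flow and Liouville's theorem. -/

section Flow

open scoped Topology

variable {X : Type*} [NormedAddCommGroup X] [InnerProductSpace ℝ X]

/-- The flow of Hamilton's equations. -/
structure IsHamFlow (gU gV : X → X) (φ : ℝ → X × X → X × X) : Prop where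
  isHamCurve : ∀ z, IsHamCurve gU gV fun t => φ t z
  zero : ∀ z, φ 0 z = z

variable {gU gV : X → X} {HU HV : X → X →L[ℝ] X} {R c K : ℝ} {φ : ℝ → X × X → X × X}

theorem field_lipschitz (hU : IsForce gU HU R c K) (hV : IsForce gV HV R c K) :
    LipschitzWith K.toNNReal (fun z : X × X => (gV z.2, -gU z.1)) := by
  refine LipschitzWith.of_dist_le_mul fun z w => ?_
  rw [Real.coe_toNNReal _ hU.K_pos.le, dist_eq_norm, dist_eq_norm, Prod.norm_def]
  refine max_le ((hV.norm_sub_le _ _).trans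
    (mul_le_mul_of_nonneg_left (norm_snd_le (z - w)) hU.K_pos.le)) ?_
  simp only [Prod.snd_sub, ← neg_sub', norm_neg]
  exact (hU.norm_sub_le _ _).trans (mul_le_mul_of_nonneg_left (norm_fst_le (z - w)) hU.K_pos.le)

theorem exists_isHamCurve [CompleteSpace X] (hU : IsForce gU HU R c K) (hV : IsForce gV HV R c K)
    (z : X × X) : ∃ γ, IsHamCurve gU gV γ ∧ γ 0 = z := by
  obtain ⟨γ, h0, hγ⟩ := exists_global_integralCurve
    (v := fun _ (z : X × X) => (gV z.2, -gU z.1)) (K := K.toNNReal) (B := ‖(gV 0, -gU 0)‖)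
    (by
      have h1 := hU.continuous
      have h2 := hV.continuous
      simp only [Function.uncurry_def]
      fun_prop)
    (fun _ => field_lipschitz hU hV) (fun _ => le_rfl) z
  exact ⟨γ, hγ, h0⟩

theorem IsHamCurve.dist_le (hU : IsForce gU HU R c K) (hV : IsForce gV HV R c K)
    {γ δ : ℝ → X × X} (hγ : IsHamCurve gU gV γ) (hδ : IsHamCurve gU gV δ) (s t : ℝ) :
    dist (γ t) (δ t) ≤ dist (γ s) (δ s) * Real.exp (K * |t - s|) := by
  simpa [Real.coe_toNNReal _ hU.K_pos.le] using
    dist_integralCurve_le (fun _ => field_lipschitz hU hV) hγ hδ s t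

theorem IsHamCurve.eq_of_eq (hU : IsForce gU HU R c K) (hV : IsForce gV HV R c K)
    {γ δ : ℝ → X × X} (hγ : IsHamCurve gU gV γ) (hδ : IsHamCurve gU gV δ) {s : ℝ}
    (h : γ s = δ s) : γ = δ :=
  integralCurve_eq (fun _ => field_lipschitz hU hV) hγ hδ h

namespace IsHamFlow

theorem dist_le (hφ : IsHamFlow gU gV φ) (hU : IsForce gU HU R c K) (hV : IsForce gV HV R c K)
    (t : ℝ) (z w : X × X) : dist (φ t z) (φ t w) ≤ dist z w * Real.exp (K * |t|) := by
  have := (hφ.isHamCurve z).dist_le hU hV (hφ.isHamCurve w) 0 t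
  simpa only [hφ.zero, sub_zero] using this

theorem continuous (hφ : IsHamFlow gU gV φ) (hU : IsForce gU HU R c K)
    (hV : IsForce gV HV R c K) (t : ℝ) : Continuous (φ t) := by
  refine (LipschitzWith.of_dist_le_mul (K := (Real.exp (K * |t|)).toNNReal) fun z w => ?_).continuous
  rw [Real.coe_toNNReal _ (Real.exp_pos _).le, mul_comm]
  exact hφ.dist_le hU hV t z w

theorem add (hφ : IsHamFlow gU gV φ) (hU : IsForce gU HU R c K) (hV : IsForce gV HV R c K)
    (s t : ℝ) (z : X × X) : φ (s + t) z = φ t (φ s z) := by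
  have h1 : IsHamCurve gU gV fun u => φ (s + u) z := fun u =>
    (hφ.isHamCurve z (s + u)).comp_const_add s u
  have := IsHamCurve.eq_of_eq hU hV h1 (hφ.isHamCurve (φ s z)) (s := 0) (by simp [hφ.zero])
  exact congrFun this t

theorem neg_self (hφ : IsHamFlow gU gV φ) (hU : IsForce gU HU R c K) (hV : IsForce gV HV R c K)
    (t : ℝ) (z : X × X) : φ (-t) (φ t z) = z := by
  rw [← hφ.add hU hV, add_neg_cancel, hφ.zero]

theorem self_neg (hφ : IsHamFlow gU gV φ) (hU : IsForce gU HU R c K) (hV : IsForce gV HV R c K)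
    (t : ℝ) (z : X × X) : φ t (φ (-t) z) = z := by
  rw [← hφ.add hU hV, neg_add_cancel, hφ.zero]

end IsHamFlow

/-- The linearization of the Hamiltonian vector field. -/
noncomputable def hamDeriv (HU HV : X → X →L[ℝ] X) (z : X × X) : X × X →L[ℝ] X × X :=
  ((HV z.2).comp (ContinuousLinearMap.snd ℝ X X)).prod
    (-(HU z.1).comp (ContinuousLinearMap.fst ℝ X X))

theorem hamDeriv_apply (z w : X × X) : hamDeriv HU HV z w = (HV z.2 w.2, -HU z.1 w.1) := rfl

theorem norm_hamDeriv_le (hU : IsForce gU HU R c K) (hV : IsForce gV HV R c K) (z : X × X) :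
    ‖hamDeriv HU HV z‖ ≤ K := by
  refine ContinuousLinearMap.opNorm_le_bound _ hU.K_pos.le fun w => ?_
  have := (variation_lipschitz hU hV (fun _ => z) 0).dist_le_mul w 0
  simpa [dist_eq_norm, hamDeriv_apply, Real.coe_toNNReal _ hU.K_pos.le] using this

theorem continuous_hamDeriv (hU : IsForce gU HU R c K) (hV : IsForce gV HV R c K) :
    Continuous (hamDeriv HU HV) := by
  have h1 := hU.continuous_deriv
  have h2 := hV.continuous_deriv
  have h3 : Continuous fun z : X × X => (HV z.2).comp (ContinuousLinearMap.snd ℝ X X) :=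
    (h2.comp continuous_snd).clm_comp continuous_const
  have h4 : Continuous fun z : X × X => -(HU z.1).comp (ContinuousLinearMap.fst ℝ X X) :=
    ((h1.comp continuous_fst).clm_comp continuous_const).neg
  exact (ContinuousLinearMap.prodₗᵢ (𝕜 := ℝ) (E := X × X) (F := X) (G := X) ℝ).continuous.comp
    (h3.prodMk h4)

theorem hasFDerivAt_field (hU : IsForce gU HU R c K) (hV : IsForce gV HV R c K) (z : X × X) :
    HasFDerivAt (fun z : X × X => (gV z.2, -gU z.1)) (hamDeriv HU HV z) z :=
  ((hV.hasFDerivAt z.2).comp z hasFDerivAt_snd).prodMk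
    ((hU.hasFDerivAt z.1).comp z hasFDerivAt_fst).neg

/-- The fundamental solution of the linearized equation. -/
theorem exists_fundamental [CompleteSpace X] (hU : IsForce gU HU R c K) (hV : IsForce gV HV R c K)
    {γ : ℝ → X × X} (hγ : Continuous γ) : ∃ J : ℝ → X × X →L[ℝ] X × X,
      J 0 = ContinuousLinearMap.id ℝ _ ∧ ∀ w, IsVariation HU HV γ fun t => J t w := by
  obtain ⟨J, h0, hJ⟩ := exists_global_integralCurve
    (v := fun t (A : X × X →L[ℝ] X × X) => (hamDeriv HU HV (γ t)).comp A) (K := K.toNNReal) (B := 0)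
    (by
      simp only [Function.uncurry_def]
      exact ((continuous_hamDeriv hU hV).comp (hγ.comp continuous_fst)).clm_comp continuous_snd)
    (fun t => by
      refine LipschitzWith.of_dist_le_mul fun A B => ?_
      rw [Real.coe_toNNReal _ hU.K_pos.le, dist_eq_norm, dist_eq_norm,
        ← ContinuousLinearMap.comp_sub]
      exact (ContinuousLinearMap.opNorm_comp_le _ _).trans
        (mul_le_mul_of_nonneg_right (norm_hamDeriv_le hU hV _) (norm_nonneg _)))
    (fun t => (congrArg norm (ContinuousLinearMap.comp_zero _)).trans_le
      (norm_zero (E := X × X →L[ℝ] X × X)).le)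
    (ContinuousLinearMap.id ℝ _)
  refine ⟨J, h0, fun w t => ?_⟩
  exact ((ContinuousLinearMap.apply ℝ (X × X) w).hasFDerivAt (x := J t)).comp_hasDerivAt t (hJ t)

theorem norm_le_gronwallBound_abs {F : Type*} [NormedAddCommGroup F] [NormedSpace ℝ F]
    {f f' : ℝ → F} {δ K ε : ℝ} (hf : ∀ t, HasDerivAt f (f' t) t) (h0 : ‖f 0‖ ≤ δ) (t : ℝ)
    (hb : ∀ s ∈ uIcc 0 t, ‖f' s‖ ≤ K * ‖f s‖ + ε) : ‖f t‖ ≤ gronwallBound δ K ε |t| := by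
  rcases le_total 0 t with h | h
  · have := norm_le_gronwallBound_of_norm_deriv_right_le (f := f) (f' := f') (a := 0) (b := t)
      (fun u _ => (hf u).continuousAt.continuousWithinAt) (fun u _ => (hf u).hasDerivWithinAt)
      h0 (fun u hu => hb u (by rw [uIcc_of_le h]; exact ⟨hu.1, hu.2.le⟩)) t ⟨h, le_rfl⟩
    rw [abs_of_nonneg h]
    simpa using this
  · have hg : ∀ u, HasDerivAt (fun u => f (-u)) (-f' (-u)) u := fun u => by
      simpa [Function.comp_def] using (hf (-u)).scomp u (hasDerivAt_neg u)
    have := norm_le_gronwallBound_of_norm_deriv_right_le (f := fun u => f (-u))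
      (f' := fun u => -f' (-u)) (a := 0) (b := -t) (δ := δ) (K := K) (ε := ε)
      (fun u _ => (hg u).continuousAt.continuousWithinAt) (fun u _ => (hg u).hasDerivWithinAt)
      (by simpa using h0) (fun u hu => by
        rw [norm_neg]
        refine hb (-u) ?_
        rw [uIcc_of_ge h]
        exact ⟨by linarith [hu.2], by linarith [hu.1]⟩) (-t) ⟨by linarith, le_rfl⟩
    rw [abs_of_nonpos h]
    simpa using this

/-- The flow is strictly differentiable, and its derivative solves the linearized equation. -/
theorem IsHamFlow.hasStrictFDerivAt [CompleteSpace X] (hφ : IsHamFlow gU gV φ)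
    (hU : IsForce gU HU R c K) (hV : IsForce gV HV R c K) {z : X × X}
    {J : ℝ → X × X →L[ℝ] X × X} (hJ0 : J 0 = ContinuousLinearMap.id ℝ _)
    (hJ : ∀ w, IsVariation HU HV (fun t => φ t z) fun t => J t w) (t : ℝ) :
    HasStrictFDerivAt (φ t) (J t) z := by
  have hK := hU.K_pos
  have hγc : Continuous fun t => φ t z := (hφ.isHamCurve z).continuous
  set x := Real.exp (K * |t|) with hx
  have hx0 : 0 < x := Real.exp_pos _
  rw [hasStrictFDerivAt_iff_isLittleO, Asymptotics.isLittleO_iff]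
  intro ε hε
  -- If the linearization varies by at most `η` near the orbit, the difference of two solutions
  -- solves the linearized equation up to a defect `η * x * ‖z₁ - z₂‖`. Grönwall multiplies this by
  -- at most `x / K`, which yields `ε`.
  set η := ε * K / x ^ 2 with hη
  have hη0 : 0 < η := by positivity
  obtain ⟨δ, hδ, hδη⟩ : ∃ δ > 0, ∀ s ∈ uIcc 0 t, ∀ w, dist w (φ s z) < δ →
      ‖hamDeriv HU HV w - hamDeriv HU HV (φ s z)‖ ≤ η := by
    have h1 := ((isCompact_uIcc (a := 0) (b := t)).image hγc).uniformContinuousAt_of_continuousAt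
      (hamDeriv HU HV) (fun a _ => (continuous_hamDeriv hU hV).continuousAt)
      (Metric.dist_mem_uniformity (α := X × X →L[ℝ] X × X) hη0)
    obtain ⟨δ, hδ, h2⟩ := Metric.mem_uniformity_dist.1 h1
    refine ⟨δ, hδ, fun s hs w hw => ?_⟩
    have h3 := h2 (a := φ s z) (b := w) (by rwa [dist_comm]) ⟨s, hs, rfl⟩
    refine le_trans (le_of_eq ?_) (le_of_lt h3)
    exact (dist_eq_norm (E := X × X →L[ℝ] X × X) _ _).symm.trans (dist_comm _ _)
  have hball : Metric.ball z (δ / x) ×ˢ Metric.ball z (δ / x) ∈ 𝓝 (z, z) :=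
    prod_mem_nhds (Metric.ball_mem_nhds _ (by positivity)) (Metric.ball_mem_nhds _ (by positivity))
  filter_upwards [hball] with ⟨z₁, z₂⟩ ⟨hz₁, hz₂⟩
  have hexp : ∀ s ∈ uIcc 0 t, Real.exp (K * |s|) ≤ x := by
    intro s hs
    refine Real.exp_le_exp.2 (mul_le_mul_of_nonneg_left ?_ hK.le)
    have := abs_sub_left_of_mem_uIcc hs
    simpa using this
  have hnear : ∀ s ∈ uIcc 0 t, ∀ w ∈ Metric.ball z (δ / x), dist (φ s w) (φ s z) < δ := by
    intro s hs w hw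
    refine (hφ.dist_le hU hV s w z).trans_lt ?_
    calc dist w z * Real.exp (K * |s|) ≤ dist w z * x := by
          have := hexp s hs; gcongr
      _ < δ := by rwa [← lt_div_iff₀ hx0]
  have hd : ∀ s, HasDerivAt (fun s => φ s z₁ - φ s z₂ - J s (z₁ - z₂))
      (((gV (φ s z₁).2, -gU (φ s z₁).1) - (gV (φ s z₂).2, -gU (φ s z₂).1)) -
        hamDeriv HU HV (φ s z) (J s (z₁ - z₂))) s := fun s =>
    ((hφ.isHamCurve z₁ s).sub (hφ.isHamCurve z₂ s)).sub (hJ (z₁ - z₂) s)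
  have hG := norm_le_gronwallBound_abs (δ := 0) (K := K) (ε := η * (x * ‖z₁ - z₂‖)) hd
    (by simp [hφ.zero, hJ0]) t (fun s hs => by
      set a := φ s z₁
      set b := φ s z₂
      have e1 := (convex_ball (φ s z) δ).norm_image_sub_le_of_norm_hasFDerivWithin_le'
        (f := fun z : X × X => (gV z.2, -gU z.1)) (φ := hamDeriv HU HV (φ s z))
        (fun w _ => (hasFDerivAt_field hU hV w).hasFDerivWithinAt)
        (fun w hw => hδη s hs w hw) (hnear s hs z₂ hz₂) (hnear s hs z₁ hz₁)
      have e2 : ‖a - b‖ ≤ x * ‖z₁ - z₂‖ := by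
        have := hφ.dist_le hU hV s z₁ z₂
        rw [dist_eq_norm, dist_eq_norm] at this
        have h2 := hexp s hs
        calc ‖a - b‖ ≤ _ := this
          _ ≤ ‖z₁ - z₂‖ * x := by gcongr
          _ = _ := mul_comm _ _
      have e3 : ((gV a.2, -gU a.1) - (gV b.2, -gU b.1)) - hamDeriv HU HV (φ s z) (J s (z₁ - z₂)) =
          hamDeriv HU HV (φ s z) (a - b - J s (z₁ - z₂)) +
          ((gV a.2, -gU a.1) - (gV b.2, -gU b.1) - hamDeriv HU HV (φ s z) (a - b)) := by
        rw [map_sub _ (a - b)]; abel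
      rw [e3]
      refine (norm_add_le _ _).trans (add_le_add
        ((hamDeriv HU HV (φ s z)).le_of_opNorm_le (norm_hamDeriv_le hU hV _) _) (e1.trans ?_))
      gcongr)
  refine hG.trans ?_
  rw [gronwallBound_of_K_ne_0 hK.ne']
  simp only [zero_mul, zero_add, ← hx]
  calc η * (x * ‖z₁ - z₂‖) / K * (x - 1) ≤ η * (x * ‖z₁ - z₂‖) / K * x := by
        gcongr; linarith
    _ = ε * ‖z₁ - z₂‖ := by rw [hη]; field_simp

/-- The symplectic form as a map to the dual. -/
noncomputable def symplecticDual : X × X →ₗ[ℝ] Module.Dual ℝ (X × X) where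
  toFun u := ((innerSL ℝ u.1).comp (ContinuousLinearMap.snd ℝ X X) -
    (innerSL ℝ u.2).comp (ContinuousLinearMap.fst ℝ X X) : X × X →L[ℝ] ℝ)
  map_add' u v := by
    ext <;> simp [add_comm]
  map_smul' a u := by
    ext <;> simp

theorem symplecticDual_apply (u w : X × X) :
    symplecticDual u w = inner ℝ u.1 w.2 - inner ℝ u.2 w.1 := rfl

theorem symplecticDual_injective : Function.Injective (symplecticDual (X := X)) := by
  rw [injective_iff_map_eq_zero]
  intro u hu
  have h1 := LinearMap.congr_fun hu (0, u.1)
  have h2 := LinearMap.congr_fun hu (u.2, 0)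
  simp only [symplecticDual_apply, inner_zero_right, sub_zero, zero_sub, LinearMap.zero_apply,
    neg_eq_zero, inner_self_eq_zero] at h1 h2
  exact Prod.ext h1 h2

/-- The derivative of the symplectic form of two variations vanishes because the Hessians are
symmetric. -/
theorem variation_symplectic (hU : IsForce gU HU R c K) (hV : IsForce gV HV R c K)
    {γ ξ η : ℝ → X × X} (hξ : IsVariation HU HV γ ξ) (hη : IsVariation HU HV γ η) (t : ℝ) :
    symplecticDual (ξ t) (η t) = symplecticDual (ξ 0) (η 0) := by
  simp only [symplecticDual_apply]
  refine is_const_of_deriv_eq_zero (f := fun t => inner ℝ (ξ t).1 (η t).2 -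
    inner ℝ (ξ t).2 (η t).1) ?_ ?_ t 0
  all_goals
    have hd := fun t => HasDerivAt.fun_sub
      ((hξ.hasDerivAt_fst t).inner ℝ (hη.hasDerivAt_snd t))
      ((hξ.hasDerivAt_snd t).inner ℝ (hη.hasDerivAt_fst t))
  · exact fun t => (hd t).differentiableAt
  · intro t
    refine (hd t).deriv.trans ?_
    simp only [inner_neg_right, inner_neg_left, hU.symm, hV.symm]
    ring

variable [FiniteDimensional ℝ X]

/-- Conservation of the symplectic form says that `e⁻¹ Jᵀ e J = 1`, where `e` is the isomorphism
with the dual. So the square of the determinant is `1`; its sign does not matter for Liouville's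
theorem. -/
theorem abs_det_fundamental (hU : IsForce gU HU R c K) (hV : IsForce gV HV R c K)
    {γ : ℝ → X × X} {J : ℝ → X × X →L[ℝ] X × X} (hJ0 : J 0 = ContinuousLinearMap.id ℝ _)
    (hJ : ∀ w, IsVariation HU HV γ fun t => J t w) (t : ℝ) : |(J t).det| = 1 := by
  let e : (X × X) ≃ₗ[ℝ] Module.Dual ℝ (X × X) :=
    LinearEquiv.ofInjectiveOfFinrankEq symplecticDual symplecticDual_injective
      (Subspace.dual_finrank_eq).symm
  have he : ∀ u w, e u w = symplecticDual u w := fun u w => rfl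
  set A : X × X →ₗ[ℝ] X × X := (J t : X × X →ₗ[ℝ] X × X) with hA
  have h1 : (e.symm.toLinearMap ∘ₗ A.dualMap ∘ₗ e.toLinearMap) ∘ₗ A = LinearMap.id := by
    refine LinearMap.ext fun u => ?_
    simp only [LinearMap.comp_apply, LinearMap.id_apply, LinearEquiv.coe_coe]
    rw [LinearEquiv.symm_apply_eq]
    refine LinearMap.ext fun w => ?_
    rw [LinearMap.dualMap_apply, he, he]
    have := variation_symplectic hU hV (hJ u) (hJ w) t
    simp only [hJ0, ContinuousLinearMap.id_apply] at this
    exact this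
  have h2 := congrArg LinearMap.det h1
  have h3 : LinearMap.det (e.symm.toLinearMap ∘ₗ A.dualMap ∘ₗ e.toLinearMap) = LinearMap.det A := by
    rw [← LinearMap.det_dualMap A]
    exact LinearMap.det_conj A.dualMap e.symm
  rw [LinearMap.det_comp, h3, LinearMap.det_id] at h2
  have h4 : (J t).det * (J t).det = 1 := h2
  have h5 : |(J t).det| * |(J t).det| = 1 := by rw [← abs_mul, h4, abs_one]
  nlinarith [abs_nonneg (J t).det]

variable [MeasurableSpace X] [BorelSpace X]

/-- **Liouville's theorem**. -/
theorem IsHamFlow.lintegral_comp (hφ : IsHamFlow gU gV φ) (hU : IsForce gU HU R c K)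
    (hV : IsForce gV HV R c K) (μ : Measure (X × X)) [μ.IsAddHaarMeasure] (t : ℝ)
    (f : X × X → ℝ≥0∞) : ∫⁻ z, f (φ t z) ∂μ = ∫⁻ z, f z ∂μ := by
  have : CompleteSpace X := FiniteDimensional.complete ℝ X
  choose J hJ0 hJ using fun z => exists_fundamental hU hV (hφ.isHamCurve z).continuous
  have h1 : ∀ z ∈ univ, HasFDerivWithinAt (φ t) (J z t) univ z := fun z _ =>
    (hφ.hasStrictFDerivAt hU hV (hJ0 z) (hJ z) t).hasFDerivAt.hasFDerivWithinAt
  have hinj : InjOn (φ t) univ :=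
    (Function.LeftInverse.injective (hφ.neg_self hU hV t)).injOn
  have hsurj : φ t '' univ = univ := by
    rw [image_univ]
    exact (Function.RightInverse.surjective (hφ.self_neg hU hV t)).range_eq
  have := lintegral_image_eq_lintegral_abs_det_fderiv_mul μ MeasurableSet.univ h1 hinj f
  rw [hsurj] at this
  simpa [fun z => abs_det_fundamental hU hV (hJ0 z) (hJ z) t] using this.symm

end Flow

/-! ### Local lower bounds on the law of a smooth image. -/

section Minorization

open scoped Topology
open ProbabilityTheory

variable {X : Type*} [NormedAddCommGroup X] [NormedSpace ℝ X] [FiniteDimensional ℝ X]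
  [MeasurableSpace X] [BorelSpace X]

/-- If `f (q, p)` is strictly differentiable at `(q₀, p₀)` with nonsingular partial derivative in
`p`, and `ν` is bounded below by a multiple of the Haar measure near `p₀`, then the laws of
`f (q, ·)` under `ν` have a common component for `q` near `q₀`. -/
theorem exists_local_minorization {f : X × X → X} {f' : X × X →L[ℝ] X} {q₀ p₀ : X}
    (hf : HasStrictFDerivAt f f' (q₀, p₀)) (hfc : Continuous f)
    (hinj : ∀ v, f' (0, v) = 0 → v = 0) (μ ν : Measure X) [μ.IsAddHaarMeasure] {κ : ℝ≥0∞}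
    (hκ : κ ≠ 0) {r : ℝ} (hr : 0 < r)
    (hν : ∀ S, MeasurableSet S → S ⊆ Metric.ball p₀ r → κ * μ S ≤ ν S) :
    ∃ ε, 0 < ε ∧ ∃ α : ℝ≥0∞, α ≠ 0 ∧ ∀ q ∈ Metric.ball q₀ ε, ∀ S, MeasurableSet S →
      S ⊆ Metric.ball (f (q₀, p₀)) ε → α * μ S ≤ ν {p | f (q, p) ∈ S} := by
  have : CompleteSpace X := FiniteDimensional.complete ℝ X
  set A : X →L[ℝ] X := f'.comp (ContinuousLinearMap.inr ℝ X X) with hA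
  -- Any number above `|det A|` serves: near `(q₀, p₀)` the maps `f (q, ·)` enlarge volumes by at
  -- most the factor `m`, so a density at least `κ` is pushed to one at least `κ / m`.
  set m : NNReal := ⟨|A.det|, abs_nonneg _⟩ + 1 with hm
  have hAm : ENNReal.ofReal |A.det| < m := by
    rw [ENNReal.ofReal_lt_coe_iff (by positivity), hm]
    exact lt_add_one _
  obtain ⟨δ, hδ, hδpos⟩ := ((addHaar_image_le_mul_of_det_lt μ A hAm).and
    self_mem_nhdsWithin).exists
  obtain ⟨U, hU, hUf⟩ := hf.approximates_deriv_on_nhds (Or.inr hδpos)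
  obtain ⟨s, hs, hsU⟩ := Metric.mem_nhds_iff.1 hU
  set r₁ := min r s with hr₁
  have hr₁0 : 0 < r₁ := lt_min hr hs
  have hsub : Metric.ball q₀ r₁ ×ˢ Metric.ball p₀ r₁ ⊆ U := by
    rw [ball_prod_same]
    exact (Metric.ball_subset_ball (min_le_right _ _)).trans hsU
  -- The map `(q, p) ↦ (q, f (q, p))` is open at `(q₀, p₀)`. This gives one ball of values that `f
  -- (q, ·)` covers for every `q` near `q₀`.
  have hG : HasStrictFDerivAt (fun z : X × X => (z.1, f z))
      ((ContinuousLinearMap.fst ℝ X X).prod f') (q₀, p₀) := hasStrictFDerivAt_fst.prodMk hf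
  have hAinj : Function.Injective A := by
    rw [injective_iff_map_eq_zero]
    exact fun v hv => hinj v (by simpa [hA] using hv)
  have hAsurj : Function.Surjective A := LinearMap.injective_iff_surjective.1 hAinj
  have hrange : ((ContinuousLinearMap.fst ℝ X X).prod f').range = ⊤ := by
    rw [LinearMap.range_eq_top]
    rintro ⟨u, y⟩
    obtain ⟨v, hv⟩ := hAsurj (y - f' (u, 0))
    refine ⟨(u, v), ?_⟩
    have h1 : f' (u, v) = f' (u, 0) + A v := by
      rw [hA, ContinuousLinearMap.comp_apply, ContinuousLinearMap.inr_apply, ← map_add]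
      simp
    have h2 : f' (u, v) = y := by rw [h1, hv]; abel
    exact Prod.ext rfl h2
  have hmap := hG.map_nhds_eq_of_surj hrange
  have himg : (fun z : X × X => (z.1, f z)) '' (Metric.ball q₀ r₁ ×ˢ Metric.ball p₀ r₁) ∈
      𝓝 (q₀, f (q₀, p₀)) := by
    rw [← hmap]
    exact Filter.image_mem_map (prod_mem_nhds (Metric.ball_mem_nhds _ hr₁0)
      (Metric.ball_mem_nhds _ hr₁0))
  obtain ⟨ε, hε, hεs⟩ := Metric.mem_nhds_iff.1 himg
  rw [← ball_prod_same] at hεs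
  have hm0 : (m : ℝ≥0∞) ≠ 0 := by
    have : 0 < m := add_pos_of_nonneg_of_pos (zero_le (a := (⟨|A.det|, abs_nonneg _⟩ : NNReal))) one_pos
    exact ENNReal.coe_ne_zero.2 this.ne'
  refine ⟨ε, hε, κ / m, ENNReal.div_ne_zero.2 ⟨hκ, ENNReal.coe_ne_top⟩, fun q hq S hS hSb => ?_⟩
  set V := Metric.ball p₀ r₁ ∩ {p | f (q, p) ∈ S} with hV
  have hVm : MeasurableSet V := Metric.isOpen_ball.measurableSet.inter
    ((hfc.comp (Continuous.prodMk_right q)).measurable hS)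
  by_cases hSe : S = ∅
  · simp [hSe]
  obtain ⟨y₁, hy₁⟩ := nonempty_iff_ne_empty.2 hSe
  have hqr : q ∈ Metric.ball q₀ r₁ := by
    obtain ⟨z, hz, hzq⟩ := hεs (mk_mem_prod hq (hSb hy₁))
    have h : z.1 = q := (Prod.ext_iff.1 hzq).1
    exact h ▸ hz.1
  have hSV : S ⊆ (fun p => f (q, p)) '' V := by
    intro y hy
    obtain ⟨⟨q', p⟩, hz, hzq⟩ := hεs (mk_mem_prod hq (hSb hy))
    obtain ⟨rfl, rfl⟩ := Prod.ext_iff.1 hzq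
    exact ⟨p, ⟨hz.2, hy⟩, rfl⟩
  have happ : ApproximatesLinearOn (fun p => f (q, p)) A V δ := by
    intro p₁ hp₁ p₂ hp₂
    have := hUf (q, p₁) (hsub ⟨hqr, hp₁.1⟩) (q, p₂) (hsub ⟨hqr, hp₂.1⟩)
    have h2 : ‖((q, p₁) : X × X) - (q, p₂)‖ = ‖p₁ - p₂‖ := by simp [Prod.norm_def]
    rw [h2] at this
    simpa [hA] using this
  have h1 : μ S ≤ m * μ V := (measure_mono hSV).trans (hδ V _ happ)
  have h2 : κ * μ V ≤ ν V := hν V hVm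
    (inter_subset_left.trans (Metric.ball_subset_ball (min_le_left _ _)))
  calc κ / m * μ S ≤ κ / m * (m * μ V) := by gcongr
    _ = κ * μ V := by
      rw [← mul_assoc, ENNReal.div_mul_cancel hm0 ENNReal.coe_ne_top]
    _ ≤ ν {p | f (q, p) ∈ S} := h2.trans (measure_mono inter_subset_right)

end Minorization

/-! ### From local to uniform minorization. -/

section Chain

open ProbabilityTheory

/-- The iterates of a kernel. -/
noncomputable def kernelIter {Y : Type*} [MeasurableSpace Y] (κ : Kernel Y Y) : ℕ → Kernel Y Y
  | 0 => Kernel.id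
  | n + 1 => kernelIter κ n ∘ₖ κ

instance {Y : Type*} [MeasurableSpace Y] (κ : Kernel Y Y) [IsMarkovKernel κ] (n : ℕ) :
    IsMarkovKernel (kernelIter κ n) := by
  induction n with
  | zero => exact inferInstanceAs (IsMarkovKernel Kernel.id)
  | succ n ih => exact inferInstanceAs (IsMarkovKernel (kernelIter κ n ∘ₖ κ))

variable {X : Type*} [NormedAddCommGroup X] [NormedSpace ℝ X] [FiniteDimensional ℝ X]
  [MeasurableSpace X] [BorelSpace X]

/-- A kernel which is bounded below by a multiple of the Haar measure near each point has an iterate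
which has this property uniformly on a ball. -/
theorem exists_minorization_of_local (κ : Kernel X X) (μ : Measure X) [μ.IsAddHaarMeasure]
    (hloc : ∀ q₀ : X, ∃ ε, 0 < ε ∧ ∃ α : ℝ≥0∞, α ≠ 0 ∧ ∀ q ∈ Metric.ball q₀ ε, ∀ S,
      MeasurableSet S → S ⊆ Metric.ball q₀ ε → α * μ S ≤ κ q S) {r : ℝ} (hr : 0 < r) :
    ∃ k : ℕ, 0 < k ∧ ∃ δ, 0 < δ ∧ ∃ α : ℝ≥0∞, α ≠ 0 ∧ ∀ q, ‖q‖ ≤ r → ∀ S, MeasurableSet S →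
      S ⊆ Metric.ball 0 δ → α * μ S ≤ kernelIter κ k q S := by
  have : ProperSpace X := FiniteDimensional.proper ℝ X
  choose ε hε a ha h using hloc
  obtain ⟨t, -, htc⟩ := (isCompact_closedBall (0 : X) (r + 1)).elim_nhds_subcover
    (fun x => Metric.ball x (ε x)) fun x _ => Metric.ball_mem_nhds x (hε x)
  have htc' : Metric.closedBall (0 : X) (r + 1) ⊆ ⋃ x : t, Metric.ball (x : X) (ε x) := by
    simpa [iUnion_subtype] using htc
  obtain ⟨δ₀, hδ₀, hleb⟩ := lebesgue_number_lemma_of_metric (isCompact_closedBall (0 : X) (r + 1))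
    (fun x : t => Metric.isOpen_ball) htc'
  -- Compactness gives a uniform scale `δ` (a Lebesgue number) and a uniform constant `α`. As `δ ≤
  -- 1`, rounding the radius `r` up to a multiple of `δ / 2` stays within `r + 1`.
  set δ := min δ₀ 1 with hδ
  have hδ0 : 0 < δ := lt_min hδ₀ one_pos
  set α := t.inf a with hα
  have hα0 : α ≠ 0 := by
    rw [← pos_iff_ne_zero, hα, Finset.lt_inf_iff ENNReal.zero_lt_top]
    exact fun x _ => pos_iff_ne_zero.2 (ha x)
  have hunif : ∀ x, ‖x‖ ≤ r + 1 → ∀ q ∈ Metric.ball x δ, ∀ S, MeasurableSet S →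
      S ⊆ Metric.ball x δ → α * μ S ≤ κ q S := by
    intro x hx q hq S hS hSx
    obtain ⟨i, hi⟩ := hleb x (by simpa using hx)
    have hi' : Metric.ball x δ ⊆ Metric.ball (i : X) (ε i) :=
      (Metric.ball_subset_ball (min_le_left _ _)).trans hi
    refine le_trans ?_ (h i q (hi' hq) S hS (hSx.trans hi'))
    gcongr
    exact Finset.inf_le i.2
  have hiter : ∀ j : ℕ, (j + 1 : ℝ) * (δ / 2) ≤ r + 1 → ∃ α' : ℝ≥0∞, α' ≠ 0 ∧
      ∀ q : X, ‖q‖ ≤ (j + 1 : ℝ) * (δ / 2) → ∀ S, MeasurableSet S → S ⊆ Metric.ball 0 (δ / 2) →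
        α' * μ S ≤ kernelIter κ (j + 1) q S := by
    intro j
    induction j with
    | zero =>
      refine fun _ => ⟨α, hα0, fun q hq S hS hSb => ?_⟩
      have : kernelIter κ (0 + 1) = κ := Kernel.id_comp κ
      rw [this]
      refine hunif 0 (by rw [norm_zero]; positivity) q ?_ S hS
        (hSb.trans (Metric.ball_subset_ball (by linarith)))
      rw [mem_ball_zero_iff]
      norm_num at hq
      linarith
    | succ j ih =>
      intro hj
      push_cast at hj
      obtain ⟨α', hα', h'⟩ := ih (by nlinarith)
      refine ⟨α' * (α * μ (Metric.ball 0 (δ / 4))), ?_, fun q hq S hS hSb => ?_⟩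
      · refine mul_ne_zero hα' (mul_ne_zero hα0 ?_)
        exact (Metric.measure_ball_pos μ _ (by positivity)).ne'
      push_cast at hq
      -- The point `l • q` is `q` pulled towards the origin so that the ball of radius `δ / 4`
      -- around it lies both within `δ` of `q` and in the ball of the preceding radius `(j + 1) * (δ
      -- / 2)`.
      set l : ℝ := ((j + 1) * (δ / 2) - δ / 4) / ((j + 1 + 1) * (δ / 2)) with hl
      have hjd : 0 ≤ (j : ℝ) * δ := by positivity
      have hden : (0 : ℝ) < (j + 1 + 1) * (δ / 2) := by positivity
      have hl0 : 0 ≤ l := div_nonneg (by nlinarith) hden.le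
      have hl1 : l ≤ 1 := (div_le_one hden).2 (by nlinarith)
      have hlq : l * ‖q‖ ≤ (j + 1) * (δ / 2) - δ / 4 := by
        calc l * ‖q‖ ≤ l * ((j + 1 + 1) * (δ / 2)) := by gcongr
          _ = _ := div_mul_cancel₀ _ hden.ne'
      have hlq' : (1 - l) * ‖q‖ ≤ 3 * δ / 4 := by
        calc (1 - l) * ‖q‖ ≤ (1 - l) * ((j + 1 + 1) * (δ / 2)) := by
              have := sub_nonneg.2 hl1
              gcongr
          _ = (j + 1 + 1) * (δ / 2) - l * ((j + 1 + 1) * (δ / 2)) := by ring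
          _ = (j + 1 + 1) * (δ / 2) - ((j + 1) * (δ / 2) - δ / 4) := by
            rw [hl, div_mul_cancel₀ _ hden.ne']
          _ = _ := by ring
      set B := Metric.ball (l • q) (δ / 4) with hB
      have hBq : B ⊆ Metric.ball q δ := by
        refine Metric.ball_subset_ball' ?_
        have : dist (l • q) q = (1 - l) * ‖q‖ := by
          rw [dist_comm, dist_eq_norm, ← one_smul ℝ q, smul_smul, mul_one, ← sub_smul, norm_smul,
            one_smul, Real.norm_of_nonneg (sub_nonneg.2 hl1)]
        rw [this]; linarith
      have hBn : ∀ x ∈ B, ‖x‖ ≤ (j + 1) * (δ / 2) := by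
        intro x hx
        rw [hB, Metric.mem_ball, dist_eq_norm] at hx
        have h1 : ‖x‖ ≤ ‖x - l • q‖ + ‖l • q‖ := by
          simpa using norm_add_le (x - l • q) (l • q)
        rw [norm_smul, Real.norm_of_nonneg hl0] at h1
        linarith
      have h1 : α * μ B ≤ κ q B := hunif q (hq.trans hj) q (Metric.mem_ball_self hδ0) B
        Metric.isOpen_ball.measurableSet hBq
      have h2 : μ B = μ (Metric.ball 0 (δ / 4)) := Measure.addHaar_ball_center μ _ _
      have h3 : kernelIter κ (j + 1 + 1) q S = ∫⁻ x, kernelIter κ (j + 1) x S ∂κ q :=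
        Kernel.comp_apply' _ _ _ hS
      rw [h3]
      calc α' * (α * μ (Metric.ball 0 (δ / 4))) * μ S = α' * μ S * (α * μ B) := by rw [h2]; ring
        _ ≤ α' * μ S * κ q B := by gcongr
        _ = ∫⁻ x in B, α' * μ S ∂κ q := by rw [setLIntegral_const]
        _ ≤ ∫⁻ x in B, kernelIter κ (j + 1) x S ∂κ q :=
          setLIntegral_mono' Metric.isOpen_ball.measurableSet fun x hx => h' x (hBn x hx) S hS hSb
        _ ≤ _ := setLIntegral_le_lintegral _ _
  set j := ⌊r / (δ / 2)⌋₊ with hj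
  have hj1 : (j : ℝ) * (δ / 2) ≤ r := by
    rw [← le_div_iff₀ (by positivity)]; exact Nat.floor_le (by positivity)
  have hj2 : r ≤ (j + 1 : ℝ) * (δ / 2) := by
    rw [← div_le_iff₀ (by positivity)]; exact (Nat.lt_floor_add_one _).le
  obtain ⟨α', hα', h'⟩ := hiter j (by
    have : δ ≤ 1 := min_le_right _ _
    linarith)
  exact ⟨j + 1, j.succ_pos, δ / 2, by positivity, α', hα', fun q hq => h' q (hq.trans hj2)⟩

end Chain

/-! ### Harris' theorem by coupling. -/

section Harris

open ProbabilityTheory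

open Classical in
/-- The cost `2 + w x + w y` off the diagonal. -/
noncomputable def weightedCost {Y : Type*} (w : Y → ℝ≥0∞) (z : Y × Y) : ℝ≥0∞ :=
  if z.1 = z.2 then 0 else 2 + w z.1 + w z.2

theorem weightedCost_le {Y : Type*} (w : Y → ℝ≥0∞) (z : Y × Y) : weightedCost w z ≤ 2 + w z.1 + w z.2 := by
  unfold weightedCost
  split_ifs
  · exact zero_le
  · exact le_rfl

variable {Y : Type*} [MeasurableSpace Y]

theorem measurable_weightedCost [MeasurableEq Y] {w : Y → ℝ≥0∞} (hw : Measurable w) :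
    Measurable (weightedCost w) := by
  classical
  refine Measurable.ite (measurableSet_eq_fun measurable_fst measurable_snd) measurable_const ?_
  exact (measurable_const.add (hw.comp measurable_fst)).add (hw.comp measurable_snd)

theorem lintegral_weightedCost_prod_le {w : Y → ℝ≥0∞} (hw : Measurable w)
    (μ ν : Measure Y) [SFinite μ] [SFinite ν] :
    ∫⁻ z, weightedCost w z ∂μ.prod ν ≤
      2 * (μ univ * ν univ) + (∫⁻ x, w x ∂μ) * ν univ + μ univ * ∫⁻ y, w y ∂ν := by
  refine (lintegral_mono (weightedCost_le w)).trans ?_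
  rw [lintegral_add_left (by fun_prop), lintegral_add_left (by fun_prop), lintegral_const,
    ← Measure.prod_prod, univ_prod_univ]
  refine le_of_eq ?_
  have h1 := lintegral_prod_mul (μ := μ) (ν := ν) hw.aemeasurable
    (aemeasurable_const (b := (1 : ℝ≥0∞)))
  have h2 := lintegral_prod_mul (μ := μ) (ν := ν) (aemeasurable_const (b := (1 : ℝ≥0∞)))
    hw.aemeasurable
  simp only [mul_one, one_mul, lintegral_one] at h1 h2
  rw [h1, h2]

theorem lintegral_weightedCost_diag [MeasurableEq Y] {w : Y → ℝ≥0∞} (hw : Measurable w)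
    (μ : Measure Y) : ∫⁻ z, weightedCost w z ∂(μ.map fun x => (x, x)) = 0 := by
  rw [lintegral_map (measurable_weightedCost hw) (by fun_prop)]
  simp [weightedCost]

/-- **Harris' theorem** in coupling form: a drift condition and a minorization on a sublevel set of
the weight give a coupling kernel which contracts a weighted cost. -/
theorem exists_contracting_coupling [MeasurableEq Y] (P : Kernel Y Y) [IsMarkovKernel P]
    {W : Y → ℝ} (hW : Measurable W) (hW0 : ∀ x, 0 ≤ W x) {l K r θ : ℝ} (hl0 : 0 ≤ l) (hl1 : l < 1)
    (hK : 0 ≤ K) (hr : 2 * K < (1 - l) * r)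
    (hdrift : ∀ x, ∫⁻ y, ENNReal.ofReal (W y) ∂P x ≤ ENNReal.ofReal (l * W x + K))
    (hθ0 : 0 < θ) (hθ1 : θ < 1) (ϑ : Measure Y) (hϑ : ϑ univ = ENNReal.ofReal θ)
    (hmin : ∀ x, W x ≤ r → ϑ ≤ P x) :
    ∃ β ρ : ℝ, 0 < β ∧ 0 < ρ ∧ ρ < 1 ∧ ∃ C : Kernel (Y × Y) (Y × Y), IsMarkovKernel C ∧
      (∀ z, (C z).map Prod.fst = P z.1) ∧ (∀ z, (C z).map Prod.snd = P z.2) ∧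
      ∀ z, ∫⁻ z', weightedCost (fun x => ENNReal.ofReal (β * W x)) z' ∂C z ≤
        ENNReal.ofReal ρ * weightedCost (fun x => ENNReal.ofReal (β * W x)) z := by
  have hr0 : 0 < r := by
    by_contra h
    nlinarith [not_lt.1 h]
  -- If one point is outside the sublevel set, then `W x + W y ≥ r`, and the constant `2 * K` is
  -- absorbed into the factor `l₁ < 1`.
  set l₁ := l + 2 * K / r with hl₁
  have hl₁1 : l₁ < 1 := by
    have : 2 * K / r < 1 - l := by rwa [div_lt_iff₀ hr0]
    rw [hl₁]; linarith
  have hl₁0 : 0 ≤ l₁ := by positivity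
  -- If both points are in the sublevel set, coupling lowers the constant `2` of the cost by `2 * θ`
  -- while the drift adds `2 * β * K ≤ θ`. What remains is `2 * (1 - θ / 2)`.
  set β := θ / (2 * (K + 1)) with hβ
  have hβ0 : 0 < β := by positivity
  have hβK : β * K ≤ θ / 2 := by
    rw [hβ, div_mul_eq_mul_div, div_le_iff₀ (by positivity)]; nlinarith
  clear_value β
  set ρ₁ := (2 + β * l₁ * r) / (2 + β * r) with hρ₁
  have hβr : 0 < β * r := by positivity
  have hρ₁1 : ρ₁ < 1 := by
    rw [hρ₁, div_lt_one (by positivity)]; nlinarith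
  set ρ := max (max ρ₁ l) (1 - θ / 2) with hρ
  have hρ0 : 0 < ρ := lt_max_of_lt_right (by linarith)
  have hρ1 : ρ < 1 := max_lt (max_lt hρ₁1 hl1) (by linarith)
  set w : Y → ℝ≥0∞ := fun x => ENNReal.ofReal (β * W x) with hw
  have hwm : Measurable w := (hW.const_mul β).ennreal_ofReal
  have hPw : ∀ x, ∫⁻ y, w y ∂P x ≤ ENNReal.ofReal (β * (l * W x + K)) := fun x => by
    simp only [hw, ENNReal.ofReal_mul hβ0.le]
    rw [lintegral_const_mul _ hW.ennreal_ofReal]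
    exact mul_le_mul_right (hdrift x) _
  have : IsFiniteMeasure ϑ := ⟨by rw [hϑ]; exact ENNReal.ofReal_lt_top⟩
  set A : Set Y := {x | W x ≤ r} with hA
  have hAm : MeasurableSet A := measurableSet_le hW measurable_const
  classical
  let Q : Kernel Y Y :=
    { toFun := fun x => if x ∈ A then P x - ϑ else P x
      measurable' := by
        refine Measure.measurable_of_measurable_coe _ fun S hS => ?_
        have : (fun x => (if x ∈ A then P x - ϑ else P x) S) =
            fun x => if x ∈ A then P x S - ϑ S else P x S := by
          ext x
          split_ifs with hx
          · exact Measure.sub_apply hS (hmin x hx)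
          · rfl
        rw [this]
        exact Measurable.ite hAm ((P.measurable_coe hS).sub_const _) (P.measurable_coe hS) }
  have hQA : ∀ x ∈ A, Q x = P x - ϑ := fun x hx => if_pos hx
  have hQP : ∀ x ∈ A, Q x + ϑ = P x := fun x hx => by
    rw [hQA x hx]; exact Measure.sub_add_cancel_of_le (hmin x hx)
  have hQle : ∀ x, Q x ≤ P x := fun x => by
    by_cases hx : x ∈ A
    · rw [← hQP x hx]; exact Measure.le_add_right le_rfl
    · exact (if_neg hx).le
  have hQfin : IsFiniteKernel Q := ⟨1, ENNReal.one_lt_top, fun x =>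
    ((hQle x) univ).trans_eq measure_univ⟩
  set c : ℝ≥0∞ := ENNReal.ofReal (1 - θ) with hc
  have hc0 : c ≠ 0 := by rw [hc]; simpa using hθ1
  have hct : c ≠ ∞ := ENNReal.ofReal_ne_top
  have hQmass : ∀ x ∈ A, Q x univ = c := fun x hx => by
    have h1 : Q x univ + ϑ univ = 1 := by
      rw [← Measure.add_apply, hQP x hx]; exact measure_univ
    rw [hϑ] at h1
    rw [hc, ENNReal.ofReal_sub _ hθ0.le, ENNReal.ofReal_one, ← h1]
    exact (ENNReal.add_sub_cancel_right ENNReal.ofReal_ne_top).symm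
  -- On `A` the residual `Q` has mass `c`, so only one factor of the product is normalized: then
  -- both marginals of `Q × Q'` are residuals of mass `c`.
  let Q' : Kernel Y Y :=
    { toFun := fun x => c⁻¹ • Q x
      measurable' := by
        refine Measure.measurable_of_measurable_coe _ fun S hS => ?_
        simpa using (Q.measurable_coe hS).const_mul c⁻¹ }
  have hQ' : ∀ x, Q' x = c⁻¹ • Q x := fun x => rfl
  have hQ'fin : IsFiniteKernel Q' := ⟨c⁻¹, ENNReal.inv_lt_top.2 (pos_iff_ne_zero.2 hc0),
    fun x => by
      rw [hQ']
      simp only [Measure.smul_apply, smul_eq_mul]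
      exact mul_le_of_le_one_right' (((hQle x) univ).trans_eq measure_univ)⟩
  have hQ'mass : ∀ x ∈ A, Q' x univ = 1 := fun x hx => by
    rw [hQ', Measure.smul_apply, hQmass x hx, smul_eq_mul, ENNReal.inv_mul_cancel hc0 hct]
  -- On the diagonal the two points move together. If both are in `A`, they meet with the common
  -- part `ϑ` and move by independent residuals otherwise. In the remaining cases they move
  -- independently.
  let Cd : Kernel (Y × Y) (Y × Y) := (P.map fun x => (x, x)).comap Prod.fst measurable_fst
  let CA : Kernel (Y × Y) (Y × Y) := Kernel.const _ (ϑ.map fun x => (x, x)) +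
    (Q.comap Prod.fst measurable_fst) ×ₖ (Q'.comap Prod.snd measurable_snd)
  let Ci : Kernel (Y × Y) (Y × Y) :=
    (P.comap Prod.fst measurable_fst) ×ₖ (P.comap Prod.snd measurable_snd)
  have hdiag : MeasurableSet {z : Y × Y | z.1 = z.2} :=
    measurableSet_eq_fun measurable_fst measurable_snd
  let C := Kernel.piecewise hdiag Cd (Kernel.piecewise (hAm.prod hAm) CA Ci)
  have hdm : Measurable fun x : Y => (x, x) := by fun_prop
  have hCd : ∀ z, z.1 = z.2 → C z = (P z.1).map fun x => (x, x) := fun z hz => by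
    rw [Kernel.piecewise_apply, if_pos (show z ∈ {z : Y × Y | z.1 = z.2} from hz), Kernel.comap_apply, Kernel.map_apply _ hdm]
  have hCA : ∀ z, z.1 ≠ z.2 → z ∈ A ×ˢ A →
      C z = (ϑ.map fun x => (x, x)) + (Q z.1).prod (Q' z.2) := fun z hz hzA => by
    rw [Kernel.piecewise_apply, if_neg (show z ∉ {z : Y × Y | z.1 = z.2} from hz), Kernel.piecewise_apply, if_pos hzA, add_apply,
      Kernel.const_apply, Kernel.prod_apply, Kernel.comap_apply, Kernel.comap_apply]
  have hCi : ∀ z, z.1 ≠ z.2 → z ∉ A ×ˢ A → C z = (P z.1).prod (P z.2) := fun z hz hzA => by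
    rw [Kernel.piecewise_apply, if_neg (show z ∉ {z : Y × Y | z.1 = z.2} from hz), Kernel.piecewise_apply, if_neg hzA, Kernel.prod_apply,
      Kernel.comap_apply, Kernel.comap_apply]
  have hid : ∀ μ : Measure Y, μ.map (fun x => x) = μ := fun μ => Measure.map_id
  have hfst : ∀ z, (C z).map Prod.fst = P z.1 := by
    intro z
    by_cases hz : z.1 = z.2
    · rw [hCd z hz, Measure.map_map measurable_fst hdm]
      exact hid _
    by_cases hzA : z ∈ A ×ˢ A
    · rw [hCA z hz hzA, Measure.map_add _ _ measurable_fst, Measure.map_map measurable_fst hdm,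
        Measure.map_fst_prod, hQ'mass _ hzA.2, one_smul, add_comm, ← hQP _ hzA.1]
      exact congrArg _ (hid _)
    · rw [hCi z hz hzA, Measure.map_fst_prod, measure_univ, one_smul]
  have hsnd : ∀ z, (C z).map Prod.snd = P z.2 := by
    intro z
    by_cases hz : z.1 = z.2
    · rw [hCd z hz, Measure.map_map measurable_snd hdm, hz]
      exact hid _
    by_cases hzA : z ∈ A ×ˢ A
    · rw [hCA z hz hzA, Measure.map_add _ _ measurable_snd, Measure.map_map measurable_snd hdm,
        Measure.map_snd_prod, hQmass _ hzA.1, hQ', smul_smul, ENNReal.mul_inv_cancel hc0 hct,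
        one_smul, add_comm, ← hQP _ hzA.2]
      exact congrArg _ (hid _)
    · rw [hCi z hz hzA, Measure.map_snd_prod, measure_univ, one_smul]
  refine ⟨β, ρ, hβ0, hρ0, hρ1, C, ⟨fun z => ⟨?_⟩⟩, hfst, hsnd, fun z => ?_⟩
  · have := congrArg (fun μ => μ univ) (hfst z)
    simpa [Measure.map_apply measurable_fst MeasurableSet.univ] using this
  by_cases hz : z.1 = z.2
  · rw [hCd z hz, lintegral_weightedCost_diag hwm]
    exact zero_le
  have hcost : weightedCost w z = ENNReal.ofReal (2 + β * W z.1 + β * W z.2) := by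
    have h1 := mul_nonneg hβ0.le (hW0 z.1)
    have h2 := mul_nonneg hβ0.le (hW0 z.2)
    rw [weightedCost, if_neg hz, ENNReal.ofReal_add (by linarith) h2, ENNReal.ofReal_add (by simp) h1]
    simp [hw]
  rw [hcost, ← ENNReal.ofReal_mul hρ0.le]
  have hs1 := hW0 z.1
  have hs2 := hW0 z.2
  have n1 : 0 ≤ β * (l * W z.1 + K) := by positivity
  have n2 : 0 ≤ β * (l * W z.2 + K) := by positivity
  by_cases hzA : z ∈ A ×ˢ A
  · rw [hCA z hz hzA, lintegral_add_measure, lintegral_weightedCost_diag hwm, zero_add]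
    refine (lintegral_weightedCost_prod_le hwm _ _).trans ?_
    rw [hQ'mass _ hzA.2, hQmass _ hzA.1, mul_one, mul_one]
    have e1 : c * ∫⁻ y, w y ∂Q' z.2 = ∫⁻ y, w y ∂Q z.2 := by
      rw [hQ', lintegral_smul_measure, smul_eq_mul, ← mul_assoc, ENNReal.mul_inv_cancel hc0 hct,
        one_mul]
    rw [e1]
    have e2 : ∀ x, ∫⁻ y, w y ∂Q x ≤ ENNReal.ofReal (β * (l * W x + K)) := fun x =>
      (lintegral_mono' (hQle x) le_rfl).trans (hPw x)
    calc _ ≤ 2 * c + ENNReal.ofReal (β * (l * W z.1 + K)) + ENNReal.ofReal (β * (l * W z.2 + K)) := by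
          gcongr <;> exact e2 _
      _ = ENNReal.ofReal (2 * (1 - θ) + β * (l * W z.1 + K) + β * (l * W z.2 + K)) := by
        rw [ENNReal.ofReal_add (by linarith) n2, ENNReal.ofReal_add (by linarith) n1,
          ENNReal.ofReal_mul (p := 2) (by norm_num), hc]
        simp
      _ ≤ _ := ENNReal.ofReal_le_ofReal ?_
    have k1 : 1 - θ / 2 ≤ ρ := le_max_right _ _
    have k2 : l ≤ ρ := (le_max_right _ _).trans (le_max_left _ _)
    have k3 := mul_le_mul_of_nonneg_right k2 (mul_nonneg hβ0.le hs1)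
    have k4 := mul_le_mul_of_nonneg_right k2 (mul_nonneg hβ0.le hs2)
    nlinarith
  · rw [hCi z hz hzA]
    refine (lintegral_weightedCost_prod_le hwm _ _).trans ?_
    simp only [measure_univ, mul_one, one_mul]
    calc _ ≤ 2 + ENNReal.ofReal (β * (l * W z.1 + K)) + ENNReal.ofReal (β * (l * W z.2 + K)) := by
          gcongr <;> exact hPw _
      _ = ENNReal.ofReal (2 + β * (l * W z.1 + K) + β * (l * W z.2 + K)) := by
        rw [ENNReal.ofReal_add (by linarith) n2, ENNReal.ofReal_add (by linarith) n1]
        simp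
      _ ≤ _ := ENNReal.ofReal_le_ofReal ?_
    set s := W z.1 + W z.2 with hs
    have hsr : r ≤ s := by
      by_contra h
      exact hzA ⟨by rw [hA, mem_ofPred_eq]; linarith, by rw [hA, mem_ofPred_eq]; linarith⟩
    have k1 : ρ₁ ≤ ρ := (le_max_left _ _).trans (le_max_left _ _)
    have k2 : 2 * K ≤ 2 * K / r * s := by
      rw [div_mul_eq_mul_div, le_div_iff₀ hr0]; gcongr
    have k3 : 2 + β * l₁ * s ≤ ρ₁ * (2 + β * s) := by
      rw [hρ₁, div_mul_eq_mul_div, le_div_iff₀ (by positivity)]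
      nlinarith [mul_nonneg (mul_nonneg hβ0.le (sub_nonneg.2 hsr)) (sub_nonneg.2 hl₁1.le)]
    have k4 : ρ₁ * (2 + β * s) ≤ ρ * (2 + β * s) := by
      have : 0 ≤ 2 + β * s := by positivity
      gcongr
    have k5 : β * (2 * K) ≤ β * (2 * K / r * s) := by gcongr
    calc 2 + β * (l * W z.1 + K) + β * (l * W z.2 + K) = 2 + β * l * s + β * (2 * K) := by
          rw [hs]; ring
      _ ≤ 2 + β * l * s + β * (2 * K / r * s) := by linarith
      _ = 2 + β * l₁ * s := by rw [hl₁]; ring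
      _ ≤ ρ * (2 + β * s) := k3.trans k4
      _ = _ := by rw [hs]; ring

end Harris

/-! ### Drift of the square root of the potential. -/

section Drift

variable {X : Type*} [NormedAddCommGroup X] [InnerProductSpace ℝ X] [CompleteSpace X]

/-- Integration of the coercivity and of the linear growth of the force along rays from the origin.
The coefficient drops from `c / 2` to `c / 4` to absorb the linear term. -/
theorem IsForce.potential_bounds {g : X → X} {H : X → X →L[ℝ] X} {R c K : ℝ}
    (h : IsForce g H R c K) {F : X → ℝ} (hF : ∀ x, HasGradientAt F (g x) x) :
    ∃ A, 0 < A ∧ ∀ x, F x ≤ A * (1 + ‖x‖) ^ 2 ∧ c / 4 * ‖x‖ ^ 2 - A ≤ F x := by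
  obtain ⟨D, hD, hDx⟩ := h.inner_ge
  have hc := h.c_pos
  have hK := h.K_pos
  set G := K + ‖g 0‖ with hG
  have hG0 : 0 < G := by positivity
  have hGx : ∀ x, ‖g x‖ ≤ G * (1 + ‖x‖) := h.norm_le_linear
  set D' := 2 * D + 2 * G + c with hD'
  have hD'0 : 0 < D' := by positivity
  have hin : ∀ y, c * ‖y‖ ^ 2 - D' * ‖y‖ ≤ inner ℝ (g y) y := by
    intro y
    have n := norm_nonneg y
    have h1 := abs_le.1 (abs_real_inner_le_norm (g y) y)
    have h2 := mul_le_mul_of_nonneg_right (hGx y) n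
    have h3 := hDx y
    rcases le_total ‖y‖ 1 with hy | hy <;> nlinarith
  have hray : ∀ x t, HasDerivAt (fun t : ℝ => F (t • x)) (inner ℝ (g (t • x)) x) t := by
    intro x t
    have h1 : HasDerivAt (fun t : ℝ => t • x) x t := by simpa using (hasDerivAt_id t).smul_const x
    exact ((hF (t • x)).hasFDerivAt.comp_hasDerivAt t h1).congr_deriv (by simp)
  have hup : ∀ x, F x ≤ F 0 + G * (1 + ‖x‖) * ‖x‖ := by
    intro x
    have h1 : ∀ t ∈ Icc (0 : ℝ) 1, ‖inner ℝ (g (t • x)) x‖ ≤ G * (1 + ‖x‖) * ‖x‖ := by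
      intro t ht
      have h2 : ‖t • x‖ ≤ ‖x‖ := by
        rw [norm_smul, Real.norm_of_nonneg ht.1]
        exact mul_le_of_le_one_left (norm_nonneg x) ht.2
      refine (norm_inner_le_norm (𝕜 := ℝ) _ _).trans ?_
      gcongr
      exact (hGx _).trans (by gcongr)
    have := (convex_Icc (0 : ℝ) 1).norm_image_sub_le_of_norm_hasDerivWithin_le
      (fun t _ => (hray x t).hasDerivWithinAt) h1 (left_mem_Icc.2 zero_le_one)
      (right_mem_Icc.2 zero_le_one)
    simp only [one_smul, zero_smul, sub_zero, norm_one, mul_one] at this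
    linarith [(abs_le.1 this).2]
  have hlow : ∀ x, F 0 + c / 2 * ‖x‖ ^ 2 - D' * ‖x‖ ≤ F x := by
    intro x
    have hd : ∀ t, HasDerivAt (fun t : ℝ => F (t • x) - c / 2 * t ^ 2 * ‖x‖ ^ 2 + D' * t * ‖x‖)
        (inner ℝ (g (t • x)) x - c * t * ‖x‖ ^ 2 + D' * ‖x‖) t := by
      intro t
      have h2 : HasDerivAt (fun t : ℝ => c / 2 * t ^ 2 * ‖x‖ ^ 2) (c * t * ‖x‖ ^ 2) t := by
        have := ((hasDerivAt_pow 2 t).const_mul (c / 2)).mul_const (‖x‖ ^ 2)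
        refine this.congr_deriv ?_
        push_cast
        ring
      have h3 : HasDerivAt (fun t : ℝ => D' * t * ‖x‖) (D' * ‖x‖) t := by
        simpa using ((hasDerivAt_id t).const_mul D').mul_const ‖x‖
      exact ((hray x t).sub h2).add h3
    have hm := monotoneOn_of_deriv_nonneg (convex_Icc (0 : ℝ) 1)
      (fun t _ => (hd t).continuousAt.continuousWithinAt)
      (fun t _ => (hd t).differentiableAt.differentiableWithinAt) (fun t ht => by
        rw [interior_Icc] at ht
        rw [(hd t).deriv]
        have h4 := hin (t • x)
        rw [inner_smul_right, norm_smul, Real.norm_of_nonneg ht.1.le] at h4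
        have h5 : t * (c * t * ‖x‖ ^ 2 - D' * ‖x‖) ≤ t * inner ℝ (g (t • x)) x := by linarith
        linarith [le_of_mul_le_mul_left h5 ht.1])
    have := hm (left_mem_Icc.2 zero_le_one) (right_mem_Icc.2 zero_le_one) zero_le_one
    simp only [zero_smul, one_smul] at this
    norm_num at this
    linarith
  refine ⟨|F 0| + G + D' ^ 2 / c, by positivity, fun x => ⟨?_, ?_⟩⟩
  · have n := norm_nonneg x
    have h1 := le_abs_self (F 0)
    have h2 : 0 ≤ D' ^ 2 / c := by positivity
    have h3 := abs_nonneg (F 0)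
    nlinarith [hup x, mul_nonneg h3 n, mul_nonneg h3 (mul_nonneg n n), mul_nonneg h2 n,
      mul_nonneg h2 (mul_nonneg n n), mul_nonneg hG0.le n]
  · have h1 := neg_abs_le (F 0)
    have h2 : D' * ‖x‖ ≤ c / 4 * ‖x‖ ^ 2 + D' ^ 2 / c := by
      have h3 : c / 4 * ‖x‖ ^ 2 + D' ^ 2 / c - D' * ‖x‖ = (c * ‖x‖ / 2 - D') ^ 2 / c := by
        field_simp; ring
      have : 0 ≤ (c * ‖x‖ / 2 - D') ^ 2 / c := by positivity
      linarith
    linarith [hlow x]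

/-- The Hamiltonian is conserved. -/
theorem IsHamCurve.energy_eq {gU gV : X → X} {U V : X → ℝ} (hU : ∀ x, HasGradientAt U (gU x) x)
    (hV : ∀ x, HasGradientAt V (gV x) x) {γ : ℝ → X × X} (hγ : IsHamCurve gU gV γ) (s t : ℝ) :
    U (γ s).1 + V (γ s).2 = U (γ t).1 + V (γ t).2 := by
  have hd : ∀ t, HasDerivAt (fun t => U (γ t).1 + V (γ t).2) 0 t := by
    intro t
    have h1 := (hU (γ t).1).hasFDerivAt.comp_hasDerivAt t (hγ.hasDerivAt_fst t)
    have h2 := (hV (γ t).2).hasFDerivAt.comp_hasDerivAt t (hγ.hasDerivAt_snd t)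
    refine (h1.add h2).congr_deriv ?_
    simp [real_inner_comm]
  exact is_const_of_deriv_eq_zero (fun t => (hd t).differentiableAt) (fun t => (hd t).deriv) s t

variable {gU gV : X → X} {HU HV : X → X →L[ℝ] X} {R c K : ℝ}

/-- The boundary estimate for motions in both directions of time. -/
theorem boundary_control_abs [Nontrivial X] (hU : IsForce gU HU R c K) (hV : IsForce gV HV R c K)
    {a T : ℝ} (ha : 0 < a) (hT : 0 < T) (haT : a * T < Real.pi)
    (hc : ∀ q p, R < ‖q‖ → R < ‖p‖ → ∀ v,
      inner ℝ (HU q (HV p v)) (HV p v) ≤ a ^ 2 * inner ℝ (HV p v) v) :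
    ∃ D, 0 < D ∧ ∀ t, |t| = T → ∀ γ, IsHamCurve gU gV γ →
      1 + ‖(γ 0).1‖ ≤ D * (1 + ‖(γ 0).2‖ + ‖(γ t).2‖) := by
  obtain ⟨D, hD, hDγ⟩ := boundary_control hU hV ha hT haT hc
  obtain ⟨L, hL, -, -, hLb⟩ := exists_linear_bound hU hV
  have h1x : 1 ≤ Real.exp (L * T) := Real.one_le_exp (by positivity)
  refine ⟨D * Real.exp (L * T), by positivity, fun t ht γ hγ => ?_⟩
  have h0 : 1 + ‖(γ 0).1‖ ≤ 1 + ‖γ 0‖ := by gcongr; exact norm_fst_le _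
  rcases abs_choice t with h | h
  · have hD1 := hDγ γ hγ
    rw [ht] at h
    rw [← h]
    refine (h0.trans hD1).trans ?_
    gcongr
    exact le_mul_of_one_le_right hD.le h1x
  · obtain rfl : t = -T := by rw [← ht, h, neg_neg]
    -- A backward motion is a forward motion seen from its other end. The bound is symmetric in the
    -- two end momenta, and Grönwall transfers it to the point at time `0`.
    have h2 : IsHamCurve gU gV fun s => γ (-T + s) := fun s => (hγ (-T + s)).comp_const_add (-T) s
    have hD1 := hDγ _ h2
    simp only [add_zero, neg_add_cancel] at hD1
    have h3 := hγ.one_add_norm_le hL hLb (s := -T) (t := 0) (T := T)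
      (by rw [sub_neg_eq_add, zero_add, abs_of_pos hT])
    calc 1 + ‖(γ 0).1‖ ≤ (1 + ‖γ (-T)‖) * Real.exp (L * T) := h0.trans h3
      _ ≤ D * (1 + ‖(γ (-T)).2‖ + ‖(γ 0).2‖) * Real.exp (L * T) := by gcongr
      _ = _ := by ring

/-- Conservation of energy and the boundary estimate give a drift condition for the square root of
the potential. -/
theorem sqrt_energy_drift {X : Type*} [NormedAddCommGroup X] {U V : X → ℝ} {c A D : ℝ} (hc : 0 < c) (hA : 0 < A) (hD : 0 < D)
    (hU : ∀ x, U x ≤ A * (1 + ‖x‖) ^ 2 ∧ c / 4 * ‖x‖ ^ 2 - A ≤ U x)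
    (hV : ∀ x, V x ≤ A * (1 + ‖x‖) ^ 2 ∧ c / 4 * ‖x‖ ^ 2 - A ≤ V x) :
    ∃ l B, 0 ≤ l ∧ l < 1 ∧ 0 < B ∧ ∀ q p q' p' : X, U q' + V p' = U q + V p →
      1 + ‖q‖ ≤ D * (1 + ‖p‖ + ‖p'‖) →
      √(U q' + A + 1) ≤ l * √(U q + A + 1) + B * (1 + ‖p‖) := by
  -- A fraction `δ` of `U q + A + 1` is at most `c / 4 * ((1 + ‖p‖)² + ‖p'‖²)`, so the final kinetic
  -- energy removes this fraction up to a cost in the fresh momentum `p`. The square root then grows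
  -- linearly, so first moments suffice.
  set δ := c / (8 * D ^ 2 * (2 * A + 1)) with hδ
  have hδ0 : 0 < δ := by positivity
  set b := max 0 (1 - δ) with hb
  have hb0 : 0 ≤ b := le_max_left _ _
  have hb1 : b < 1 := max_lt one_pos (by linarith)
  refine ⟨√b, √(2 * A + c / 4), Real.sqrt_nonneg _, by rwa [Real.sqrt_lt' one_pos, one_pow],
    Real.sqrt_pos.2 (by positivity), fun q p q' p' he hq => ?_⟩
  have n := norm_nonneg q
  have n1 := norm_nonneg p
  have n2 := norm_nonneg p'
  have hWq : 0 ≤ U q + A + 1 := by nlinarith [(hU q).2]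
  have hW1 : U q + A + 1 ≤ (2 * A + 1) * (1 + ‖q‖) ^ 2 := by
    have h0 : 1 ≤ (1 + ‖q‖) ^ 2 := one_le_pow₀ (by linarith)
    nlinarith [(hU q).1]
  have h1 : (1 + ‖q‖) ^ 2 ≤ 2 * D ^ 2 * ((1 + ‖p‖) ^ 2 + ‖p'‖ ^ 2) := by
    calc (1 + ‖q‖) ^ 2 ≤ (D * (1 + ‖p‖ + ‖p'‖)) ^ 2 := by gcongr
      _ ≤ _ := by nlinarith [mul_nonneg (sq_nonneg D) (sq_nonneg (1 + ‖p‖ - ‖p'‖))]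
  have h2 : δ * (U q + A + 1) ≤ c / 4 * ((1 + ‖p‖) ^ 2 + ‖p'‖ ^ 2) := by
    calc δ * (U q + A + 1) ≤ δ * ((2 * A + 1) * (2 * D ^ 2 * ((1 + ‖p‖) ^ 2 + ‖p'‖ ^ 2))) := by
          gcongr
          exact hW1.trans (by gcongr)
      _ = _ := by rw [hδ]; field_simp; ring
  have h3 : (1 - δ) * (U q + A + 1) ≤ b * (U q + A + 1) :=
    mul_le_mul_of_nonneg_right (le_max_right _ _) hWq
  have h4 : U q' + A + 1 ≤ b * (U q + A + 1) + (2 * A + c / 4) * (1 + ‖p‖) ^ 2 := by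
    have h5 : 0 ≤ A * ((1 + ‖p‖) ^ 2 - 1) := mul_nonneg hA.le (by nlinarith)
    linarith [(hV p).1, (hV p').2]
  calc √(U q' + A + 1) ≤ √(b * (U q + A + 1) + (2 * A + c / 4) * (1 + ‖p‖) ^ 2) :=
        Real.sqrt_le_sqrt h4
    _ ≤ √(b * (U q + A + 1)) + √((2 * A + c / 4) * (1 + ‖p‖) ^ 2) := by
      have e1 : 0 ≤ b * (U q + A + 1) := by positivity
      have e2 : 0 ≤ (2 * A + c / 4) * (1 + ‖p‖) ^ 2 := by positivity
      rw [Real.sqrt_le_left (by positivity)]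
      nlinarith [Real.sq_sqrt e1, Real.sq_sqrt e2,
        mul_nonneg (Real.sqrt_nonneg (b * (U q + A + 1)))
          (Real.sqrt_nonneg ((2 * A + c / 4) * (1 + ‖p‖) ^ 2))]
    _ = _ := by
      rw [Real.sqrt_mul hb0, Real.sqrt_mul (by positivity), Real.sqrt_sq (by positivity)]

end Drift

/-- A density with quadratically growing energy has a first moment. -/
theorem lintegral_enorm_lt_top_of_quadratic {X : Type*} [NormedAddCommGroup X]
    [InnerProductSpace ℝ X] [FiniteDimensional ℝ X] [MeasurableSpace X]
    [BorelSpace X] {F : X → ℝ} {b A : ℝ} (hb : 0 < b) (hF : ∀ x, b * ‖x‖ ^ 2 - A ≤ F x) :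
    ∫⁻ x : X, ‖x‖ₑ * ENNReal.ofReal (Real.exp (-F x)) < ∞ := by
  have hi : Integrable (fun x : X => Real.exp (-(b / 2) * ‖x‖ ^ 2)) := by
    have := (GaussianFourier.integrable_cexp_neg_mul_sq_norm_add (V := X) (b := ((b / 2 : ℝ) : ℂ))
      (by simpa using hb) 0 0).norm
    refine this.congr (Filter.Eventually.of_forall fun x => ?_)
    simp only [Complex.norm_exp]
    congr 1
    simp [← Complex.ofReal_pow]
  have hB := (hi.const_mul ((1 + 1 / (2 * b)) * Real.exp A)).lintegral_lt_top
  refine (lintegral_mono fun x => ?_).trans_lt hB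
  rw [← ofReal_norm, ← ENNReal.ofReal_mul (norm_nonneg x)]
  refine ENNReal.ofReal_le_ofReal ?_
  have h1 : ‖x‖ ≤ (1 + 1 / (2 * b)) * Real.exp (b / 2 * ‖x‖ ^ 2) := by
    have h2 := Real.add_one_le_exp (b / 2 * ‖x‖ ^ 2)
    have h3 : ‖x‖ ≤ b / 2 * ‖x‖ ^ 2 + 1 / (2 * b) := by
      have h4 : b / 2 * ‖x‖ ^ 2 + 1 / (2 * b) - ‖x‖ = (b * ‖x‖ - 1) ^ 2 / (2 * b) := by
        field_simp; ring
      have : 0 ≤ (b * ‖x‖ - 1) ^ 2 / (2 * b) := by positivity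
      linarith
    have h5 : 0 < 1 / (2 * b) := by positivity
    nlinarith [sq_nonneg ‖x‖, mul_nonneg hb.le (sq_nonneg ‖x‖)]
  have h6 : Real.exp (-F x) ≤ Real.exp A * Real.exp (-b * ‖x‖ ^ 2) := by
    rw [← Real.exp_add]
    exact Real.exp_le_exp.2 (by linarith [hF x])
  calc ‖x‖ * Real.exp (-F x)
      ≤ ((1 + 1 / (2 * b)) * Real.exp (b / 2 * ‖x‖ ^ 2)) *
        (Real.exp A * Real.exp (-b * ‖x‖ ^ 2)) := by gcongr
    _ = (1 + 1 / (2 * b)) * Real.exp A *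
        (Real.exp (b / 2 * ‖x‖ ^ 2) * Real.exp (-b * ‖x‖ ^ 2)) := by ring
    _ = _ := by
      rw [← Real.exp_add]
      congr 2
      ring

/-! ### From the norm of `A` to a pointwise comparison of Hessians. -/

section Root

variable {H : Type*} [NormedAddCommGroup H] [InnerProductSpace ℝ H] [CompleteSpace H]

/-- The norm of a self-adjoint operator is at most the norm of any operator similar to it. -/
theorem norm_le_of_similar {r r' s : H →L[ℝ] H} (h1 : r * r' = 1) (hs : IsSelfAdjoint s) {a : ℝ}
    (ha : 0 < a) (h : ‖r' * s * r‖ ≤ a) : ‖s‖ ≤ a := by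
  -- A spectral radius argument: powers of the two operators agree up to the fixed factor `‖r‖ *
  -- ‖r'‖`, and `‖s ^ (2 ^ n)‖ = ‖s‖ ^ (2 ^ n)` since `s` is self-adjoint, so the factor disappears
  -- for large `n`.
  have hpow : ∀ n : ℕ, s ^ n = r * (r' * s * r) ^ n * r' := by
    intro n
    induction n with
    | zero => rw [pow_zero, pow_zero, mul_one, h1]
    | succ n ih =>
      calc s ^ (n + 1) = s ^ n * s * (r * r') := by rw [h1, mul_one, pow_succ]
        _ = r * ((r' * s * r) ^ n * (r' * s * r)) * r' := by rw [ih]; simp only [mul_assoc]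
        _ = _ := by rw [pow_succ]
  by_contra! hlt
  have hx : 1 < ‖s‖ / a := (one_lt_div ha).2 hlt
  obtain ⟨n, hn⟩ := pow_unbounded_of_one_lt (‖r‖ * ‖r'‖) hx
  have h2 : ‖s‖ ^ (2 ^ n) ≤ ‖r‖ * ‖r'‖ * a ^ (2 ^ n) := by
    rw [← hs.norm_pow_two_pow, hpow]
    calc ‖r * (r' * s * r) ^ 2 ^ n * r'‖ ≤ ‖r‖ * ‖r' * s * r‖ ^ 2 ^ n * ‖r'‖ := by
          refine (norm_mul_le _ _).trans ?_
          gcongr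
          refine (norm_mul_le _ _).trans ?_
          gcongr
          exact norm_pow_le' _ (by positivity)
      _ ≤ ‖r‖ * a ^ 2 ^ n * ‖r'‖ := by gcongr
      _ = _ := by ring
  have h3 : (‖s‖ / a) ^ n ≤ (‖s‖ / a) ^ (2 ^ n) := pow_le_pow_right₀ hx.le n.lt_two_pow_self.le
  have h4 : (‖s‖ / a) ^ (2 ^ n) ≤ ‖r‖ * ‖r'‖ := by
    rw [div_pow, div_le_iff₀ (by positivity)]; exact h2
  linarith

theorem form_le_of_tendsto {H : Type*} [NormedAddCommGroup H] [InnerProductSpace ℝ H]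
    {A B : ℝ → H →L[ℝ] H} {A₀ B₀ : H →L[ℝ] H} {l : Filter ℝ} [l.NeBot]
    (hA : Filter.Tendsto A l (nhds A₀)) (hB : Filter.Tendsto B l (nhds B₀)) {k : ℝ}
    (h : ∀ᶠ t in l, ∀ y, inner ℝ (A t (B t y)) (B t y) ≤ k * inner ℝ (B t y) y) (y : H) :
    inner ℝ (A₀ (B₀ y)) (B₀ y) ≤ k * inner ℝ (B₀ y) y := by
  have h1 : Filter.Tendsto (fun t => B t y) l (nhds (B₀ y)) :=
    (isBoundedBilinearMap_apply.continuous.tendsto (B₀, y)).comp (hB.prodMk_nhds tendsto_const_nhds)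
  have h2 : Filter.Tendsto (fun t => A t (B t y)) l (nhds (A₀ (B₀ y))) :=
    (isBoundedBilinearMap_apply.continuous.tendsto (A₀, B₀ y)).comp (hA.prodMk_nhds h1)
  exact le_of_tendsto_of_tendsto (h2.inner h1)
    ((h1.inner tendsto_const_nhds).const_mul k) (h.mono fun t ht => ht y)

end Root

namespace ADHMC

open scoped Topology

variable {m : ℕ}

theorem posDef_symm_toEuclideanCLM {u : E m →L[ℝ] E m} (hu : IsSelfAdjoint u)
    (hpos : ∀ x, x ≠ 0 → 0 < inner ℝ (u x) x) :
    ((Matrix.toEuclideanCLM (𝕜 := ℝ) (n := Fin m)).symm u).PosDef := by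
  set M := Matrix.toEuclideanCLM (𝕜 := ℝ) (n := Fin m) with hM
  have hMu : M (M.symm u) = u := M.apply_symm_apply u
  refine Matrix.PosDef.of_dotProduct_mulVec_pos ?_ fun x hx => ?_
  · have : star (M.symm u) = M.symm u := EquivLike.injective M (by rw [map_star, hMu, hu.star_eq])
    exact this
  · have h1 := hpos (WithLp.toLp 2 x) (by simpa using hx)
    rw [real_inner_comm, ← hMu, Matrix.inner_toEuclideanCLM] at h1
    simpa using h1

/-- A bound on the norm of `√(v u)` compares the forms `v u v` and `v`. -/
theorem form_le_of_norm_rootProdMatrix_le {u v : E m →L[ℝ] E m} (hu : IsSelfAdjoint u)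
    (hu' : ∀ x, x ≠ 0 → 0 < inner ℝ (u x) x) (hv : IsSelfAdjoint v)
    (hv' : ∀ x, x ≠ 0 → 0 < inner ℝ (v x) x) {a : ℝ} (ha : 0 < a)
    (h : ‖Matrix.toEuclideanCLM (𝕜 := ℝ) (n := Fin m) (rootProdMatrix
      ((Matrix.toEuclideanCLM (𝕜 := ℝ) (n := Fin m)).symm v)
      ((Matrix.toEuclideanCLM (𝕜 := ℝ) (n := Fin m)).symm u))‖ ≤ a) (y : E m) :
    inner ℝ (u (v y)) (v y) ≤ a ^ 2 * inner ℝ (v y) y := by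
  have hU := posDef_symm_toEuclideanCLM hu hu'
  have hV := posDef_symm_toEuclideanCLM hv hv'
  set M := Matrix.toEuclideanCLM (𝕜 := ℝ) (n := Fin m) with hM
  have hMu : M (M.symm u) = u := M.apply_symm_apply u
  have hMv : M (M.symm v) = v := M.apply_symm_apply v
  have hr : rootMatrix (M.symm u) * rootMatrix (M.symm u) = M.symm u :=
    rootMatrix_mul_self hU.posSemidef
  have hdet : IsUnit (rootMatrix (M.symm u)).det := by
    have h : IsUnit (rootMatrix (M.symm u) * rootMatrix (M.symm u)).det := by
      rw [hr]; exact hU.det_pos.ne'.isUnit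
    rw [Matrix.det_mul] at h
    exact isUnit_of_mul_isUnit_left h
  have hs := rootMatrix_mul_self (S := rootMatrix (M.symm u) * M.symm v * rootMatrix (M.symm u)) (by
    have h := hV.posSemidef.mul_mul_conjTranspose_same (rootMatrix (M.symm u))
    rwa [(rootMatrix_isHermitian _).eq] at h)
  have hrs := rootMatrix_isHermitian (M.symm u)
  have hss := rootMatrix_isHermitian (rootMatrix (M.symm u) * M.symm v * rootMatrix (M.symm u))
  unfold rootProdMatrix at h
  generalize rootMatrix (rootMatrix (M.symm u) * M.symm v * rootMatrix (M.symm u)) = s' at *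
  generalize rootMatrix (M.symm u) = r' at *
  have e1 : M r' * M r'⁻¹ = 1 := by rw [← map_mul, Matrix.mul_nonsing_inv _ hdet, map_one]
  have e2 : M r' * M r' = u := by rw [← map_mul, hr, hMu]
  have e3 : M s' * M s' = M r' * v * M r' := by rw [← map_mul, hs, map_mul, map_mul, hMv]
  have hrs' : IsSelfAdjoint (M r') := by
    rw [IsSelfAdjoint, ← map_star]; exact congrArg M hrs
  have hss' : IsSelfAdjoint (M s') := by
    rw [IsSelfAdjoint, ← map_star]; exact congrArg M hss
  rw [map_mul, map_mul] at h
  have hn := norm_le_of_similar e1 hss' ha h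
  generalize M r'⁻¹ = ri at *
  generalize M r' = r at *
  generalize M s' = s at *
  have hsym : ∀ {w : E m →L[ℝ] E m}, IsSelfAdjoint w → ∀ x z, inner ℝ (w x) z = inner ℝ x (w z) :=
    fun hw x z => hw.isSymmetric x z
  -- With `u = r²`, `s² = r v r` and `w = r⁻¹ y` one has `r v y = s² w`. The two forms are then `‖s²
  -- w‖²` and `‖s w‖²`, and the claim reduces to `‖s‖ ≤ a`.
  set w := ri y with hw
  have hy : r w = y := by rw [hw, ← mul_apply_eq_comp, e1]; rfl
  have e4 : r (v y) = s (s w) := by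
    rw [← mul_apply_eq_comp s, e3]; simp [hy]
  calc inner ℝ (u (v y)) (v y) = ‖s (s w)‖ ^ 2 := by
        rw [← e2, mul_apply_eq_comp, hsym hrs', e4, real_inner_self_eq_norm_sq]
    _ ≤ (a * ‖s w‖) ^ 2 := by
        gcongr
        exact (s.le_opNorm _).trans (by gcongr)
    _ = a ^ 2 * inner ℝ (s (s w)) w := by
        rw [mul_pow, hsym hss', real_inner_self_eq_norm_sq]
    _ = _ := by rw [← e4, hsym hrs', hy]

theorem tendsto_average {f : ℝ → E m →L[ℝ] E m} (hf : Continuous f) :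
    Filter.Tendsto (fun t : ℝ => t⁻¹ • ∫ s in (0 : ℝ)..t, f s) (𝓝[>] 0) (𝓝 (f 0)) := by
  have h := intervalIntegral.integral_hasDerivAt_right (hf.intervalIntegrable 0 0)
    hf.stronglyMeasurable.stronglyMeasurableAtFilter hf.continuousAt
  have h1 := hasDerivAt_iff_tendsto_slope_zero.1 h
  simp only [zero_add, intervalIntegral.integral_same, sub_zero] at h1
  exact h1.mono_left (nhdsWithin_mono _ fun t (ht : 0 < t) => ht.ne')

theorem average_apply_inner {f : ℝ → E m →L[ℝ] E m} (hf : Continuous f) (t : ℝ) (x y : E m) :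
    inner ℝ ((t⁻¹ • ∫ s in (0 : ℝ)..t, f s) x) y = t⁻¹ * ∫ s in (0 : ℝ)..t, inner ℝ (f s x) y := by
  have h1 : (∫ s in (0 : ℝ)..t, f s) x = ∫ s in (0 : ℝ)..t, f s x :=
    ContinuousLinearMap.intervalIntegral_apply (hf.intervalIntegrable 0 t) x
  have h2 : Continuous fun s => f s x := by fun_prop
  have h3 := (innerSL ℝ y).intervalIntegral_comp_comm (h2.intervalIntegrable (μ := volume) 0 t)
  simp only [innerSL_apply_apply] at h3
  rw [smul_apply, h1, inner_smul_left, real_inner_comm, ← h3]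
  simp [real_inner_comm]

theorem average_isSelfAdjoint {f : ℝ → E m →L[ℝ] E m} (hf : Continuous f)
    (hs : ∀ s x y, inner ℝ (f s x) y = inner ℝ x (f s y)) (t : ℝ) :
    IsSelfAdjoint (t⁻¹ • ∫ s in (0 : ℝ)..t, f s) := by
  rw [ContinuousLinearMap.isSelfAdjoint_iff_isSymmetric]
  intro x y
  rw [← real_inner_comm]
  simp only [ContinuousLinearMap.coe_coe]
  rw [real_inner_comm, average_apply_inner hf, ← real_inner_comm x, average_apply_inner hf]
  congr 1
  refine intervalIntegral.integral_congr fun s _ => ?_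
  rw [hs, real_inner_comm]

theorem average_pos {f : ℝ → E m →L[ℝ] E m} (hf : Continuous f) {c t : ℝ} (hc : 0 < c) (ht : 0 < t)
    (hl : ∀ s ∈ Icc 0 t, ∀ x, c * ‖x‖ ^ 2 ≤ inner ℝ (f s x) x) {x : E m} (hx : x ≠ 0) :
    0 < inner ℝ ((t⁻¹ • ∫ s in (0 : ℝ)..t, f s) x) x := by
  rw [average_apply_inner hf]
  have h2 : Continuous fun s => inner ℝ (f s x) x := by fun_prop
  have h3 : ∫ s in (0 : ℝ)..t, c * ‖x‖ ^ 2 ≤ ∫ s in (0 : ℝ)..t, inner ℝ (f s x) x :=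
    intervalIntegral.integral_mono_on ht.le (by simp) (h2.intervalIntegrable _ _)
      fun s hs => hl s hs x
  have h4 : 0 < ∫ s in (0 : ℝ)..t, c * ‖x‖ ^ 2 := by
    have := norm_pos_iff.2 hx
    simp only [intervalIntegral.integral_const, sub_zero, smul_eq_mul]
    positivity
  have := h4.trans_le h3
  positivity

variable {U V : E m → ℝ} {R c K : ℝ}

theorem isHamFlow_motion (hU : IsForce (gradient U) (hess U) R c K)
    (hV : IsForce (gradient V) (hess V) R c K) :
    IsHamFlow (gradient U) (gradient V) (motion U V) := by
  classical
  have h : ∀ z : E m × E m, ∃ γ : ℝ → E m × E m, IsHamiltonianMotion U V γ ∧ γ 0 = z :=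
    fun z => exists_isHamCurve hU hV z
  have e : ∀ z, (fun t => motion U V t z) = (h z).choose := by
    intro z
    ext1 t
    rw [motion, dif_pos (h z)]
  refine ⟨fun z => ?_, fun z => ?_⟩
  · rw [e]; exact (h z).choose_spec.1
  · exact (congrFun (e z) 0).trans (h z).choose_spec.2

/-- The comparison of forms for time averages along a motion that stays outside the ball. -/
theorem form_average_le (hU : IsForce (gradient U) (hess U) R c K)
    (hV : IsForce (gradient V) (hess V) R c K) {a T : ℝ} (ha : 0 < a)
    (hA : normAOutside U V R T ≤ ENNReal.ofReal a) {z : E m × E m} {t : ℝ} (ht : 0 < t)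
    (htT : t ≤ T)
    (hin : ∀ s ∈ Icc 0 t, R < ‖(motion U V s z).1‖ ∧ R < ‖(motion U V s z).2‖)
    (y : E m) : inner ℝ (avgHessU U V z t (avgHessV U V z t y)) (avgHessV U V z t y) ≤
      a ^ 2 * inner ℝ (avgHessV U V z t y) y := by
  have hγ : Continuous fun t => motion U V t z := ((isHamFlow_motion hU hV).isHamCurve z).continuous
  have hUc : Continuous fun s => hess U (motion U V s z).1 :=
    hU.continuous_deriv.comp (continuous_fst.comp hγ)
  have hVc : Continuous fun s => hess V (motion U V s z).2 :=
    hV.continuous_deriv.comp (continuous_snd.comp hγ)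
  have hnorm : ‖opA U V z t‖ ≤ a := by
    have h1 : ‖opA U V z t‖ₑ ≤ ENNReal.ofReal a := by
      refine le_trans ?_ hA
      unfold normAOutside
      exact le_iSup₂_of_le z t (le_iSup₂_of_le ⟨ht, htT⟩ hin le_rfl)
    rwa [← ofReal_norm, ENNReal.ofReal_le_ofReal_iff ha.le] at h1
  have sU : IsSelfAdjoint (avgHessU U V z t) := average_isSelfAdjoint hUc (fun s => hU.symm _) t
  have sV : IsSelfAdjoint (avgHessV U V z t) := average_isSelfAdjoint hVc (fun s => hV.symm _) t
  have pU : ∀ x, x ≠ 0 → 0 < inner ℝ (avgHessU U V z t x) x := fun x hx =>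
    average_pos hUc hU.c_pos ht (fun s hs => hU.lower _ (hin s hs).1) hx
  have pV : ∀ x, x ≠ 0 → 0 < inner ℝ (avgHessV U V z t x) x := fun x hx =>
    average_pos hVc hV.c_pos ht (fun s hs => hV.lower _ (hin s hs).2) hx
  unfold opA at hnorm
  exact form_le_of_norm_rootProdMatrix_le sU pU sV pV ha hnorm y

/-- The motion started at `(q, p)` stays outside the ball for a short time, and the averaged
Hessians tend to those at `q` and `p` as that time tends to `0`. Any pair `(q, p)` outside the ball
is an admissible start, so the two points are independent. -/
theorem form_le_of_normAOutside_le (hU : IsForce (gradient U) (hess U) R c K)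
    (hV : IsForce (gradient V) (hess V) R c K) {a T : ℝ} (ha : 0 < a) (hT : 0 < T)
    (hA : normAOutside U V R T ≤ ENNReal.ofReal a) {q p : E m} (hq : R < ‖q‖) (hp : R < ‖p‖)
    (y : E m) : inner ℝ (hess U q (hess V p y)) (hess V p y) ≤
      a ^ 2 * inner ℝ (hess V p y) y := by
  have hφ := isHamFlow_motion hU hV
  have hγ : Continuous fun t => motion U V t (q, p) := (hφ.isHamCurve (q, p)).continuous
  have h0 : motion U V 0 (q, p) = (q, p) := hφ.zero _
  have tU : Filter.Tendsto (avgHessU U V (q, p)) (𝓝[>] 0) (𝓝 (hess U q)) := by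
    have := tendsto_average (hU.continuous_deriv.comp (continuous_fst.comp hγ))
    simp only [Function.comp_apply, h0] at this
    exact this
  have tV : Filter.Tendsto (avgHessV U V (q, p)) (𝓝[>] 0) (𝓝 (hess V p)) := by
    have := tendsto_average (hV.continuous_deriv.comp (continuous_snd.comp hγ))
    simp only [Function.comp_apply, h0] at this
    exact this
  have hout : ∀ᶠ s in 𝓝 (0 : ℝ), R < ‖(motion U V s (q, p)).1‖ ∧ R < ‖(motion U V s (q, p)).2‖ := by
    refine ((continuous_fst.comp hγ).norm.tendsto 0).eventually_const_lt ?_ |>.and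
      (((continuous_snd.comp hγ).norm.tendsto 0).eventually_const_lt ?_)
    · simpa [h0] using hq
    · simpa [h0] using hp
  obtain ⟨ε, hε, hεs⟩ := Metric.eventually_nhds_iff.1 hout
  refine form_le_of_tendsto tU tV ?_ y
  filter_upwards [Ioo_mem_nhdsGT (lt_min hε hT)] with t ht
  intro y
  refine form_average_le hU hV ha hA ht.1 (ht.2.trans_le (min_le_right _ _)).le (fun s hs => ?_) y
  refine hεs ?_
  rw [dist_zero_right, Real.norm_of_nonneg hs.1]
  exact hs.2.trans_lt (ht.2.trans_le (min_le_left _ _))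

theorem exists_frequency_bound {N : ℝ≥0∞} {T : ℝ} (hT : 0 < T)
    (h : ENNReal.ofReal T < ENNReal.ofReal Real.pi / N) :
    ∃ a, 0 < a ∧ N ≤ ENNReal.ofReal a ∧ a * T < Real.pi := by
  have hpi := Real.pi_pos
  -- For `N = 0` the quotient is `∞` and `h` says nothing, so `a` is chosen from `T` alone; `N = ∞`
  -- contradicts `h`.
  rcases eq_or_ne N 0 with rfl | h0
  · refine ⟨Real.pi / (2 * T), by positivity, zero_le, ?_⟩
    field_simp
    linarith
  have ht : N ≠ ∞ := by
    rintro rfl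
    simp at h
  have hn := ENNReal.toReal_pos h0 ht
  refine ⟨N.toReal, hn, (ENNReal.ofReal_toReal ht).ge, ?_⟩
  rw [← ENNReal.ofReal_toReal ht, ← ENNReal.ofReal_div_of_pos hn,
    ENNReal.ofReal_lt_ofReal_iff (by positivity), lt_div_iff₀ hn] at h
  linarith

end ADHMC

/-! ### Regularity of the energies. -/

section Regularity

variable {X : Type*} [NormedAddCommGroup X] [InnerProductSpace ℝ X] [CompleteSpace X]

/-- The inverse of the Riesz isomorphism as a linear map over the reals. -/
noncomputable def rieszInv (X : Type*) [NormedAddCommGroup X] [InnerProductSpace ℝ X]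
    [CompleteSpace X] : (X →L[ℝ] ℝ) →L[ℝ] X :=
  LinearMap.mkContinuous
    { toFun := fun l => (InnerProductSpace.toDual ℝ X).symm l
      map_add' := fun a b => map_add _ a b
      map_smul' := fun a b => by simp } 1 fun l => by simp

theorem inner_rieszInv (l : X →L[ℝ] ℝ) (v : X) : inner ℝ (rieszInv X l) v = l v :=
  InnerProductSpace.toDual_symm_apply

theorem gradient_eq_rieszInv (F : X → ℝ) : gradient F = fun x => rieszInv X (fderiv ℝ F x) := rfl

theorem ContDiff.gradient {F : X → ℝ} (hF : ContDiff ℝ 2 F) : ContDiff ℝ 1 (gradient F) := by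
  rw [gradient_eq_rieszInv]
  exact (rieszInv X).contDiff.comp (hF.fderiv_right (by norm_num))

theorem inner_fderiv_gradient {F : X → ℝ} (hF : ContDiff ℝ 2 F) (x u v : X) :
    inner ℝ (fderiv ℝ (gradient F) x u) v = fderiv ℝ (fderiv ℝ F) x u v := by
  have h1 : DifferentiableAt ℝ (fderiv ℝ F) x :=
    ((hF.fderiv_right (m := 1) (by norm_num)).differentiable one_ne_zero) x
  have h2 : HasFDerivAt (gradient F) ((rieszInv X).comp (fderiv ℝ (fderiv ℝ F) x)) x :=
    (rieszInv X).hasFDerivAt.comp x h1.hasFDerivAt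
  rw [h2.fderiv]
  exact inner_rieszInv _ _

/-- Positivity of the form at `H v - C • v` and the upper bound at `H v` give `‖H v‖² ≤ C ⟨H v, v⟩`.
-/
theorem norm_le_of_form_le {X : Type*} [NormedAddCommGroup X] [InnerProductSpace ℝ X] {H : X →L[ℝ] X} (hs : ∀ u v, inner ℝ (H u) v = inner ℝ u (H v)) {C : ℝ}
    (hC : 0 < C) (h0 : ∀ v, 0 ≤ inner ℝ (H v) v) (h1 : ∀ v, inner ℝ (H v) v ≤ C * ‖v‖ ^ 2) :
    ‖H‖ ≤ C := by
  refine H.opNorm_le_bound hC.le fun v => ?_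
  have h2 := h0 (H v - C • v)
  have h3 := h1 (H v)
  have h4 := h1 v
  have h5 : inner ℝ (H (H v)) v = ‖H v‖ ^ 2 := by rw [hs, real_inner_self_eq_norm_sq]
  simp only [map_sub, map_smul, inner_sub_left, inner_sub_right, inner_smul_left, inner_smul_right,
    h5, real_inner_self_eq_norm_sq, conj_trivial] at h2
  have h6 : C * ‖H v‖ ^ 2 ≤ C * (C * inner ℝ (H v) v) := by linarith
  have h7 := le_of_mul_le_mul_left h6 hC
  have h8 : C * inner ℝ (H v) v ≤ C * (C * ‖v‖ ^ 2) := by gcongr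
  refine (sq_le_sq₀ (norm_nonneg _) (by positivity)).1 ?_
  nlinarith

end Regularity

namespace ADHMC

variable {m : ℕ} {f : E m → ℝ}

theorem IsRegularDensity.contDiff_energy (hf : IsRegularDensity f) : ContDiff ℝ 2 (energy f) :=
  (hf.contDiff.log fun x => (hf.pos x).ne').neg

theorem IsRegularDensity.exp_neg_energy (hf : IsRegularDensity f) (x : E m) :
    Real.exp (-energy f x) = f x := by
  rw [energy, neg_neg, Real.exp_log (hf.pos x)]

theorem IsRegularDensity.hasGradientAt_energy (hf : IsRegularDensity f) (x : E m) :
    HasGradientAt (energy f) (gradient (energy f) x) x :=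
  ((hf.contDiff_energy.differentiable two_ne_zero) x).hasGradientAt

theorem IsRegularDensity.isProbabilityMeasure (hf : IsRegularDensity f) :
    IsProbabilityMeasure (densityMeasure f) :=
  ⟨by rw [densityMeasure, withDensity_apply _ MeasurableSet.univ, Measure.restrict_univ,
    hf.lintegral_eq_one]⟩

theorem IsRegularDensity.exists_isForce (hf : IsRegularDensity f) {R : ℝ} (hR : 0 < R)
    (h : StrictlyLogConcaveOutside f R) :
    ∃ c K, IsForce (gradient (energy f)) (hess (energy f)) R c K := by
  obtain ⟨c, C, hc, hform⟩ := h
  have hE := hf.contDiff_energy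
  have hsymm : ∀ x u v, inner ℝ (hess (energy f) x u) v = inner ℝ u (hess (energy f) x v) := by
    intro x u v
    have h1 : IsSymmSndFDerivAt ℝ (energy f) x := hE.contDiffAt.isSymmSndFDerivAt (by simp)
    rw [real_inner_comm _ u, hess, inner_fderiv_gradient hE, inner_fderiv_gradient hE]
    exact h1 u v
  have hcont : Continuous (hess (energy f)) := hE.gradient.continuous_fderiv one_ne_zero
  obtain ⟨K, hK⟩ := (isCompact_closedBall (0 : E m) R).exists_bound_of_continuousOn hcont.continuousOn
  -- `K` bounds the Hessian on the ball by compactness, the forms bound it outside. The `1` is there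
  -- because `C` need not be positive.
  refine ⟨c, max K (max C 1), fun x => ?_, hcont, hsymm, fun x => ?_, fun x hx v => (hform x hx v).1,
    hc, by positivity, hR⟩
  · exact ((hE.gradient.differentiable one_ne_zero) x).hasFDerivAt
  · rcases le_or_gt ‖x‖ R with hx | hx
    · exact (hK x (by simpa using hx)).trans (le_max_left _ _)
    · refine (norm_le_of_form_le (hsymm x) (C := max C 1) (by positivity)
        (fun v => le_trans (by positivity) (hform x hx v).1) fun v => (hform x hx v).2.trans ?_).trans
        (le_max_right _ _)
      gcongr
      exact le_max_left _ _

/-- Every regular density dominates a multiple of Lebesgue measure on bounded sets. -/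
theorem IsRegularDensity.exists_mul_volume_le (hf : IsRegularDensity f) (x : E m) (r : ℝ) :
    ∃ κ : ℝ≥0∞, κ ≠ 0 ∧ ∀ S, MeasurableSet S → S ⊆ Metric.ball x r →
      κ * volume S ≤ densityMeasure f S := by
  rcases lt_or_ge r 0 with hr | hr
  · refine ⟨1, one_ne_zero, fun S _ hSb => ?_⟩
    rw [Metric.ball_eq_empty.2 hr.le, subset_empty_iff] at hSb
    simp [hSb]
  obtain ⟨y, -, hy⟩ := (isCompact_closedBall x r).exists_isMinOn
    ⟨x, Metric.mem_closedBall_self hr⟩ hf.contDiff.continuous.continuousOn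
  refine ⟨ENNReal.ofReal (f y), by simpa using hf.pos y, fun S hS hSb => ?_⟩
  rw [densityMeasure, withDensity_apply _ hS, ← setLIntegral_const]
  exact setLIntegral_mono' hS fun z hz => ENNReal.ofReal_le_ofReal
    (hy (Metric.ball_subset_closedBall (hSb hz)))

end ADHMC

/-! ### Kernels of single moves and composition of drift conditions. -/

section Move

open ProbabilityTheory

variable {Y Z : Type*} [MeasurableSpace Y] [MeasurableSpace Z]

/-- The kernel that sends `q` to the law of `f (q, p)`, where `p` has law `ν`. -/
noncomputable def moveKernel (ν : Measure Z) (f : Y × Z → Y) : Kernel Y Y :=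
  (Kernel.id ×ₖ Kernel.const Y ν).map f

variable {ν : Measure Z} [IsProbabilityMeasure ν] {f : Y × Z → Y}

theorem isMarkovKernel_moveKernel (hf : Measurable f) : IsMarkovKernel (moveKernel ν f) :=
  Kernel.IsMarkovKernel.map _ hf

theorem lintegral_moveKernel (hf : Measurable f) {g : Y → ℝ≥0∞} (hg : Measurable g) (q : Y) :
    ∫⁻ y, g y ∂moveKernel ν f q = ∫⁻ p, g (f (q, p)) ∂ν := by
  rw [moveKernel, Kernel.map_apply _ hf, lintegral_map hg hf, Kernel.prod_apply, Kernel.id_apply,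
    Kernel.const_apply, Measure.dirac_prod]
  exact lintegral_map (hg.comp hf) measurable_prodMk_left

theorem moveKernel_apply (hf : Measurable f) {S : Set Y} (hS : MeasurableSet S) (q : Y) :
    moveKernel ν f q S = ν {p | f (q, p) ∈ S} := by
  rw [moveKernel, Kernel.map_apply _ hf, Measure.map_apply hf hS, Kernel.prod_apply,
    Kernel.id_apply, Kernel.const_apply, Measure.dirac_prod,
    Measure.map_apply measurable_prodMk_left (hf hS)]
  rfl

theorem bind_moveKernel (hf : Measurable f) (μ : Measure Y) [SFinite μ] :
    μ.bind (moveKernel ν f) = (μ.prod ν).map f := by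
  rw [moveKernel, ← Measure.map_comp _ _ hf, ← Measure.compProd_eq_comp_prod,
    Measure.compProd_const]

/-- A geometric drift condition. -/
def HasDrift (κ : Kernel Y Y) (W : Y → ℝ) (l K : ℝ) : Prop :=
  ∀ x, ∫⁻ y, ENNReal.ofReal (W y) ∂κ x ≤ ENNReal.ofReal (l * W x + K)

theorem HasDrift.lintegral_le {κ : Kernel Y Y} {W : Y → ℝ} {l K : ℝ} (h : HasDrift κ W l K)
    (hW : Measurable W) (hW0 : ∀ x, 0 ≤ W x) (hl : 0 ≤ l) (hK : 0 ≤ K) (μ : Measure Y)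
    [IsProbabilityMeasure μ] : ∫⁻ x, ENNReal.ofReal (W x) ∂(μ.bind κ) ≤
      ENNReal.ofReal l * ∫⁻ x, ENNReal.ofReal (W x) ∂μ + ENNReal.ofReal K := by
  rw [Measure.lintegral_bind κ.aemeasurable hW.ennreal_ofReal.aemeasurable]
  refine (lintegral_mono h).trans_eq ?_
  simp_rw [fun x => ENNReal.ofReal_add (mul_nonneg hl (hW0 x)) hK, ENNReal.ofReal_mul hl]
  rw [lintegral_add_right _ measurable_const, lintegral_const_mul _ hW.ennreal_ofReal]
  simp

theorem HasDrift.comp {κ η : Kernel Y Y} [IsMarkovKernel κ] {W : Y → ℝ} (hW : Measurable W)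
    (hW0 : ∀ x, 0 ≤ W x) {l K l' K' : ℝ} (hl : 0 ≤ l) (hK : 0 ≤ K) (hl' : 0 ≤ l') (hK' : 0 ≤ K')
    (h : HasDrift κ W l K) (h' : HasDrift η W l' K') :
    HasDrift (η ∘ₖ κ) W (l' * l) (l' * K + K') := by
  intro x
  have := h'.lintegral_le hW hW0 hl' hK' (κ x)
  rw [Kernel.comp_apply]
  refine this.trans ((add_le_add_left (mul_le_mul_right (h x) _) _).trans_eq ?_)
  have h1 := hW0 x
  rw [← ENNReal.ofReal_mul hl', ← ENNReal.ofReal_add (by positivity) hK']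
  congr 1
  ring

theorem HasDrift.iter {κ : Kernel Y Y} [IsMarkovKernel κ] {W : Y → ℝ} (hW : Measurable W)
    (hW0 : ∀ x, 0 ≤ W x) {l K : ℝ} (hl : 0 ≤ l) (hl1 : l < 1) (hK : 0 ≤ K)
    (h : HasDrift κ W l K) (n : ℕ) :
    HasDrift (kernelIter κ n) W (l ^ n) (K / (1 - l) * (1 - l ^ n)) := by
  have h1 : 0 < 1 - l := by linarith
  induction n with
  | zero =>
    intro x
    rw [kernelIter, Kernel.id_apply, lintegral_dirac' _ hW.ennreal_ofReal]
    simp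
  | succ n ih =>
    have h2 : 0 ≤ 1 - l ^ n := sub_nonneg.2 (pow_le_one₀ hl hl1.le)
    have h3 := HasDrift.comp hW hW0 hl hK (pow_nonneg hl n) (by positivity) h ih
    have h4 : l ^ n * K + K / (1 - l) * (1 - l ^ n) = K / (1 - l) * (1 - l ^ (n + 1)) := by
      field_simp
      ring
    rwa [h4, ← pow_succ] at h3

end Move

/-! ### Minorization for a pair of moves and invariance of the target. -/

section Hamiltonian

open ProbabilityTheory

variable {X : Type*} [NormedAddCommGroup X] [InnerProductSpace ℝ X] [FiniteDimensional ℝ X]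
  [MeasurableSpace X] [BorelSpace X] {gU gV : X → X} {HU HV : X → X →L[ℝ] X} {R c K : ℝ}
  {φ : ℝ → X × X → X × X}

/-- A forward move followed by a backward move has a component with a density near the starting
point. -/
theorem exists_minorization_forward_backward [Nontrivial X] (hφ : IsHamFlow gU gV φ)
    (hU : IsForce gU HU R c K) (hV : IsForce gV HV R c K) {a T : ℝ} (ha : 0 < a) (hT : 0 < T)
    (haT : a * T < Real.pi)
    (hc : ∀ q p, R < ‖q‖ → R < ‖p‖ → ∀ v,
      inner ℝ (HU q (HV p v)) (HV p v) ≤ a ^ 2 * inner ℝ (HV p v) v)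
    (μ ν : Measure X) [μ.IsAddHaarMeasure] [IsProbabilityMeasure ν]
    (hν : ∀ x, ∃ κ : ℝ≥0∞, κ ≠ 0 ∧ ∀ S, MeasurableSet S → S ⊆ Metric.ball x 1 → κ * μ S ≤ ν S)
    (q₀ : X) : ∃ ε, 0 < ε ∧ ∃ α : ℝ≥0∞, α ≠ 0 ∧ ∀ q ∈ Metric.ball q₀ ε, ∀ S,
      MeasurableSet S → S ⊆ Metric.ball q₀ ε →
      α * μ S ≤ (moveKernel ν (fun z => (φ (-T) z).1) ∘ₖ moveKernel ν (fun z => (φ T z).1)) q S := by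
  have : CompleteSpace X := FiniteDimensional.complete ℝ X
  obtain ⟨τ, hτ, hvar⟩ := variation_eq_zero hU hV ha hT haT hc
  obtain ⟨p₀, hp₀⟩ := exists_badTimes_small hU hV hT hτ q₀
  have hcont : ∀ t, Continuous fun z => (φ t z).1 := fun t => (hφ.continuous hU hV t).fst
  set z₀ : X × X := (q₀, p₀) with hz₀
  set z₁ := φ T z₀ with hz₁
  have hbad := hp₀ (fun t => φ t z₀) (hφ.isHamCurve z₀) (hφ.zero z₀)
  have hγc := (hφ.isHamCurve z₀).continuous
  obtain ⟨J, hJ0, hJ⟩ := exists_fundamental hU hV hγc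
  obtain ⟨J', hJ0', hJ'⟩ := exists_fundamental hU hV (hφ.isHamCurve z₁).continuous
  have hf : HasStrictFDerivAt (fun z => (φ T z).1) ((ContinuousLinearMap.fst ℝ X X).comp (J T))
      (q₀, p₀) :=
    hasStrictFDerivAt_fst.comp _ (hφ.hasStrictFDerivAt hU hV hJ0 hJ T)
  have hf' : HasStrictFDerivAt (fun z => (φ (-T) z).1)
      ((ContinuousLinearMap.fst ℝ X X).comp (J' (-T))) (z₁.1, z₁.2) :=
    hasStrictFDerivAt_fst.comp _ (hφ.hasStrictFDerivAt hU hV hJ0' hJ' (-T))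
  have hinj : ∀ v, ((ContinuousLinearMap.fst ℝ X X).comp (J T)) (0, v) = 0 → v = 0 := by
    intro v hv
    have h0 := hvar _ _ hγc (hJ (0, v)) hbad (by simp [hJ0]) hv
    have h1 := congrFun h0 0
    simp only [hJ0, ContinuousLinearMap.id_apply, Pi.zero_apply] at h1
    exact (Prod.ext_iff.1 h1).2
  -- Shifted in time by `T`, a variation of the backward motion is a variation along the same
  -- forward orbit. The bound on its time in the ball is therefore already available.
  have hinj' : ∀ v, ((ContinuousLinearMap.fst ℝ X X).comp (J' (-T))) (0, v) = 0 → v = 0 := by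
    intro v hv
    have hs : IsVariation HU HV (fun t => φ t z₀) fun t => J' (-T + t) (0, v) := by
      intro t
      have h1 := (hJ' (0, v) (-T + t)).comp_const_add (-T) t
      have h2 : φ (-T + t) z₁ = φ t z₀ := by
        rw [hz₁, ← hφ.add hU hV]
        congr 1
        ring
      simp only [h2] at h1
      exact h1
    have h0 := hvar _ _ hγc hs hbad (by simpa using hv) (by simp [hJ0'])
    have h1 := congrFun h0 T
    simp only [neg_add_cancel, hJ0', ContinuousLinearMap.id_apply, Pi.zero_apply] at h1
    exact (Prod.ext_iff.1 h1).2
  obtain ⟨κ, hκ, hκS⟩ := hν p₀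
  obtain ⟨κ', hκ', hκS'⟩ := hν z₁.2
  obtain ⟨ε₁, hε₁, α₁, hα₁, h1⟩ :=
    exists_local_minorization hf (hcont T) hinj μ ν hκ one_pos hκS
  obtain ⟨ε₂, hε₂, α₂, hα₂, h2⟩ :=
    exists_local_minorization hf' (hcont (-T)) hinj' μ ν hκ' one_pos hκS'
  have hback : (φ (-T) (z₁.1, z₁.2)).1 = q₀ := by
    rw [Prod.mk.eta, hz₁, hφ.neg_self hU hV]
  rw [hback] at h2
  -- The chain passes through intermediate positions near that of `z₁`: the first move reaches `B`
  -- with mass at least `α₁ * μ B`, and from each point of `B` the second move has a component with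
  -- a density near `q₀`.
  set B := Metric.ball z₁.1 (min ε₁ ε₂) with hB
  refine ⟨min ε₁ ε₂, lt_min hε₁ hε₂, α₂ * α₁ * μ B, ?_, fun q hq S hS hSb => ?_⟩
  · exact mul_ne_zero (mul_ne_zero hα₂ hα₁) (Metric.measure_ball_pos μ _ (lt_min hε₁ hε₂)).ne'
  have hq1 : α₁ * μ B ≤ moveKernel ν (fun z => (φ T z).1) q B := by
    rw [moveKernel_apply (hcont T).measurable Metric.isOpen_ball.measurableSet]
    exact h1 q (Metric.ball_subset_ball (min_le_left _ _) hq) B Metric.isOpen_ball.measurableSet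
      (Metric.ball_subset_ball (min_le_left _ _))
  rw [Kernel.comp_apply' _ _ _ hS]
  calc α₂ * α₁ * μ B * μ S = α₂ * μ S * (α₁ * μ B) := by ring
    _ ≤ α₂ * μ S * moveKernel ν (fun z => (φ T z).1) q B := by gcongr
    _ = ∫⁻ y in B, α₂ * μ S ∂moveKernel ν (fun z => (φ T z).1) q := by rw [setLIntegral_const]
    _ ≤ ∫⁻ y in B, moveKernel ν (fun z => (φ (-T) z).1) y S ∂moveKernel ν (fun z => (φ T z).1) q := by
      refine setLIntegral_mono' Metric.isOpen_ball.measurableSet fun y hy => ?_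
      rw [moveKernel_apply (hcont (-T)).measurable hS]
      exact h2 y (Metric.ball_subset_ball (min_le_right _ _) hy) S hS
        (hSb.trans (Metric.ball_subset_ball (min_le_right _ _)))
    _ ≤ _ := setLIntegral_le_lintegral _ _

/-- The flow preserves every density which is constant along the motions. -/
theorem IsHamFlow.map_withDensity (hφ : IsHamFlow gU gV φ) (hU : IsForce gU HU R c K)
    (hV : IsForce gV HV R c K) (μ : Measure (X × X)) [μ.IsAddHaarMeasure] {g : X × X → ℝ≥0∞} {t : ℝ}
    (hg : ∀ z, g (φ t z) = g z) : (μ.withDensity g).map (φ t) = μ.withDensity g := by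
  have hm := (hφ.continuous hU hV t).measurable
  ext S hS
  rw [Measure.map_apply hm hS, withDensity_apply _ (hm hS), withDensity_apply _ hS,
    ← lintegral_indicator (hm hS), ← lintegral_indicator hS,
    ← hφ.lintegral_comp hU hV μ t (S.indicator g)]
  refine lintegral_congr fun z => ?_
  by_cases hz : φ t z ∈ S
  · rw [indicator_of_mem hz, indicator_of_mem (show z ∈ φ t ⁻¹' S from hz), hg]
  · rw [indicator_of_notMem hz, indicator_of_notMem (show z ∉ φ t ⁻¹' S from hz)]

/-- The law with density `exp (-U)` is invariant under a move of any duration with a momentum of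
density `exp (-V)`. -/
theorem IsHamFlow.map_prod_withDensity (hφ : IsHamFlow gU gV φ) (hU : IsForce gU HU R c K)
    (hV : IsForce gV HV R c K) {U V : X → ℝ} (hgU : ∀ x, HasGradientAt U (gU x) x)
    (hgV : ∀ x, HasGradientAt V (gV x) x) (μ : Measure X) [μ.IsAddHaarMeasure]
    [IsProbabilityMeasure (μ.withDensity fun x => ENNReal.ofReal (Real.exp (-V x)))] (t : ℝ) :
    ((μ.withDensity fun x => ENNReal.ofReal (Real.exp (-U x))).prod
      (μ.withDensity fun x => ENNReal.ofReal (Real.exp (-V x)))).map (fun z => (φ t z).1) =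
    μ.withDensity fun x => ENNReal.ofReal (Real.exp (-U x)) := by
  have mU : Measurable fun x => ENNReal.ofReal (Real.exp (-U x)) := by
    have : Continuous U := continuous_iff_continuousAt.2 fun x => (hgU x).continuousAt
    fun_prop
  have mV : Measurable fun x => ENNReal.ofReal (Real.exp (-V x)) := by
    have : Continuous V := continuous_iff_continuousAt.2 fun x => (hgV x).continuousAt
    fun_prop
  have h1 := hφ.map_withDensity hU hV (μ.prod μ)
    (g := fun z => ENNReal.ofReal (Real.exp (-U z.1)) * ENNReal.ofReal (Real.exp (-V z.2))) (t := t)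
    (fun z => by
      rw [← ENNReal.ofReal_mul (Real.exp_pos _).le, ← ENNReal.ofReal_mul (Real.exp_pos _).le,
        ← Real.exp_add, ← Real.exp_add]
      have := (hφ.isHamCurve z).energy_eq hgU hgV t 0
      simp only [hφ.zero] at this
      congr 2
      linarith)
  rw [← prod_withDensity mU mV] at h1
  have h2 := Measure.map_map (μ := (μ.withDensity fun x => ENNReal.ofReal (Real.exp (-U x))).prod
      (μ.withDensity fun x => ENNReal.ofReal (Real.exp (-V x)))) measurable_fst
    (hφ.continuous hU hV t).measurable
  rw [h1, Measure.map_fst_prod, measure_univ, one_smul] at h2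
  exact h2.symm

end Hamiltonian

/-! ### Geometric convergence from drift and minorization. -/

section Convergence

open ProbabilityTheory

theorem iterate_bind {Y : Type*} [MeasurableSpace Y] (κ : Kernel Y Y) (n : ℕ) (μ : Measure Y) :
    (fun μ : Measure Y => μ.bind κ)^[n] μ = μ.bind (kernelIter κ n) := by
  induction n generalizing μ with
  | zero => simp [kernelIter, Measure.id_comp]
  | succ n ih =>
    rw [Function.iterate_succ_apply, ih, kernelIter, Measure.comp_assoc]

theorem bind_iterate_eq {Y : Type*} [MeasurableSpace Y] {κ : Kernel Y Y} {μ : Measure Y}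
    (h : μ.bind κ = μ) (n : ℕ) : μ.bind (kernelIter κ n) = μ := by
  rw [← iterate_bind]
  exact Function.iterate_fixed h n

/-- The marginals of a coupling kernel. -/
theorem map_bind_of_marginal {Y Z : Type*} [MeasurableSpace Y] [MeasurableSpace Z] {Q : Kernel Y Y}
    {C : Kernel Z Z} {f : Z → Y} (hf : Measurable f) (hC : ∀ z, (C z).map f = Q (f z))
    (γ : Measure Z) : (γ.bind C).map f = (γ.map f).bind Q := by
  ext S hS
  rw [Measure.map_apply hf hS, Measure.bind_apply (hf hS) C.aemeasurable,
    Measure.bind_apply hS Q.aemeasurable, lintegral_map (Q.measurable_coe hS) hf]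
  refine lintegral_congr fun z => ?_
  rw [← hC, Measure.map_apply hf hS]

theorem lintegral_iterate_bind_le {Z : Type*} [MeasurableSpace Z] {C : Kernel Z Z} {g : Z → ℝ≥0∞}
    (hg : Measurable g) {ρ : ℝ≥0∞} (h : ∀ z, ∫⁻ z', g z' ∂C z ≤ ρ * g z) (γ : Measure Z) (n : ℕ) :
    ∫⁻ z, g z ∂((fun γ : Measure Z => γ.bind C)^[n] γ) ≤ ρ ^ n * ∫⁻ z, g z ∂γ := by
  induction n with
  | zero => simp
  | succ n ih =>
    rw [Function.iterate_succ_apply', Measure.lintegral_bind C.aemeasurable hg.aemeasurable]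
    calc _ ≤ ∫⁻ z, ρ * g z ∂((fun γ : Measure Z => γ.bind C)^[n] γ) := lintegral_mono h
      _ = ρ * ∫⁻ z, g z ∂((fun γ : Measure Z => γ.bind C)^[n] γ) := lintegral_const_mul _ hg
      _ ≤ ρ * (ρ ^ n * ∫⁻ z, g z ∂γ) := by gcongr
      _ = _ := by rw [pow_succ']; ring

end Convergence

namespace ADHMC

open ProbabilityTheory

variable {m : ℕ}

theorem edist_le_weightedCost {W : E m → ℝ} {b β : ℝ} (hb : 0 < b) (hβ : 0 < β)
    (hbW : ∀ x, b * ‖x‖ ≤ W x) (z : E m × E m) :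
    edist z.1 z.2 ≤ ENNReal.ofReal (1 / (b * β)) *
      weightedCost (fun x => ENNReal.ofReal (β * W x)) z := by
  by_cases hz : z.1 = z.2
  · rw [hz, edist_self]; exact zero_le
  have h1 : ∀ x : E m, ‖x‖ₑ ≤ ENNReal.ofReal (1 / (b * β)) * ENNReal.ofReal (β * W x) := by
    intro x
    rw [← ofReal_norm, ← ENNReal.ofReal_mul (by positivity)]
    refine ENNReal.ofReal_le_ofReal ?_
    have : 1 / (b * β) * (β * W x) = W x / b := by field_simp
    rw [this, le_div_iff₀ hb, mul_comm]
    exact hbW x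
  rw [weightedCost, if_neg hz, mul_add, mul_add]
  calc edist z.1 z.2 ≤ edist z.1 0 + edist 0 z.2 := edist_triangle _ _ _
    _ = ‖z.1‖ₑ + ‖z.2‖ₑ := by rw [edist_zero_right, edist_zero_left]; rfl
    _ ≤ _ := by
      refine add_le_add ((h1 _).trans ?_) (h1 _)
      exact le_add_self

/-- A drift condition and a local minorization imply geometric convergence in `W₁`. -/
theorem convergesGeometrically_of_hasDrift {step : Measure (E m) → Measure (E m)}
    {P : Kernel (E m) (E m)} [IsMarkovKernel P]
    (hstep : ∀ μ, IsProbabilityMeasure μ → step μ = μ.bind P) {π : Measure (E m)}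
    [IsProbabilityMeasure π] (hπ : π.bind P = π) (hπ1 : ∫⁻ q, ‖q‖ₑ ∂π < ∞) {W : E m → ℝ}
    (hW : Measurable W) {b B l K : ℝ} (hb : 0 < b) (hbW : ∀ x, b * ‖x‖ ≤ W x) (hB : 0 < B)
    (hWB : ∀ x, W x ≤ B * (1 + ‖x‖)) (hl0 : 0 ≤ l) (hl1 : l < 1) (hK : 0 ≤ K)
    (hdrift : HasDrift P W l K)
    (hloc : ∀ q₀ : E m, ∃ ε, 0 < ε ∧ ∃ α : ℝ≥0∞, α ≠ 0 ∧ ∀ q ∈ Metric.ball q₀ ε, ∀ S,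
      MeasurableSet S → S ⊆ Metric.ball q₀ ε → α * volume S ≤ P q S) :
    ConvergesGeometrically step π := by
  have hW0 : ∀ x, 0 ≤ W x := fun x => (by positivity : 0 ≤ b * ‖x‖).trans (hbW x)
  have hl' : 0 < 1 - l := by linarith
  set K' := K / (1 - l) with hK'
  have hK'0 : 0 ≤ K' := by positivity
  have hiter : ∀ n, HasDrift (kernelIter P n) W (l ^ n) K' := fun n x => by
    refine (hdrift.iter hW hW0 hl0 hl1 hK n x).trans (ENNReal.ofReal_le_ofReal ?_)
    have : 0 ≤ l ^ n := by positivity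
    nlinarith [mul_nonneg hK'0 this]
  set r := (2 * K' + 1) / (1 - l) with hr
  have hr0 : 0 < r := by positivity
  have hrK : 2 * K' < (1 - l) * r := by rw [hr, mul_div_cancel₀ _ hl'.ne']; linarith
  obtain ⟨k, hk, δ, hδ, α, hα, hmin⟩ :=
    exists_minorization_of_local P volume hloc (r := r / b) (by positivity)
  have hdk : HasDrift (kernelIter P k) W l K' := fun x => by
    refine (hiter k x).trans (ENNReal.ofReal_le_ofReal ?_)
    have h1 : l ^ k ≤ l := pow_le_of_le_one hl0 hl1.le hk.ne'
    have := mul_le_mul_of_nonneg_right h1 (hW0 x)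
    linarith
  set v := volume (Metric.ball (0 : E m) δ) with hv
  have hv0 : v ≠ 0 := (Metric.measure_ball_pos _ _ hδ).ne'
  have hvt : v ≠ ∞ := measure_ball_lt_top.ne
  -- The minorizing measure is shrunk to mass at most `1 / 2`, because the coupling needs a mass
  -- strictly below `1`.
  set s := min α (2 * v)⁻¹ with hs
  have hs0 : s ≠ 0 := by
    have : (2 * v)⁻¹ ≠ 0 := ENNReal.inv_ne_zero.2 (ENNReal.mul_ne_top (by simp) hvt)
    rw [hs, ← pos_iff_ne_zero]
    exact lt_min (pos_iff_ne_zero.2 hα) (pos_iff_ne_zero.2 this)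
  have hsv : s * v ≤ 2⁻¹ := by
    calc s * v ≤ (2 * v)⁻¹ * v := by gcongr; exact min_le_right _ _
      _ = 2⁻¹ := by
        rw [ENNReal.mul_inv (by simp) (by simp), mul_assoc, ENNReal.inv_mul_cancel hv0 hvt, mul_one]
  have hsvt : s * v ≠ ∞ := ne_top_of_le_ne_top (by simp) hsv
  obtain ⟨β, ρ, hβ, hρ0, hρ1, C, hC, hC1, hC2, hCρ⟩ := exists_contracting_coupling
    (kernelIter P k) hW hW0 (θ := (s * v).toReal) hl0 hl1 hK'0 hrK hdk
    (ENNReal.toReal_pos (mul_ne_zero hs0 hv0) hsvt)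
    ((ENNReal.toReal_mono (by simp) hsv).trans_lt (by norm_num))
    (s • volume.restrict (Metric.ball (0 : E m) δ))
    (by rw [ENNReal.ofReal_toReal hsvt]; simp [hv]) (fun x hx => by
      refine Measure.le_iff.2 fun S hS => ?_
      rw [Measure.smul_apply, Measure.restrict_apply hS, smul_eq_mul]
      have hxr : ‖x‖ ≤ r / b := by
        rw [le_div_iff₀ hb, mul_comm]; exact (hbW x).trans hx
      calc s * volume (S ∩ Metric.ball (0 : E m) δ) ≤ α * volume (S ∩ Metric.ball (0 : E m) δ) := by
            gcongr; exact min_le_left _ _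
        _ ≤ kernelIter P k x (S ∩ Metric.ball (0 : E m) δ) := hmin x hxr _
            (hS.inter Metric.isOpen_ball.measurableSet) inter_subset_right
        _ ≤ _ := measure_mono inter_subset_left)
  set w : E m → ℝ≥0∞ := fun x => ENNReal.ofReal (β * W x) with hw
  have hwm : Measurable w := (hW.const_mul β).ennreal_ofReal
  have hcm := measurable_weightedCost hwm
  have hWμ : ∀ μ : Measure (E m), IsProbabilityMeasure μ → ∫⁻ x, ENNReal.ofReal (W x) ∂μ ≤
      ENNReal.ofReal B * (1 + ∫⁻ q, ‖q‖ₑ ∂μ) := by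
    intro μ _
    calc ∫⁻ x, ENNReal.ofReal (W x) ∂μ ≤ ∫⁻ x, ENNReal.ofReal B * (1 + ‖x‖ₑ) ∂μ := by
          refine lintegral_mono fun x => ?_
          rw [← ofReal_norm, ← ENNReal.ofReal_one, ← ENNReal.ofReal_add zero_le_one (norm_nonneg x),
            ← ENNReal.ofReal_mul hB.le]
          exact ENNReal.ofReal_le_ofReal (hWB x)
      _ = _ := by
        rw [lintegral_const_mul _ (by fun_prop), lintegral_add_left measurable_const]
        simp
  set M := ∫⁻ x, w x ∂π with hM
  have hwW : ∀ μ : Measure (E m), ∫⁻ x, w x ∂μ = ENNReal.ofReal β * ∫⁻ x, ENNReal.ofReal (W x) ∂μ := by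
    intro μ
    rw [← lintegral_const_mul _ hW.ennreal_ofReal]
    simp only [hw, ENNReal.ofReal_mul hβ.le]
  have hMt : M ≠ ∞ := by
    rw [hM, hwW]
    refine ENNReal.mul_ne_top ENNReal.ofReal_ne_top (ne_top_of_le_ne_top ?_ (hWμ π inferInstance))
    exact ENNReal.mul_ne_top ENNReal.ofReal_ne_top (ENNReal.add_ne_top.2 ⟨by simp, hπ1.ne⟩)
  set A := 2 + (β * (B + K') + M.toReal) with hA
  have hMr : 0 ≤ M.toReal := ENNReal.toReal_nonneg
  have hA0 : 0 < A := by positivity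
  have hk' : (0 : ℝ) < k := by exact_mod_cast hk
  -- The coupling contracts by `ρ` once every `k` steps, hence the rate `ρ ^ (1 / k)`. The remaining
  -- `n % k` steps cost at most the factor `1 / ρ` in the constant.
  set σ := ρ ^ (1 / (k : ℝ)) with hσ
  have hσ0 : 0 < σ := Real.rpow_pos_of_pos hρ0 _
  have hσ1 : σ < 1 := Real.rpow_lt_one hρ0.le hρ1 (by positivity)
  have hσk : σ ^ k = ρ := by
    rw [hσ, ← Real.rpow_natCast, ← Real.rpow_mul hρ0.le, one_div_mul_cancel hk'.ne', Real.rpow_one]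
  refine ⟨1 / (b * β) * A / ρ, σ, by positivity, hσ0, hσ1, fun μ hμ hμ1 n => ?_⟩
  have hstep' : ∀ n, step^[n] μ = μ.bind (kernelIter P n) := by
    intro n
    rw [← iterate_bind]
    induction n with
    | zero => rfl
    | succ n ih =>
      rw [Function.iterate_succ_apply', Function.iterate_succ_apply', ih]
      refine hstep _ ?_
      rw [iterate_bind]
      infer_instance
  set j := n / k with hj
  set i := n % k with hi
  have hn : n = k * j + i := (Nat.div_add_mod n k).symm
  set μi := μ.bind (kernelIter P i) with hμi
  have hμip : IsProbabilityMeasure μi := by rw [hμi]; infer_instance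
  -- The remaining `i` steps are made first, with the drift bounding the moment of `μi`. The
  -- coupling then starts from the independent pair of `μi` and `π` and contracts `j` times.
  set γ := (fun γ : Measure (E m × E m) => γ.bind C)^[j] (μi.prod π) with hγ
  have hmarg : ∀ f : E m × E m → E m, Measurable f →
      (∀ z, (C z).map f = kernelIter P k (f z)) →
      γ.map f = (fun μ : Measure (E m) => μ.bind (kernelIter P k))^[j] ((μi.prod π).map f) := by
    intro f hf hCf
    rw [hγ]
    clear_value j
    clear hγ hn hj
    induction j with
    | zero => rfl
    | succ j ih =>
      rw [Function.iterate_succ_apply', Function.iterate_succ_apply', ← ih]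
      exact map_bind_of_marginal hf hCf _
  have hγ1 : γ.map Prod.fst = step^[n] μ := by
    have h1 : ∀ ν : Measure (E m), (fun μ : Measure (E m) => μ.bind (kernelIter P k)) ν =
        (fun μ : Measure (E m) => μ.bind P)^[k] ν := fun ν => (iterate_bind P k ν).symm
    rw [hmarg _ measurable_fst hC1, Measure.map_fst_prod, measure_univ, one_smul, funext h1,
      ← Function.iterate_mul, hμi, ← iterate_bind, ← Function.iterate_add_apply, ← hn,
      iterate_bind, hstep']
  have hγ2 : γ.map Prod.snd = π := by
    rw [hmarg _ measurable_snd hC2, Measure.map_snd_prod, measure_univ, one_smul]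
    exact Function.iterate_fixed (bind_iterate_eq hπ k) j
  have hcost0 : ∫⁻ z, weightedCost w z ∂μi.prod π ≤
      ENNReal.ofReal A * (1 + ∫⁻ q, ‖q‖ₑ ∂μ) := by
    refine (lintegral_weightedCost_prod_le hwm _ _).trans ?_
    simp only [measure_univ, mul_one, one_mul]
    have h1 : ∫⁻ x, w x ∂μi ≤ ENNReal.ofReal (β * (B + K')) * (1 + ∫⁻ q, ‖q‖ₑ ∂μ) := by
      rw [hwW, ENNReal.ofReal_mul hβ.le, mul_assoc]
      gcongr
      refine ((hiter i).lintegral_le hW hW0 (by positivity) hK'0 μ).trans ?_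
      rw [ENNReal.ofReal_add hB.le hK'0, add_mul]
      refine add_le_add ?_ (le_mul_of_one_le_right' le_self_add)
      calc _ ≤ 1 * ∫⁻ x, ENNReal.ofReal (W x) ∂μ := by
            gcongr
            rw [← ENNReal.ofReal_one]
            exact ENNReal.ofReal_le_ofReal (pow_le_one₀ hl0 hl1.le)
        _ ≤ _ := by rw [one_mul]; exact hWμ μ hμ
    rw [hA, ENNReal.ofReal_add (by norm_num) (by positivity), ENNReal.ofReal_add (by positivity) hMr,
      ENNReal.ofReal_toReal hMt, add_mul, add_mul, ← add_assoc]
    refine add_le_add (add_le_add ?_ h1) (le_mul_of_one_le_right' le_self_add)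
    rw [ENNReal.ofReal_ofNat]
    exact le_mul_of_one_le_right' le_self_add
  have hcost : ∫⁻ z, weightedCost w z ∂γ ≤
      ENNReal.ofReal ρ ^ j * (ENNReal.ofReal A * (1 + ∫⁻ q, ‖q‖ₑ ∂μ)) :=
    (lintegral_iterate_bind_le hcm hCρ _ j).trans (by gcongr)
  have hρj : ρ ^ j ≤ σ ^ n / ρ := by
    rw [le_div_iff₀ hρ0, hn, pow_add, pow_mul, hσk]
    have : ρ ≤ σ ^ i := by
      rw [← hσk]
      exact pow_le_pow_of_le_one hσ0.le hσ1.le (Nat.mod_lt n hk).le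
    gcongr
  calc W1 (step^[n] μ) π ≤ ∫⁻ z, edist z.1 z.2 ∂γ := iInf₂_le γ ⟨hγ1, hγ2⟩
    _ ≤ ∫⁻ z, ENNReal.ofReal (1 / (b * β)) * weightedCost w z ∂γ :=
      lintegral_mono (edist_le_weightedCost hb hβ hbW)
    _ = ENNReal.ofReal (1 / (b * β)) * ∫⁻ z, weightedCost w z ∂γ := lintegral_const_mul _ hcm
    _ ≤ ENNReal.ofReal (1 / (b * β)) *
        (ENNReal.ofReal ρ ^ j * (ENNReal.ofReal A * (1 + ∫⁻ q, ‖q‖ₑ ∂μ))) := by gcongr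
    _ = ENNReal.ofReal (1 / (b * β) * (ρ ^ j * A)) * (1 + ∫⁻ q, ‖q‖ₑ ∂μ) := by
      rw [ENNReal.ofReal_mul (by positivity), ENNReal.ofReal_mul (by positivity),
        ENNReal.ofReal_pow hρ0.le]
      ring
    _ ≤ _ := by
      refine mul_le_mul_left (ENNReal.ofReal_le_ofReal ?_) _
      calc 1 / (b * β) * (ρ ^ j * A) ≤ 1 / (b * β) * (σ ^ n / ρ * A) := by gcongr
        _ = 1 / (b * β) * A / ρ * σ ^ n := by ring

end ADHMC

/-! ### The convergence theorem. -/

open ADHMC ProbabilityTheory in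
theorem mainTheorem6 (m : ℕ) (hm : 0 < m)
    (target aux : ADHMC.E m → ℝ)
    (htarget : ADHMC.IsRegularDensity target) (haux : ADHMC.IsRegularDensity aux)
    (R : ℝ) (hR : 0 < R)
    (hlc_target : ADHMC.StrictlyLogConcaveOutside target R)
    (hlc_aux : ADHMC.StrictlyLogConcaveOutside aux R)
    (T : ℝ) (hT : 0 < T)
    (hTA : ENNReal.ofReal T < ENNReal.ofReal Real.pi /
      ADHMC.normAOutside (ADHMC.energy target) (ADHMC.energy aux) R T) :
    ADHMC.ConvergesGeometrically (ADHMC.adhmcStep target aux T)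
      (ADHMC.densityMeasure target) := by
  have : Nonempty (Fin m) := ⟨⟨0, hm⟩⟩
  have : IsProbabilityMeasure (densityMeasure target) := htarget.isProbabilityMeasure
  have : IsProbabilityMeasure (densityMeasure aux) := haux.isProbabilityMeasure
  obtain ⟨c₁, K₁, h₁⟩ := htarget.exists_isForce hR hlc_target
  obtain ⟨c₂, K₂, h₂⟩ := haux.exists_isForce hR hlc_aux
  have hc0 : 0 < min c₁ c₂ := lt_min h₁.c_pos h₂.c_pos
  have hU := h₁.mono hc0 (min_le_left _ _) (le_max_left K₁ K₂)
  have hV := h₂.mono hc0 (min_le_right _ _) (le_max_right K₁ K₂)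
  clear h₁ h₂
  generalize min c₁ c₂ = c at *
  generalize max K₁ K₂ = K at *
  set U := energy target with hUdef
  set V := energy aux with hVdef
  have hφ := isHamFlow_motion hU hV
  have gU : ∀ x, HasGradientAt U (gradient U x) x := htarget.hasGradientAt_energy
  have gV : ∀ x, HasGradientAt V (gradient V x) x := haux.hasGradientAt_energy
  obtain ⟨a, ha, hNa, haT⟩ := exists_frequency_bound hT hTA
  have hform : ∀ q p, R < ‖q‖ → R < ‖p‖ → ∀ v, inner ℝ (hess U q (hess V p v)) (hess V p v) ≤
      a ^ 2 * inner ℝ (hess V p v) v :=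
    fun q p hq hp => form_le_of_normAOutside_le hU hV ha hT hNa hq hp
  have hmeas : ∀ t, Measurable fun z => (motion U V t z).1 :=
    fun t => (hφ.continuous hU hV t).fst.measurable
  set ν := densityMeasure aux with hν
  set κ : ℝ → Kernel (E m) (E m) := fun t => moveKernel ν fun z => (motion U V t z).1 with hκ
  have hκm : ∀ t, IsMarkovKernel (κ t) := fun t => isMarkovKernel_moveKernel (hmeas t)
  have hmove : ∀ t μ, IsProbabilityMeasure μ → hmcMove target aux t μ = μ.bind (κ t) :=
    fun t μ _ => (bind_moveKernel (hmeas t) μ).symm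
  have hstep : ∀ μ, IsProbabilityMeasure μ →
      adhmcStep target aux T μ = μ.bind (κ (-T) ∘ₖ κ T) := fun μ _ => by
    rw [adhmcStep, hmove T μ inferInstance, hmove (-T) _ inferInstance, Measure.comp_assoc]
  have hdt : (fun x => ENNReal.ofReal (Real.exp (-U x))) = fun x => ENNReal.ofReal (target x) :=
    funext fun x => congrArg _ (htarget.exp_neg_energy x)
  have hda : (fun x => ENNReal.ofReal (Real.exp (-V x))) = fun x => ENNReal.ofReal (aux x) :=
    funext fun x => congrArg _ (haux.exp_neg_energy x)
  have hinv : ∀ t, (densityMeasure target).bind (κ t) = densityMeasure target := by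
    intro t
    have hp : IsProbabilityMeasure (volume.withDensity fun x => ENNReal.ofReal (Real.exp (-V x))) := by
      rw [hda]; assumption
    have := hφ.map_prod_withDensity hU hV gU gV volume t
    rw [hdt, hda] at this
    rw [hκ, bind_moveKernel (hmeas t)]
    exact this
  have hinv' : (densityMeasure target).bind (κ (-T) ∘ₖ κ T) = densityMeasure target := by
    rw [← Measure.comp_assoc, hinv, hinv]
  obtain ⟨A₁, hA₁, hUA⟩ := hU.potential_bounds gU
  obtain ⟨A₂, hA₂, hVA⟩ := hV.potential_bounds gV
  have hmoment : ∀ {f : E m → ℝ} {A : ℝ}, IsRegularDensity f →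
      (∀ x, c / 4 * ‖x‖ ^ 2 - A ≤ energy f x) → ∫⁻ x, ‖x‖ₑ ∂densityMeasure f < ∞ := by
    intro f A hf hfA
    have h1 := lintegral_enorm_lt_top_of_quadratic (by positivity) hfA
    simp only [hf.exp_neg_energy] at h1
    have hfm : Measurable fun x => ENNReal.ofReal (f x) := hf.contDiff.continuous.measurable.ennreal_ofReal
    rw [densityMeasure, lintegral_withDensity_eq_lintegral_mul _ hfm (by fun_prop)]
    simpa only [Pi.mul_apply, mul_comm] using h1
  set A := max A₁ A₂ with hA
  have hA0 : 0 < A := lt_max_of_lt_left hA₁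
  have hUA' : ∀ x, U x ≤ A * (1 + ‖x‖) ^ 2 ∧ c / 4 * ‖x‖ ^ 2 - A ≤ U x := fun x =>
    ⟨(hUA x).1.trans (by gcongr; exact le_max_left _ _),
      (sub_le_sub_left (le_max_left _ _) _).trans (hUA x).2⟩
  have hVA' : ∀ x, V x ≤ A * (1 + ‖x‖) ^ 2 ∧ c / 4 * ‖x‖ ^ 2 - A ≤ V x := fun x =>
    ⟨(hVA x).1.trans (by gcongr; exact le_max_right _ _),
      (sub_le_sub_left (le_max_right _ _) _).trans (hVA x).2⟩
  obtain ⟨D, hD, hbc⟩ := boundary_control_abs hU hV ha hT haT hform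
  obtain ⟨l, B, hl0, hl1, hB, hdrift⟩ := sqrt_energy_drift hc0 hA0 hD hUA' hVA'
  set W : E m → ℝ := fun q => √(U q + A + 1) with hW
  have hUc : Continuous U := htarget.contDiff_energy.continuous
  have hWm : Measurable W := by
    have : Continuous W := by fun_prop
    exact this.measurable
  have hW0 : ∀ x, 0 ≤ W x := fun x => Real.sqrt_nonneg _
  set I := ∫⁻ p, ENNReal.ofReal (B * (1 + ‖p‖)) ∂ν with hI
  have hIt : I ≠ ∞ := by
    have h1 : ∀ p : E m, ENNReal.ofReal (B * (1 + ‖p‖)) = ENNReal.ofReal B * (1 + ‖p‖ₑ) := by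
      intro p
      rw [ENNReal.ofReal_mul hB.le, ENNReal.ofReal_add zero_le_one (norm_nonneg p), ofReal_norm,
        ENNReal.ofReal_one]
    simp only [hI, h1]
    rw [lintegral_const_mul _ (by fun_prop), lintegral_add_left measurable_const]
    refine ENNReal.mul_ne_top ENNReal.ofReal_ne_top (ENNReal.add_ne_top.2 ⟨by simp, ?_⟩)
    exact (hmoment haux fun x => (hVA' x).2).ne
  -- The pathwise drift is averaged over the fresh momentum, which contributes only its first moment
  -- `I`. It holds for either sign of `t`, so the two moves compose to a drift with factor `l * l`.
  have hκd : ∀ t, |t| = T → HasDrift (κ t) W l I.toReal := by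
    intro t ht q
    rw [hκ, lintegral_moveKernel (hmeas t) hWm.ennreal_ofReal]
    have h1 : ∀ p, W (motion U V t (q, p)).1 ≤ l * W q + B * (1 + ‖p‖) := fun p => by
      have hz := hφ.isHamCurve (q, p)
      refine hdrift q p _ (motion U V t (q, p)).2 ?_ ?_
      · have := hz.energy_eq gU gV t 0
        simpa only [hφ.zero] using this
      · have := hbc t ht _ hz
        simpa only [hφ.zero] using this
    have h2 : 0 ≤ l * W q := mul_nonneg hl0 (hW0 q)
    calc _ ≤ ∫⁻ p, ENNReal.ofReal (l * W q) + ENNReal.ofReal (B * (1 + ‖p‖)) ∂ν := by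
          refine lintegral_mono fun p => ?_
          rw [← ENNReal.ofReal_add h2 (by positivity)]
          exact ENNReal.ofReal_le_ofReal (h1 p)
      _ = ENNReal.ofReal (l * W q) + I := by
          rw [lintegral_add_left measurable_const, lintegral_const, measure_univ, mul_one]
      _ = _ := by rw [ENNReal.ofReal_add h2 ENNReal.toReal_nonneg, ENNReal.ofReal_toReal hIt]
  have hI0 : 0 ≤ I.toReal := ENNReal.toReal_nonneg
  have hPd := HasDrift.comp hWm hW0 hl0 hI0 hl0 hI0 (hκd T (abs_of_pos hT))
    (hκd (-T) (by rw [abs_neg, abs_of_pos hT]))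
  refine convergesGeometrically_of_hasDrift hstep hinv' (hmoment htarget fun x => (hUA' x).2) hWm
    (b := √(c / 4)) (B := √(2 * A + 1)) (Real.sqrt_pos.2 (by positivity)) (fun x => ?_)
    (Real.sqrt_pos.2 (by positivity)) (fun x => ?_) (by positivity) (by nlinarith)
    (by positivity) hPd fun q₀ => ?_
  · rw [← Real.sqrt_sq (norm_nonneg x), ← Real.sqrt_mul (by positivity)]
    refine Real.sqrt_le_sqrt ?_
    linarith [(hUA' x).2]
  · rw [← Real.sqrt_sq (by positivity : 0 ≤ 1 + ‖x‖), ← Real.sqrt_mul (by positivity)]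
    refine Real.sqrt_le_sqrt ?_
    have h0 : 1 ≤ (1 + ‖x‖) ^ 2 := one_le_pow₀ (by linarith [norm_nonneg x])
    nlinarith [(hUA' x).1]
  · exact exists_minorization_forward_backward hφ hU hV ha hT haT hform volume ν
      (fun x => haux.exists_mul_volume_le x 1) q₀
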